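/- Let $S_n$ be the symmetric group, $\ell(w)$ the number of inversions of $w$, and $\ell(x,y)=\ell(y)-\ell(x)$. Write $x\to y$ if $yx^{-1}$ is a transposition and $\ell(x)<\ell(y)$; this edge of the Bruhat graph is labelled by $yx^{-1}$. Bruhat order is defined by $x\le y$ iff there is a directed path from $x$ to $y$, and $\Gamma(u,v)$ denotes the induced subgraph of the Bruhat graph on the interval $[u,v]$. A $k$-hypercube in $\Gamma(u,v)$ is a (not necessarily induced) subgraph isomorphic to the Hasse diagram, directed upwards, of the Boolean lattice of subsets of a $k$-element set; it is spanned by the set of the $k$ endpoints of the edges leaving its bottom vertex. A $2$-hypercube is called a diamond. For $I\subseteq[u,v]$ and $x\in I$ let $$\mathcal Y_x=\{y\in[u,v]\setminus I : x\to y\},\qquad \mathcal A_x=\{Y\subseteq\mathcal Y_x : Y\text{ is an antichain in Bruhat order}\}.$$ There is a hypercube cluster at $x$ (relative to $I$) if for every $Y\in\mathcal A_x$ there is a unique hypercube in $\Gamma(u,v)$ with bottom vertex $x$ that is spanned by $Y$; its top vertex is then denoted $\theta_x(Y)$. A hypercube decomposition of $[u,v]$ is a set $I=[u,z]$ with $z\in[u,v]$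 such that (a) whenever $I$ contains three vertices of a diamond of $\Gamma(u,v)$, it contains the fourth, and (b) for every $x\in I$ there is a hypercube cluster at $x$ relative to $I$. A reflection order is a strict total order $\prec$ on the transpositions of $S_n$ such that for all $a<b<c$ either $(a\,b)\prec(a\,c)\prec(b\,c)$ or $(b\,c)\prec(a\,c)\prec(a\,b)$. **Theorem.** Let $v\in S_n$ and let $I$ be any hypercube decomposition of the lower interval $[e,v]$. Then: 1. $I$ has property (E): for every $x\in I$ there is a reflection order $\prec$ such that, whenever $x_1,x_2,x_3\in I\cap[x,v]$, $y\in[x,v]\setminus I$, $x_1\to x_2$ is an edge with label $t_1$ and $x_3\to y$ is an edge with label $t_2$, one has $t_1\prec t_2$. 2. The hypercube cluster at $e$ is strong: for all $Y_1,Y_2\in\mathcal A_e$ with $|Y_1|=|Y_2|=|Y_1\cap Y_2|+1$ and all $w$, if $\Gamma(e,v)$ contains a diamond with bottom vertex $\theta_e(Y_1\cap Y_2)$, middle vertices $\theta_e(Y_1)\ne\theta_e(Y_2)$ and top vertex $w$, then $Y_1\cup Y_2$ is an antichain and $\theta_e(Y_1\cup Y_2)=w$. 3. The hypercube cluster at $e$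 satisfies the numerical criterion: for every $Y\in\mathcal A_e$, $$\frac{\ell(e,\theta_e(Y))+|Y|}{2}=|\Lambda(Y)|,$$ where $\Lambda(Y)=\{y\in\mathcal Y_e : y\le y'\text{ for some }y'\in Y\}$. -/

import Mathlib

namespace BruhatCube

open Equiv

variable {n : ℕ}

/-- The Coxeter length on the symmetric group of `{0, …, n-1}`: the number of inversions. -/
def length (w : Perm (Fin n)) : ℕ :=
  (Finset.univ.filter fun p : Fin n × Fin n => p.1 < p.2 ∧ w p.2 < w p.1).card

/-- The reflections of the symmetric group, i.e. the transpositions. -/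
abbrev Reflection (n : ℕ) : Type := {t : Perm (Fin n) // t.IsSwap}

/-- The reflection exchanging `a` and `b`. -/
def reflOf (a b : Fin n) (h : a ≠ b) : Reflection n := ⟨swap a b, a, b, h, rfl⟩

/-- The edges `x → y` of the Bruhat graph; such an edge is labelled by `y * x⁻¹`. -/
def Edge (x y : Perm (Fin n)) : Prop :=
  (y * x⁻¹).IsSwap ∧ length x < length y

/-- Bruhat order: there is a (possibly empty) directed path from `x` to `y`. -/
def BruhatLE (x y : Perm (Fin n)) : Prop := Relation.ReflTransGen Edge x y

/-- The Bruhat interval `[u, v]`. -/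
def Interval (u v : Perm (Fin n)) : Set (Perm (Fin n)) := {w | BruhatLE u w ∧ BruhatLE w v}

/-- A reflection order for the symmetric group, as a strict total order on reflections. -/
def IsReflectionOrder (r : Reflection n → Reflection n → Prop) : Prop :=
  IsStrictTotalOrder (Reflection n) r ∧
    ∀ (a b c : Fin n) (hab : a < b) (hbc : b < c),
      (r (reflOf a b hab.ne) (reflOf a c (hab.trans hbc).ne) ∧
        r (reflOf a c (hab.trans hbc).ne) (reflOf b c hbc.ne)) ∨
      (r (reflOf b c hbc.ne) (reflOf a c (hab.trans hbc).ne) ∧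
        r (reflOf a c (hab.trans hbc).ne) (reflOf a b hab.ne))

/-- `a → b → d`, `a → c → d` is a diamond (a `2`-hypercube) in `Γ(u, v)`. -/
structure IsDiamond (u v a b c d : Perm (Fin n)) : Prop where
  mem_bot : a ∈ Interval u v
  mem_left : b ∈ Interval u v
  mem_right : c ∈ Interval u v
  mem_top : d ∈ Interval u v
  ne : b ≠ c
  bot_left : Edge a b
  bot_right : Edge a c
  left_top : Edge b d
  right_top : Edge c d

/-- `I` contains the fourth vertex of every diamond of `Γ(u, v)` of which it contains three. -/
def DiamondClosed (u v : Perm (Fin n)) (I : Set (Perm (Fin n))) : Prop :=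
  ∀ a b c d, IsDiamond u v a b c d →
    (a ∈ I → b ∈ I → c ∈ I → d ∈ I) ∧ (a ∈ I → b ∈ I → d ∈ I → c ∈ I) ∧
    (a ∈ I → c ∈ I → d ∈ I → b ∈ I) ∧ (b ∈ I → c ∈ I → d ∈ I → a ∈ I)

/-- `φ` is a hypercube in `Γ(u, v)` with bottom vertex `x`, spanned by `Y`: an embedding into
`Γ(u, v)` of the Hasse diagram of the Boolean lattice of subsets of `Y` which sends `∅` to `x` and
`{y}` to `y`. An automorphism of the Hasse diagram that fixes all atoms is the identity, so the
subgraphs of `Γ(u, v)` that are hypercubes with bottom `x` spanned by `Y` correspond bijectively to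
these maps `φ`. The top vertex is `φ Finset.univ`. -/
structure IsHypercube (u v x : Perm (Fin n)) (Y : Finset (Perm (Fin n)))
    (φ : Finset Y → Perm (Fin n)) : Prop where
  mem : ∀ A, φ A ∈ Interval u v
  injective : Function.Injective φ
  edge : ∀ A B, A ⋖ B → Edge (φ A) (φ B)
  bot : φ ∅ = x
  atom : ∀ y : Y, φ {y} = y

/-- The set `𝒴_x` of `y ∈ [u, v] \ I` with `x → y`. -/
def Out (u v : Perm (Fin n)) (I : Set (Perm (Fin n))) (x : Perm (Fin n)) : Set (Perm (Fin n)) :=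
  {y | y ∈ Interval u v ∧ y ∉ I ∧ Edge x y}

/-- The set `𝒜_x` of antichains (in Bruhat order) contained in `𝒴_x`. -/
def Antichains (u v : Perm (Fin n)) (I : Set (Perm (Fin n))) (x : Perm (Fin n)) :
    Set (Finset (Perm (Fin n))) :=
  {Y | (Y : Set (Perm (Fin n))) ⊆ Out u v I x ∧ IsAntichain BruhatLE (Y : Set (Perm (Fin n)))}

/-- There is a hypercube cluster at `x` relative to `I ⊆ [u, v]`. -/
def HasCluster (u v : Perm (Fin n)) (I : Set (Perm (Fin n))) (x : Perm (Fin n)) : Prop :=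
  ∀ Y ∈ Antichains u v I x, ∃! φ : Finset Y → Perm (Fin n), IsHypercube u v x Y φ

open Classical in
/-- The hypercube map `θ_x`: the top vertex of the hypercube with bottom `x` spanned by `Y`.
It is only used at antichains `Y ∈ 𝒜_x` where there is a hypercube cluster at `x`, so that this
hypercube exists and is unique; the value is `x` if there is no such hypercube. -/
noncomputable def theta (u v x : Perm (Fin n)) (Y : Finset (Perm (Fin n))) : Perm (Fin n) :=
  if h : ∃ φ : Finset Y → Perm (Fin n), IsHypercube u v x Y φ then h.choose Finset.univ else x

/-- Hypercube decompositions of `[u, v]`. -/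
structure IsHypercubeDecomposition (u v : Perm (Fin n)) (I : Set (Perm (Fin n))) : Prop where
  principal : ∃ z ∈ Interval u v, I = Interval u z
  diamondClosed : DiamondClosed u v I
  cluster : ∀ x ∈ I, HasCluster u v I x

/-- The hypercube cluster at `x` relative to `I` is strong. -/
def IsStrongCluster (u v : Perm (Fin n)) (I : Set (Perm (Fin n))) (x : Perm (Fin n)) : Prop :=
  HasCluster u v I x ∧
    ∀ Y₁ ∈ Antichains u v I x, ∀ Y₂ ∈ Antichains u v I x,
      Y₁.card = Y₂.card → Y₂.card = (Y₁ ∩ Y₂).card + 1 →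
      ∀ w, IsDiamond u v (theta u v x (Y₁ ∩ Y₂)) (theta u v x Y₁) (theta u v x Y₂) w →
        IsAntichain BruhatLE ((Y₁ ∪ Y₂ : Finset (Perm (Fin n))) : Set (Perm (Fin n))) ∧
          theta u v x (Y₁ ∪ Y₂) = w

/-- The order ideal `Λ(Y)` of `(𝒴_x, ≤)` generated by `Y`. -/
def Lam (u v : Perm (Fin n)) (I : Set (Perm (Fin n))) (x : Perm (Fin n))
    (Y : Finset (Perm (Fin n))) : Set (Perm (Fin n)) :=
  {y | y ∈ Out u v I x ∧ ∃ y' ∈ Y, BruhatLE y y'}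

/-- The hypercube cluster at `x` relative to `I` satisfies the numerical criterion. -/
def NumericalCriterion (u v : Perm (Fin n)) (I : Set (Perm (Fin n))) (x : Perm (Fin n)) : Prop :=
  HasCluster u v I x ∧
    ∀ Y ∈ Antichains u v I x,
      (((length (theta u v x Y) : ℚ) - (length x : ℚ)) + (Y.card : ℚ)) / 2 =
        ((Lam u v I x Y).ncard : ℚ)

/-- Property (E) at `x`, relative to `I ⊆ [u, v]`. -/
def PropertyEAt (v : Perm (Fin n)) (I : Set (Perm (Fin n))) (x : Perm (Fin n)) : Prop :=
  ∃ r : Reflection n → Reflection n → Prop, IsReflectionOrder r ∧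
    ∀ x₁ ∈ I ∩ Interval x v, ∀ x₂ ∈ I ∩ Interval x v, ∀ x₃ ∈ I ∩ Interval x v,
      ∀ y ∈ Interval x v \ I, ∀ (h₁ : Edge x₁ x₂) (h₂ : Edge x₃ y),
        r ⟨x₂ * x₁⁻¹, h₁.1⟩ ⟨y * x₃⁻¹, h₂.1⟩

/-- `I ⊆ [u, v]` has property (E): this holds at all `x ∈ I`. -/
def PropertyE (v : Perm (Fin n)) (I : Set (Perm (Fin n))) : Prop :=
  ∀ x ∈ I, PropertyEAt v I x

end BruhatCube

namespace BruhatCube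

open Equiv

variable {n : ℕ}

/-! ### Length and edges -/

/-! Call `j` a cut if `(j j+1)` lies in `[e, v]` but not in `I`. A permutation that is neither `1`
nor a simple transposition is the top of a diamond. Diamond closure and induction on length
therefore show that `I` consists of the elements of `[e, v]` preserving `{0, …, j}` for every cut
`j`: it is the intersection of `[e, v]` with a Young subgroup. Labels of edges inside `I` lie in
this subgroup, labels of edges leaving `I` do not, and some reflection order begins with the
reflections of the subgroup. This gives (E), in `propertyE`.

For transpositions Bruhat order is containment of intervals (`swap_le_swap_iff`). Existence and
uniqueness of hypercubes at `e` and at a few other points of `I` exclude three configurations: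
`not_swap_le_of_cuts`, `not_swap_le_of_cut` and `not_overlap`. Hence every `(a b)` in `𝒴_e`, `a <
b`, crosses exactly one cut `j`, satisfies `a = j` or `b = j + 1`, and intervals belonging to
different cuts follow one another, sharing at most an endpoint. So an antichain in `𝒴_e` is linearly
ordered from left to right.

Let `z = (p q)` be an extreme element of an antichain `Y ∪ {z}`. The other elements fix `q`, and `p`
is either fixed by them as well or is the endpoint facing `q` of everything they move (`IsEnd`).
Then `θ(Y ∪ {z})` is `θ(Y) z` or `z θ(Y)`, the side being the same for all subsets of `Y`
(`orientation`, `Cube.insert_eq_mul`).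

Strongness follows by stripping extreme elements off `Y₁ ∩ Y₂` until the two remaining elements are
themselves the extremes (`DiamondsFill.of_erase`); there the top of the diamond is one of two
explicit products, and both agree with `θ(Y₁ ∪ Y₂)` (`diamondsFill_of_ends`). The numerical
criterion is an induction in which the rightmost transposition is added: the gain in length and the
number of new elements of `Λ` are both counted explicitly (`length_theta_insert`). -/

theorem length_eq_sum (w : Perm (Fin n)) :
    length w = ∑ a, ∑ b, if a < b ∧ w b < w a then 1 else 0 := by
  rw [length, Finset.card_filter, ← Finset.univ_product_univ, Finset.sum_product]

theorem sum_sum_split (g : Fin n → Fin n → ℕ) {i j : Fin n} (h : i ≠ j) :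
    ∑ a, ∑ b, g a b =
      (∑ a ∈ (Finset.univ.erase i).erase j, ∑ b ∈ (Finset.univ.erase i).erase j, g a b) +
      (∑ m ∈ (Finset.univ.erase i).erase j, (g m i + g m j + g i m + g j m)) +
      (g i i + g i j + g j i + g j j) := by
  have key : ∀ f : Fin n → ℕ, ∑ b, f b =
      (∑ b ∈ (Finset.univ.erase i).erase j, f b) + f i + f j := by
    intro f
    rw [← Finset.sum_erase_add _ _ (Finset.mem_univ i),
      ← Finset.sum_erase_add _ _ (Finset.mem_erase.2 ⟨h.symm, Finset.mem_univ j⟩)]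
    ring
  rw [key]
  simp only [key, Finset.sum_add_distrib]
  ring

/-- Pairs avoiding `i` and `j` are unaffected and the pair `(i, j)` contributes 1. For another `m`,
the two pairs with `i` and `j` together gain 2 exactly when `m` lies strictly between in position
and in value; otherwise their total is unchanged. -/
theorem length_mul_swap {x : Perm (Fin n)} {i j : Fin n} (hij : i < j) (hx : x i < x j) :
    length (x * swap i j) = length x + 1 +
      2 * (Finset.univ.filter fun m => i < m ∧ m < j ∧ x i < x m ∧ x m < x j).card := by
  have hne : i ≠ j := hij.ne
  rw [length_eq_sum, length_eq_sum, sum_sum_split _ hne, sum_sum_split _ hne]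
  have h1 : ∀ m ∈ (Finset.univ.erase i).erase j, (x * swap i j) m = x m := by
    intro m hm
    simp only [Finset.mem_erase, Finset.mem_univ, and_true] at hm
    rw [Perm.mul_apply, swap_apply_of_ne_of_ne hm.2 hm.1]
  have hi : (x * swap i j) i = x j := by simp
  have hj : (x * swap i j) j = x i := by simp
  have hcard : (Finset.univ.filter fun m => i < m ∧ m < j ∧ x i < x m ∧ x m < x j).card =
      ∑ m ∈ (Finset.univ.erase i).erase j,
        if i < m ∧ m < j ∧ x i < x m ∧ x m < x j then 1 else 0 := by
    rw [← Finset.card_filter]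
    congr 1
    ext m
    simp only [Finset.mem_filter, Finset.mem_univ, true_and, Finset.mem_erase, and_true]
    constructor
    · rintro ⟨a, b, c⟩; exact ⟨⟨b.ne, a.ne'⟩, a, b, c⟩
    · rintro ⟨_, h⟩; exact h
  rw [hcard, Finset.mul_sum]
  have e1 : (∑ a ∈ (Finset.univ.erase i).erase j, ∑ b ∈ (Finset.univ.erase i).erase j,
      if a < b ∧ (x * swap i j) b < (x * swap i j) a then 1 else 0) =
      ∑ a ∈ (Finset.univ.erase i).erase j, ∑ b ∈ (Finset.univ.erase i).erase j,
      if a < b ∧ x b < x a then 1 else 0 := by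
    refine Finset.sum_congr rfl fun a ha => Finset.sum_congr rfl fun b hb => ?_
    rw [h1 a ha, h1 b hb]
  rw [e1, hi, hj]
  have e2 : (∑ m ∈ (Finset.univ.erase i).erase j,
      ((if m < i ∧ x j < (x * swap i j) m then 1 else 0) +
        (if m < j ∧ x i < (x * swap i j) m then 1 else 0) +
        (if i < m ∧ (x * swap i j) m < x j then 1 else 0) +
        (if j < m ∧ (x * swap i j) m < x i then 1 else 0))) =
      (∑ m ∈ (Finset.univ.erase i).erase j,
      ((if m < i ∧ x i < x m then 1 else 0) +
        (if m < j ∧ x j < x m then 1 else 0) +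
        (if i < m ∧ x m < x i then 1 else 0) +
        (if j < m ∧ x m < x j then 1 else 0))) +
      ∑ m ∈ (Finset.univ.erase i).erase j,
        2 * (if i < m ∧ m < j ∧ x i < x m ∧ x m < x j then 1 else 0) := by
    rw [← Finset.sum_add_distrib]
    refine Finset.sum_congr rfl fun m hm => ?_
    rw [h1 m hm]
    simp only [Finset.mem_erase, Finset.mem_univ, and_true] at hm
    have a1 : x m ≠ x i := fun h => hm.2 (x.injective h)
    have a2 : x m ≠ x j := fun h => hm.1 (x.injective h)
    rcases lt_or_gt_of_ne hm.1 with c1 | c1 <;> rcases lt_or_gt_of_ne hm.2 with c2 | c2 <;>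
      rcases lt_or_gt_of_ne a1 with c3 | c3 <;> rcases lt_or_gt_of_ne a2 with c4 | c4 <;>
      first
        | (exfalso; order)
        | simp [c1, c2, c3, c4, not_lt_of_gt c1, not_lt_of_gt c2, not_lt_of_gt c3,
            not_lt_of_gt c4]
  rw [e2]
  have b1 : ¬ (x j < x i) := not_lt.2 hx.le
  have b2 : ¬ (j < i) := not_lt.2 hij.le
  simp [hij, hx, b1, b2]
  ring

theorem isSwap_mul_swap (x : Perm (Fin n)) {i j : Fin n} (h : i ≠ j) :
    (x * swap i j * x⁻¹).IsSwap :=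
  ⟨x i, x j, fun e => h (x.injective e), (swap_apply_apply x i j).symm⟩

theorem edge_of_swap {x : Perm (Fin n)} {i j : Fin n} (hij : i < j) (hx : x i < x j) :
    Edge x (x * swap i j) :=
  ⟨isSwap_mul_swap x hij.ne, by rw [length_mul_swap hij hx]; omega⟩

theorem edge_mul_swap {x : Perm (Fin n)} {i j : Fin n} (h : i ≠ j) :
    Edge x (x * swap i j) ↔ (i < j ↔ x i < x j) := by
  have key : ∀ {i j : Fin n}, i < j → (Edge x (x * swap i j) ↔ x i < x j) := by
    intro i j hij
    refine ⟨fun he => ?_, edge_of_swap hij⟩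
    by_contra hlt
    have hx : x j < x i := lt_of_le_of_ne (not_lt.1 hlt) fun e => hij.ne' (x.injective e)
    have h2 : Edge (x * swap i j) (x * swap i j * swap i j) := edge_of_swap hij (by simpa using hx)
    rw [mul_assoc, swap_mul_self, mul_one] at h2
    exact lt_asymm he.2 h2.2
  have hx : x i ≠ x j := fun e => h (x.injective e)
  rcases lt_or_gt_of_ne h with hij | hij
  · simp [key hij, hij]
  · rw [swap_comm, key hij]
    have : ¬ i < j := not_lt_of_gt hij
    simp only [this, false_iff, not_lt]
    exact ⟨le_of_lt, fun h => lt_of_le_of_ne h hx.symm⟩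

theorem Edge.exists_swap {x y : Perm (Fin n)} (h : Edge x y) :
    ∃ i j, i < j ∧ x i < x j ∧ y = x * swap i j := by
  obtain ⟨a, b, hab, he⟩ := h.1
  have hy : y = x * swap (x⁻¹ a) (x⁻¹ b) := by
    rw [← swap_mul_eq_mul_swap, ← he]; simp
  have hne : x⁻¹ a ≠ x⁻¹ b := fun e => hab (x⁻¹.injective e)
  rw [hy, edge_mul_swap hne] at h
  rcases lt_or_gt_of_ne hne with hl | hl
  · exact ⟨_, _, hl, h.1 hl, hy⟩
  · refine ⟨_, _, hl, ?_, by rw [swap_comm]; exact hy⟩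
    by_contra hc
    have h3 : x (x⁻¹ a) < x (x⁻¹ b) :=
      lt_of_le_of_ne (not_lt.1 hc) fun e => hne (x.injective e)
    exact lt_asymm hl (h.2 h3)

theorem length_inv (w : Perm (Fin n)) : length w⁻¹ = length w := by
  unfold length
  refine Finset.card_bij' (fun p _ => (w⁻¹ p.2, w⁻¹ p.1)) (fun p _ => (w p.2, w p.1)) ?_ ?_ ?_ ?_ <;>
    simp +contextual

/-- Inversion is an automorphism of the Bruhat graph. It turns each statement about right
multiplication into one about left multiplication. -/
theorem edge_inv {x y : Perm (Fin n)} (h : Edge x y) : Edge x⁻¹ y⁻¹ := by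
  refine ⟨?_, by rw [length_inv, length_inv]; exact h.2⟩
  obtain ⟨i, j, hij, -, rfl⟩ := h.exists_swap
  exact ⟨i, j, hij.ne, by simp⟩

theorem edge_swap_mul {x : Perm (Fin n)} {i j : Fin n} (h : i ≠ j) :
    Edge x (swap i j * x) ↔ (i < j ↔ x⁻¹ i < x⁻¹ j) := by
  rw [← edge_mul_swap h]
  constructor
  · intro e; simpa using edge_inv e
  · intro e; simpa using edge_inv e

theorem BruhatLE.inv {x y : Perm (Fin n)} (h : BruhatLE x y) : BruhatLE x⁻¹ y⁻¹ := by
  induction h with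
  | refl => exact .refl
  | tail _ e ih => exact ih.tail (edge_inv e)

theorem BruhatLE.trans {x y z : Perm (Fin n)} (h : BruhatLE x y) (h' : BruhatLE y z) :
    BruhatLE x z := Relation.ReflTransGen.trans h h'

theorem Edge.le {x y : Perm (Fin n)} (h : Edge x y) : BruhatLE x y := .single h

theorem Edge.ne {x y : Perm (Fin n)} (h : Edge x y) : x ≠ y := by
  rintro rfl; exact lt_irrefl _ h.2

theorem BruhatLE.length_le {x y : Perm (Fin n)} (h : BruhatLE x y) : length x ≤ length y := by
  induction h with
  | refl => exact le_rfl
  | tail _ e ih => exact ih.trans e.2.le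

theorem BruhatLE.eq_of_length_eq {x y : Perm (Fin n)} (h : BruhatLE x y)
    (hl : length x = length y) : x = y := by
  rcases Relation.ReflTransGen.cases_head h with h | ⟨z, e, h⟩
  · exact h
  · have := e.2; have := BruhatLE.length_le h; omega

/-! ### The rank criterion -/

/-- The number of positions smaller than `p` whose value is at least `q`. -/
def rank (w : Perm (Fin n)) (p q : ℕ) : ℕ :=
  (Finset.univ.filter fun a : Fin n => a.val < p ∧ q ≤ (w a).val).card

theorem rank_mul_swap {x : Perm (Fin n)} {i j : Fin n} (hij : i < j) (hx : x i < x j) (p q : ℕ) :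
    rank (x * swap i j) p q = rank x p q +
      if i.val < p ∧ p ≤ j.val ∧ (x i).val < q ∧ q ≤ (x j).val then 1 else 0 := by
  have key : ∀ w : Perm (Fin n), rank w p q =
      (∑ a ∈ (Finset.univ.erase i).erase j, if a.val < p ∧ q ≤ (w a).val then 1 else 0) +
      (if i.val < p ∧ q ≤ (w i).val then 1 else 0) +
      (if j.val < p ∧ q ≤ (w j).val then 1 else 0) := by
    intro w
    rw [rank, Finset.card_filter, ← Finset.sum_erase_add _ _ (Finset.mem_univ i),
      ← Finset.sum_erase_add _ _ (Finset.mem_erase.2 ⟨hij.ne', Finset.mem_univ j⟩)]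
    ring
  rw [key, key]
  have e : (∑ a ∈ (Finset.univ.erase i).erase j,
      if a.val < p ∧ q ≤ ((x * swap i j) a).val then 1 else 0) =
      ∑ a ∈ (Finset.univ.erase i).erase j, if a.val < p ∧ q ≤ (x a).val then 1 else 0 := by
    refine Finset.sum_congr rfl fun m hm => ?_
    simp only [Finset.mem_erase, Finset.mem_univ, and_true] at hm
    rw [Perm.mul_apply, swap_apply_of_ne_of_ne hm.2 hm.1]
  have hi : (x * swap i j) i = x j := by simp
  have hj : (x * swap i j) j = x i := by simp
  rw [e, hi, hj]
  rw [Fin.lt_def] at hij hx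
  split_ifs <;> omega

theorem BruhatLE.rank_le {x y : Perm (Fin n)} (h : BruhatLE x y) (p q : ℕ) :
    rank x p q ≤ rank y p q := by
  induction h with
  | refl => exact le_rfl
  | tail _ e ih =>
    obtain ⟨i, j, hij, hx, rfl⟩ := e.exists_swap
    rw [rank_mul_swap hij hx]; omega

theorem length_le (w : Perm (Fin n)) : length w ≤ n * n := by
  refine (Finset.card_filter_le _ _).trans ?_
  simp

/-- Subtract the counts above the value `y i`. Among the values from `q` to `y i` at positions below
`p`, `x` has only those before `i`, where it agrees with `y`, while `y` has the point at `i` in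
addition. -/
theorem rank_lt_of_step {x y : Perm (Fin n)} (h : ∀ p q, rank x p q ≤ rank y p q) {i : Fin n}
    (hi : ∀ a < i, x a = y a) {j : Fin n}
    (hj : ∀ k, i < k → k < j → ¬ (x i < x k ∧ x k ≤ y i)) {p q : ℕ} (hp : i.val < p)
    (hpj : p ≤ j.val) (hq : (x i).val < q) (hqy : q ≤ (y i).val) :
    rank x p q < rank y p q := by
  have split : ∀ w : Perm (Fin n), rank w p q = rank w p ((y i).val + 1) +
      (Finset.univ.filter fun a : Fin n => a.val < p ∧ q ≤ (w a).val ∧ w a ≤ y i).card := by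
    intro w
    rw [rank, rank, ← Finset.card_union_of_disjoint]
    · congr 1
      ext a
      simp only [Finset.mem_filter, Finset.mem_univ, true_and, Finset.mem_union, Fin.le_def]
      omega
    · rw [Finset.disjoint_left]
      simp only [Finset.mem_filter, Finset.mem_univ, true_and, Fin.le_def]
      omega
  rw [split x, split y]
  have h1 := h p ((y i).val + 1)
  suffices hs : (Finset.univ.filter fun a : Fin n => a.val < p ∧ q ≤ (x a).val ∧ x a ≤ y i).card <
      (Finset.univ.filter fun a : Fin n => a.val < p ∧ q ≤ (y a).val ∧ y a ≤ y i).card by omega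
  apply Finset.card_lt_card
  rw [Finset.ssubset_iff_of_subset]
  · refine ⟨i, by simp [hp, hqy], ?_⟩
    simp only [Finset.mem_filter, Finset.mem_univ, true_and]
    omega
  · intro a
    simp only [Finset.mem_filter, Finset.mem_univ, true_and]
    rintro ⟨h2, h3, h4⟩
    have hai : a < i := by
      rcases lt_trichotomy a i with h5 | h5 | h5
      · exact h5
      · subst h5; omega
      · refine absurd ⟨?_, h4⟩ (hj a h5 (by rw [Fin.lt_def]; omega))
        rw [Fin.lt_def]; omega
    rw [← hi a hai]
    exact ⟨h2, h3, h4⟩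

/-- Let `i` be the first position of disagreement and `j` the first later position whose `x`-value
is in `(x i, y i]`. Exchanging `i` and `j` raises the rank only on a rectangle where the previous
lemma leaves room. -/
theorem exists_step {x y : Perm (Fin n)} (hne : x ≠ y) (h : ∀ p q, rank x p q ≤ rank y p q) :
    ∃ x', Edge x x' ∧ ∀ p q, rank x' p q ≤ rank y p q := by
  obtain ⟨i, hxi, hi⟩ : ∃ i, x i ≠ y i ∧ ∀ a < i, x a = y a := by
    have hex : ∃ i, x i ≠ y i := by
      by_contra hc; push Not at hc; exact hne (Equiv.ext hc)
    obtain ⟨i, hi, hmin⟩ := WellFounded.has_min (wellFounded_lt (α := Fin n))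
      {i | x i ≠ y i} hex
    exact ⟨i, hi, fun a ha => by by_contra hc; exact hmin a hc ha⟩
  have hlt : x i < y i := by
    refine lt_of_le_of_ne ?_ hxi
    by_contra hc
    -- If `y i < x i`, then at this cell `x` counts the position `i` and `y` does not, with equality
    -- before `i`.
    have h1 := h (i.val + 1) (x i).val
    refine absurd h1 (not_le.2 ?_)
    apply Finset.card_lt_card
    rw [Finset.ssubset_iff_of_subset]
    · refine ⟨i, by simp, ?_⟩
      simp only [Finset.mem_filter, Finset.mem_univ, true_and]
      omega
    · intro a
      simp only [Finset.mem_filter, Finset.mem_univ, true_and]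
      rintro ⟨h2, h3⟩
      have hai : a < i := by
        rcases lt_trichotomy a i with h5 | h5 | h5
        · exact h5
        · subst h5; omega
        · rw [Fin.lt_def] at h5; omega
      rw [hi a hai]; exact ⟨h2, h3⟩
  -- The position at which `x` takes the value `y i` shows that such a `j` exists.
  obtain ⟨j, ⟨hij, h1, h2⟩, hmin⟩ := WellFounded.has_min (wellFounded_lt (α := Fin n))
    {k | i < k ∧ x i < x k ∧ x k ≤ y i} ⟨x⁻¹ (y i), by
      have e : x (x⁻¹ (y i)) = y i := by simp
      refine ⟨?_, by rw [e]; exact hlt, by rw [e]⟩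
      rcases lt_trichotomy i (x⁻¹ (y i)) with h5 | h5 | h5
      · exact h5
      · rw [← h5] at e; exact absurd e hxi
      · rw [hi _ h5] at e; exact absurd (y.injective e) h5.ne⟩
  refine ⟨_, edge_of_swap hij h1, fun p q => ?_⟩
  rw [rank_mul_swap hij h1]
  split_ifs with hc
  · exact rank_lt_of_step h hi (fun k hk hkj hc => hmin k ⟨hk, hc⟩ hkj) hc.1 hc.2.1 hc.2.2.1
      (by rw [Fin.le_def] at h2; omega)
  · exact h p q

theorem bruhatLE_of_rank_le {x y : Perm (Fin n)} (h : ∀ p q, rank x p q ≤ rank y p q) :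
    BruhatLE x y := by
  by_cases hne : x = y
  · subst hne; exact .refl
  · obtain ⟨x', e, hx'⟩ := exists_step hne h
    exact .head e (bruhatLE_of_rank_le hx')
termination_by n * n - length x
decreasing_by
  have := e.2; have := length_le x'; omega

theorem exists_inversion {w : Perm (Fin n)} (h : w ≠ 1) : ∃ i j, i < j ∧ w j < w i := by
  have hex : ∃ i, w i ≠ i := by
    by_contra hc; push Not at hc; exact h (Equiv.ext hc)
  obtain ⟨i, hi, hmin⟩ := WellFounded.has_min (wellFounded_lt (α := Fin n)) {i | w i ≠ i} hex
  have hfix : ∀ a < i, w a = a := fun a ha => by by_contra hc; exact hmin a hc ha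
  have hi' : w i ≠ i := hi
  have h1 : i < w i := by
    rcases lt_trichotomy i (w i) with h5 | h5 | h5
    · exact h5
    · exact absurd h5.symm hi'
    · exact absurd (w.injective (hfix _ h5)) h5.ne
  have e : w (w⁻¹ i) = i := by simp
  refine ⟨i, w⁻¹ i, ?_, by rw [e]; exact h1⟩
  rcases lt_trichotomy i (w⁻¹ i) with h5 | h5 | h5
  · exact h5
  · rw [← h5] at e; exact absurd e hi'
  · rw [hfix _ h5] at e; exact absurd e h5.ne

theorem edge_of_inversion {w : Perm (Fin n)} {i j : Fin n} (hij : i < j) (hw : w j < w i) :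
    Edge (w * swap i j) w := by
  have := edge_of_swap (x := w * swap i j) hij (by simpa using hw)
  simpa [mul_assoc] using this

theorem one_le (w : Perm (Fin n)) : BruhatLE 1 w := by
  by_cases h : w = 1
  · subst h; exact .refl
  · obtain ⟨i, j, hij, hw⟩ := exists_inversion h
    exact .tail (one_le (w * swap i j)) (edge_of_inversion hij hw)
termination_by length w
decreasing_by exact (edge_of_inversion hij hw).2

theorem mem_interval_one {v w : Perm (Fin n)} : w ∈ Interval 1 v ↔ BruhatLE w v :=
  ⟨fun h => h.2, fun h => ⟨one_le w, h⟩⟩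

/-! ### Transpositions in Bruhat order. -/

theorem rank_swap {a b : Fin n} (h : a < b) (p q : ℕ) :
    rank (swap a b) p q = rank (1 : Perm (Fin n)) p q +
      if a.val < p ∧ p ≤ b.val ∧ a.val < q ∧ q ≤ b.val then 1 else 0 := by
  have := rank_mul_swap (x := (1 : Perm (Fin n))) h (by simpa using h) p q
  rw [one_mul] at this
  exact this

/-- The rank of `(a b)` exceeds that of the identity, by one, exactly on a square of cells;
elsewhere the comparison is automatic because the identity is the minimum. -/
theorem swap_le_iff {a b : Fin n} (h : a < b) {v : Perm (Fin n)} :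
    BruhatLE (swap a b) v ↔ ∀ p q, a.val < p → p ≤ b.val → a.val < q → q ≤ b.val →
      rank (1 : Perm (Fin n)) p q < rank v p q := by
  constructor
  · intro hv p q h1 h2 h3 h4
    have := hv.rank_le p q
    rw [rank_swap h, if_pos ⟨h1, h2, h3, h4⟩] at this
    omega
  · intro hv
    refine bruhatLE_of_rank_le fun p q => ?_
    rw [rank_swap h]
    split_ifs with hc
    · exact hv p q hc.1 hc.2.1 hc.2.2.1 hc.2.2.2
    · exact (one_le v).rank_le p q

theorem swap_le_swap_iff {a b c d : Fin n} (h : a < b) (h' : c < d) :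
    BruhatLE (swap a b) (swap c d) ↔ c ≤ a ∧ b ≤ d := by
  rw [swap_le_iff h]
  simp only [Fin.le_def, Fin.lt_def] at *
  constructor
  · intro hv
    -- The two extreme diagonal cells of the square already force both inequalities.
    have h1 := hv (a.val + 1) (a.val + 1) (by omega) (by omega) (by omega) (by omega)
    have h2 := hv b.val b.val (by omega) (by omega) (by omega) (by omega)
    rw [rank_swap h'] at h1 h2
    split_ifs at h1 h2 with c1 c2 <;> omega
  · intro hv p q h1 h2 h3 h4
    rw [rank_swap h', if_pos (by omega)]
    omega

theorem BruhatLE.swap_mono {a b c d : Fin n} {v : Perm (Fin n)} (hv : BruhatLE (swap c d) v)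
    (hab : a < b) (h1 : c ≤ a) (h2 : b ≤ d) : BruhatLE (swap a b) v :=
  ((swap_le_swap_iff hab (h1.trans_lt (hab.trans_le h2))).2 ⟨h1, h2⟩).trans hv

theorem rank_add_card_lt (w : Perm (Fin n)) (p q : ℕ) :
    rank w p q + (Finset.univ.filter fun a : Fin n => a.val < p ∧ (w a).val < q).card =
      (Finset.univ.filter fun a : Fin n => a.val < p).card := by
  rw [rank, ← Finset.card_union_of_disjoint]
  · congr 1
    ext a
    simp only [Finset.mem_filter, Finset.mem_univ, true_and, Finset.mem_union]
    omega
  · rw [Finset.disjoint_left]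
    simp only [Finset.mem_filter, Finset.mem_univ, true_and]
    omega

/-- Count points with position `< p` and value `< q`: the identity has `min p q` of them. If `p ≤
q`, `w` misses the position `i`, since `w i ≥ k ≥ q`. If `q < p`, it misses the value `i`, since
`w⁻¹ i ≥ k ≥ p`. -/
theorem swap_le_of_le_apply {w : Perm (Fin n)} {i k : Fin n} (hik : i < k) (h1 : k ≤ w i)
    (h2 : k ≤ w⁻¹ i) : BruhatLE (swap i k) w := by
  rw [swap_le_iff hik]
  intro p q hp hpk hq hqk
  have e1 := rank_add_card_lt w p q
  have e2 : rank (1 : Perm (Fin n)) p q +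
      (Finset.univ.filter fun a : Fin n => a.val < p ∧ a.val < q).card = _ :=
    rank_add_card_lt (1 : Perm (Fin n)) p q
  rw [Fin.le_def] at h1 h2
  suffices hs : (Finset.univ.filter fun a : Fin n => a.val < p ∧ (w a).val < q).card <
    (Finset.univ.filter fun a : Fin n => a.val < p ∧ a.val < q).card by omega
  rcases le_or_gt p q with hpq | hpq
  · apply Finset.card_lt_card
    rw [Finset.ssubset_iff_of_subset]
    · refine ⟨i, ?_, ?_⟩ <;>
        simp only [Finset.mem_filter, Finset.mem_univ, true_and] <;> omega
    · intro a
      simp only [Finset.mem_filter, Finset.mem_univ, true_and]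
      omega
  · rw [← Finset.card_map w.toEmbedding]
    apply Finset.card_lt_card
    rw [Finset.ssubset_iff_of_subset]
    · refine ⟨i, ?_, ?_⟩
      · simp only [Finset.mem_filter, Finset.mem_univ, true_and]; omega
      · simp only [Finset.mem_map, Finset.mem_filter, Finset.mem_univ, true_and, not_exists]
        rintro a ⟨⟨h3, h4⟩, h5⟩
        have : w⁻¹ i = a := by rw [← h5]; simp
        rw [this] at h2; omega
    · intro b
      simp only [Finset.mem_map, Finset.mem_filter, Finset.mem_univ, true_and]
      rintro ⟨a, ⟨h3, h4⟩, rfl⟩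
      simp only [Equiv.coe_toEmbedding]
      omega

/-! ### Cuts -/

/-- `w` does not preserve the set `{0, …, j}`. -/
def Crosses (w : Perm (Fin n)) (j : ℕ) : Prop := ∃ a : Fin n, a.val ≤ j ∧ j < (w a).val

theorem crosses_iff_rank {w : Perm (Fin n)} {j : ℕ} : Crosses w j ↔ 0 < rank w (j + 1) (j + 1) := by
  rw [rank, Finset.card_pos]
  constructor
  · rintro ⟨a, h⟩
    refine ⟨a, ?_⟩
    simp only [Finset.mem_filter, Finset.mem_univ, true_and]
    omega
  · rintro ⟨a, h⟩
    simp only [Finset.mem_filter, Finset.mem_univ, true_and] at h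
    exact ⟨a, by omega, by omega⟩

theorem Crosses.mono {x y : Perm (Fin n)} {j : ℕ} (h : Crosses x j) (hxy : BruhatLE x y) :
    Crosses y j := by
  rw [crosses_iff_rank] at *
  exact h.trans_le (hxy.rank_le _ _)

/-- For a simple transposition the square is a single cell, and there the identity has rank 0. -/
theorem swap_le_iff_crosses {a b : Fin n} (h : b.val = a.val + 1) {w : Perm (Fin n)} :
    BruhatLE (swap a b) w ↔ Crosses w a.val := by
  have hab : a < b := by rw [Fin.lt_def]; omega
  have h1 : rank (1 : Perm (Fin n)) (a.val + 1) (a.val + 1) = 0 := by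
    rw [rank, Finset.card_eq_zero, Finset.filter_eq_empty_iff]
    intro x _; simp
  rw [swap_le_iff hab, crosses_iff_rank]
  constructor
  · intro hv
    have := hv (a.val + 1) (a.val + 1) (by omega) (by omega) (by omega) (by omega)
    omega
  · intro hv p q h2 h3 h4 h5
    obtain rfl : p = a.val + 1 := by omega
    obtain rfl : q = a.val + 1 := by omega
    omega

theorem crosses_swap {a b : Fin n} (h : a < b) {j : ℕ} :
    Crosses (swap a b) j ↔ a.val ≤ j ∧ j < b.val := by
  rw [Fin.lt_def] at h
  constructor
  · rintro ⟨x, h1, h2⟩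
    rw [swap_apply_def] at h2
    split_ifs at h2 with c1 c2
    · subst c1; omega
    · subst c2; omega
    · omega
  · rintro ⟨h1, h2⟩
    exact ⟨a, h1, by simpa using h2⟩

/-- With `Crosses.inv`, this says that the permutations not crossing `j` form a subgroup. -/
theorem Crosses.of_mul {x y : Perm (Fin n)} {j : ℕ} (h : Crosses (x * y) j) :
    Crosses x j ∨ Crosses y j := by
  obtain ⟨a, h1, h2⟩ := h
  by_cases hc : j < (y a).val
  · exact .inr ⟨a, h1, hc⟩
  · exact .inl ⟨y a, by omega, h2⟩

theorem Crosses.inv {w : Perm (Fin n)} {j : ℕ} (h : Crosses w j) : Crosses w⁻¹ j := by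
  obtain ⟨a, h1, h2⟩ := h
  have hj := (w a).isLt
  have key := swap_le_iff_crosses (a := (⟨j, by omega⟩ : Fin n)) (b := ⟨j + 1, by omega⟩) rfl
    (w := w)
  have key' := swap_le_iff_crosses (a := (⟨j, by omega⟩ : Fin n)) (b := ⟨j + 1, by omega⟩) rfl
    (w := w⁻¹)
  rw [← key']
  simpa using (key.2 ⟨a, h1, h2⟩).inv

/-! ### Diamonds -/

theorem swap_apply_of_moved {α : Type*} [DecidableEq α] {g h x y : α} (hxy : x ≠ y) :
    swap g h x = x ∨ swap g h y = y ∨ swap g h x = y := by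
  simp only [swap_apply_def]
  grind

/-- The equation says that `(c d)(a b)` is also `(g h)(e f)`. A product of two disjoint
transpositions factors into transpositions only by these two, as is seen by tracking which of the
four points a single transposition can move. -/
theorem eq_of_disjoint_swap_mul_swap {α : Type*} [DecidableEq α] {a b c d e f g h : α} (hab : a ≠ b) (hcd : c ≠ d)
    (hac : a ≠ c) (had : a ≠ d) (hbc : b ≠ c) (hbd : b ≠ d)
    (heq : swap c d * swap a b * swap e f = swap g h) :
    (e = c ∧ f = d) ∨ (e = d ∧ f = c) ∨ (e = a ∧ f = b) ∨ (e = b ∧ f = a) := by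
  obtain ⟨π, hπ⟩ : ∃ π, π = swap g h := ⟨_, rfl⟩
  have H : ∀ x y, x ≠ y → π x = x ∨ π y = y ∨ π x = y := by
    subst hπ; exact fun x y => swap_apply_of_moved
  have K : ∀ x, x ≠ e → x ≠ f → π x = swap c d (swap a b x) := fun x h1 h2 => by
    rw [hπ, ← heq]; simp [swap_apply_of_ne_of_ne h1 h2]
  have ka : a = e ∨ a = f ∨ π a = b := by
    by_contra hc; push Not at hc; obtain ⟨h1, h2, h3⟩ := hc; apply h3; rw [K a h1 h2, swap_apply_left, swap_apply_of_ne_of_ne hbc hbd]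
  have kb : b = e ∨ b = f ∨ π b = a := by
    by_contra hc; push Not at hc; obtain ⟨h1, h2, h3⟩ := hc; apply h3; rw [K b h1 h2, swap_apply_right, swap_apply_of_ne_of_ne hac had]
  have kc : c = e ∨ c = f ∨ π c = d := by
    by_contra hc; push Not at hc; obtain ⟨h1, h2, h3⟩ := hc; apply h3; rw [K c h1 h2, swap_apply_of_ne_of_ne hac.symm hbc.symm, swap_apply_left]
  have kd : d = e ∨ d = f ∨ π d = c := by
    by_contra hc; push Not at hc; obtain ⟨h1, h2, h3⟩ := hc; apply h3; rw [K d h1 h2, swap_apply_of_ne_of_ne had.symm hbd.symm, swap_apply_right]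
  have Hac := H a c hac
  have Had := H a d had
  have Hbc := H b c hbc
  have Hbd := H b d hbd
  clear heq hπ H K
  grind

/-- Here `(a d)(a b)` is a three-cycle, whose factorisations into two transpositions use only the
three transpositions of its support. -/
theorem eq_of_swap_mul_swap {α : Type*} [DecidableEq α] {a b d e f g h : α} (hab : a ≠ b) (had : a ≠ d)
    (hbd : b ≠ d) (heq : swap a d * swap a b * swap e f = swap g h) :
    (e = a ∧ f = d) ∨ (e = d ∧ f = a) ∨ (e = b ∧ f = d) ∨ (e = d ∧ f = b) ∨
      (e = a ∧ f = b) ∨ (e = b ∧ f = a) := by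
  obtain ⟨π, hπ⟩ : ∃ π, π = swap g h := ⟨_, rfl⟩
  have H : ∀ x y, x ≠ y → π x = x ∨ π y = y ∨ π x = y := by
    subst hπ; exact fun x y => swap_apply_of_moved
  have K : ∀ x, x ≠ e → x ≠ f → π x = swap a d (swap a b x) := fun x h1 h2 => by
    rw [hπ, ← heq]; simp [swap_apply_of_ne_of_ne h1 h2]
  have ka : a = e ∨ a = f ∨ π a = b := by
    by_contra hc; push Not at hc; obtain ⟨h1, h2, h3⟩ := hc; apply h3; rw [K a h1 h2, swap_apply_left, swap_apply_of_ne_of_ne hab.symm hbd]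
  have kb : b = e ∨ b = f ∨ π b = d := by
    by_contra hc; push Not at hc; obtain ⟨h1, h2, h3⟩ := hc; apply h3; rw [K b h1 h2, swap_apply_right, swap_apply_left]
  have kd : d = e ∨ d = f ∨ π d = a := by
    by_contra hc; push Not at hc; obtain ⟨h1, h2, h3⟩ := hc; apply h3; rw [K d h1 h2, swap_apply_of_ne_of_ne had.symm hbd.symm, swap_apply_right]
  have Hac := H a b hab
  have Had := H b a hab.symm
  have Hbc := H b d hbd
  have Hbd := H a d had
  have H1 := H d b hbd.symm
  have H2 := H d a had.symm
  clear heq hπ H K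
  grind

/-- Writing `d = a t r = a s r'` makes `s t r` a transposition, so the two factorisation lemmas list
the possible `r`. The value `r = t` would lead back to `a`; the others give `a t s` or `a s t`. -/
theorem diamond_top {a d t s : Perm (Fin n)} (ht : t.IsSwap) (hs : s.IsSwap) (hne : t ≠ s)
    (h0 : Edge a (a * t)) (h1 : Edge (a * t) d) (h2 : Edge (a * s) d) :
    d = a * t * s ∨ d = a * s * t := by
  have hda : d ≠ a := by
    rintro rfl; exact lt_asymm h0.2 h1.2
  obtain ⟨e, f, -, -, rfl⟩ := h1.exists_swap
  obtain ⟨g, h, -, -, h3⟩ := h2.exists_swap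
  obtain ⟨i, j, hij, rfl⟩ := ht
  obtain ⟨k, l, hkl, rfl⟩ := hs
  have heq : swap k l * swap i j * swap e f = swap g h := by
    have : swap i j * swap e f = swap k l * swap g h := by
      simpa [mul_assoc] using h3
    rw [mul_assoc, this, ← mul_assoc, swap_mul_self, one_mul]
  have hne' : swap e f ≠ swap i j := by
    intro e; apply hda; rw [e, mul_assoc, swap_mul_self, mul_one]
  have key : ∀ {i j l : Fin n}, i ≠ j → i ≠ l → swap i j ≠ swap i l → swap e f ≠ swap i j →
      swap i l * swap i j * swap e f = swap g h →
      a * swap i j * swap e f = a * swap i j * swap i l ∨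
      a * swap i j * swap e f = a * swap i l * swap i j := by
    intro i j l hij hil hne hne' heq
    have hjl : j ≠ l := by rintro rfl; exact hne rfl
    have h5 : swap i j * swap j l = swap i l * swap i j := by
      rw [mul_swap_eq_swap_mul, swap_apply_right, swap_apply_of_ne_of_ne hil.symm hjl.symm]
    rcases eq_of_swap_mul_swap hij hil hjl heq with
      ⟨rfl, rfl⟩ | ⟨rfl, rfl⟩ | ⟨rfl, rfl⟩ | ⟨rfl, rfl⟩ | ⟨rfl, rfl⟩ | ⟨rfl, rfl⟩
    · exact .inl rfl
    · left; rw [swap_comm e]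
    · right; rw [mul_assoc, mul_assoc, h5]
    · right; rw [swap_comm e, mul_assoc, mul_assoc, h5]
    · exact absurd rfl hne'
    · exact absurd (swap_comm _ _) hne'
  by_cases hik : i = k
  · subst hik; exact key hij hkl hne hne' heq
  by_cases hil : i = l
  · subst hil
    rw [swap_comm k] at hne heq ⊢
    exact key hij (Ne.symm hkl) hne hne' heq
  by_cases hjk : j = k
  · subst hjk
    rw [swap_comm i] at hne hne' heq ⊢
    exact key hij.symm hkl hne hne' heq
  by_cases hjl : j = l
  · subst hjl
    rw [swap_comm i] at hne hne' heq ⊢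
    rw [swap_comm k] at hne heq ⊢
    exact key hij.symm (Ne.symm hkl) hne hne' heq
  rcases eq_of_disjoint_swap_mul_swap hij hkl hik hil hjk hjl heq with
      ⟨rfl, rfl⟩ | ⟨rfl, rfl⟩ | ⟨rfl, rfl⟩ | ⟨rfl, rfl⟩
  · exact .inl rfl
  · left; rw [swap_comm e]
  · exact absurd rfl hne'
  · exact absurd (swap_comm _ _) hne'

/-- `y` is the top of a diamond `a → b → y`, `a → c → y`. -/
def IsDiamondTop (y : Perm (Fin n)) : Prop :=
  ∃ a b c, b ≠ c ∧ Edge a b ∧ Edge a c ∧ Edge b y ∧ Edge c y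

theorem swap_mul_swap_rotate {i j k : Fin n} (hik : i ≠ k) (hjk : j ≠ k) :
    swap i j * swap j k = swap i k * swap i j := by
  rw [mul_swap_eq_swap_mul, swap_apply_right, swap_apply_of_ne_of_ne hik.symm hjk.symm]

/-- The hypothesis says that the pattern of `y` at `i, j, k` is 231, 312 or 321, and in each case a
diamond below it uses only these three positions. -/
theorem isDiamondTop_of_triple {y : Perm (Fin n)} {i j k : Fin n} (hij : i < j) (hjk : j < k)
    (h : y j < y i ∧ y k < y i ∨ y k < y i ∧ y k < y j) : IsDiamondTop y := by
  have n1 := hij.ne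
  have n2 := hjk.ne
  have hik := hij.trans hjk
  have n3 := hik.ne
  have m2 : y j ≠ y k := fun e => n2 (y.injective e)
  have m1 : y i ≠ y j := fun e => n1 (y.injective e)
  have r1 : swap i j * swap j k = swap i k * swap i j := swap_mul_swap_rotate n3 n2
  have r2 : swap j k * swap i j = swap i k * swap j k := by
    have := swap_mul_swap_rotate (i := k) (j := j) (k := i) n3.symm n1.symm
    rwa [swap_comm k j, swap_comm j i, swap_comm k i] at this
  have r3 : swap i j * swap i k = swap j k * swap i j := by
    have := swap_mul_swap_rotate (i := j) (j := i) (k := k) n2 n3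
    rwa [swap_comm j i] at this
  have e1 : swap i j k = k := swap_apply_of_ne_of_ne n3.symm n2.symm
  have e2 : swap j k i = i := swap_apply_of_ne_of_ne n1 n3
  have e3 : swap i k j = j := swap_apply_of_ne_of_ne n1.symm n2
  have d1 : y * swap i j ≠ y * swap i k := by
    intro e; have := congrArg (fun f => f i) e; simp [n2] at this
  have d2 : y * swap i k ≠ y * swap j k := by
    intro e; have := congrArg (fun f => f j) e; simp [n2, e3] at this
  have d3 : y * swap i j ≠ y * swap j k := by
    intro e; have := congrArg (fun f => f i) e; simp [n1.symm, e2] at this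
  rcases lt_or_gt_of_ne m1 with c1 | c1
  · have c2 : y k < y i := by rcases h with h | h <;> order
    refine ⟨y * swap i k * swap j k, y * swap i k, y * swap j k, d2,
      edge_of_inversion hjk (by simpa [e3] using c1), ?_,
      edge_of_inversion hik c2, edge_of_inversion hjk (by order)⟩
    rw [mul_assoc, ← r2, ← mul_assoc]
    exact edge_of_inversion hij (by simpa [e2] using c2)
  · have c2 : y k < y i := by rcases h with h | h <;> order
    rcases lt_or_gt_of_ne m2 with c3 | c3
    · refine ⟨y * swap i j * swap j k, y * swap i j, y * swap i k, d1,
        edge_of_inversion hjk (by simpa [e1] using c2), ?_,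
        edge_of_inversion hij c1, edge_of_inversion hik c2⟩
      rw [mul_assoc, r1, ← mul_assoc]
      exact edge_of_inversion hij (by simpa [e3] using c3)
    · refine ⟨y * swap i j * swap i k, y * swap i j, y * swap j k, d3,
        edge_of_inversion hik (by simpa [e1] using c3), ?_,
        edge_of_inversion hij c1, edge_of_inversion hjk c3⟩
      rw [mul_assoc, r3, ← mul_assoc]
      exact edge_of_inversion hij (by simpa [e2] using c2)

theorem isDiamondTop_of_inversions {y : Perm (Fin n)} {i j k l : Fin n} (hij : i < j)
    (hy : y j < y i) (hkl : k < l) (hy' : y l < y k) (hne : ¬ (i = k ∧ j = l)) :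
    IsDiamondTop y := by
  by_cases hik : i = k
  · subst hik
    rcases lt_or_gt_of_ne (fun e : j = l => hne ⟨rfl, e⟩) with h | h
    · exact isDiamondTop_of_triple hij h (.inl ⟨hy, hy'⟩)
    · exact isDiamondTop_of_triple hkl h (.inl ⟨hy', hy⟩)
  by_cases hjl : j = l
  · subst hjl
    rcases lt_or_gt_of_ne hik with h | h
    · exact isDiamondTop_of_triple h hkl (.inr ⟨hy, hy'⟩)
    · exact isDiamondTop_of_triple h hij (.inr ⟨hy', hy⟩)
  by_cases hjk : j = k
  · subst hjk
    exact isDiamondTop_of_triple hij hkl (.inl ⟨hy, hy'.trans hy⟩)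
  by_cases hil : i = l
  · subst hil
    exact isDiamondTop_of_triple hkl hij (.inl ⟨hy', hy.trans hy'⟩)
  have e1 : swap i j k = k := swap_apply_of_ne_of_ne (Ne.symm hik) (Ne.symm hjk)
  have e2 : swap i j l = l := swap_apply_of_ne_of_ne (Ne.symm hil) (Ne.symm hjl)
  have e3 : swap k l i = i := swap_apply_of_ne_of_ne hik hil
  have e4 : swap k l j = j := swap_apply_of_ne_of_ne hjk hjl
  have hc : swap i j * swap k l = swap k l * swap i j := by
    rw [mul_swap_eq_swap_mul, e1, e2]
  refine ⟨y * swap i j * swap k l, y * swap i j, y * swap k l, ?_,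
    edge_of_inversion hkl (by simpa [e1, e2] using hy'), ?_,
    edge_of_inversion hij hy, edge_of_inversion hkl hy'⟩
  · intro e; have := congrArg (fun f => f i) e; simp [e3, hij.ne'] at this
  · rw [mul_assoc, hc, ← mul_assoc]
    exact edge_of_inversion hij (by simpa [e3, e4] using hy)

/-- Two distinct inversions produce a diamond, so only permutations with at most one inversion
remain. A unique inversion has adjacent positions, and undoing it leaves the identity. -/
theorem eq_one_or_swap_or_isDiamondTop (y : Perm (Fin n)) :
    y = 1 ∨ (∃ i j : Fin n, j.val = i.val + 1 ∧ y = swap i j) ∨ IsDiamondTop y := by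
  by_cases h1 : y = 1
  · exact .inl h1
  right
  by_contra hc
  rw [not_or] at hc
  obtain ⟨hc1, hc2⟩ := hc
  obtain ⟨i, j, hij, hy⟩ := exists_inversion h1
  have huniq : ∀ k l, k < l → y l < y k → i = k ∧ j = l := fun k l hkl hy' => by
    by_contra hne; exact hc2 (isDiamondTop_of_inversions hij hy hkl hy' hne)
  have hadj : j.val = i.val + 1 := by
    by_contra hne
    rw [Fin.lt_def] at hij
    have hm : i.val + 1 < n := by have := j.isLt; omega
    set m : Fin n := ⟨i.val + 1, hm⟩ with hmdef
    have him : i < m := by rw [Fin.lt_def, hmdef]; simp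
    have hmj : m < j := by rw [Fin.lt_def, hmdef]; simp; omega
    by_cases hlt : y m < y i
    · exact hmj.ne (huniq i m him hlt).2.symm
    · exact him.ne (huniq m j hmj (by order)).1
  apply hc1
  refine ⟨i, j, hadj, ?_⟩
  by_contra hne
  have h2 : y * swap i j ≠ 1 := by
    intro e
    apply hne
    rw [mul_eq_one_iff_eq_inv] at e
    simpa using e
  -- An inversion of `y (i j)` gives an inversion of `y` other than `(i, j)`, whichever of `k`, `l`
  -- meet `i`, `j`.
  obtain ⟨k, l, hkl, hy'⟩ := exists_inversion h2
  simp only [Perm.mul_apply, swap_apply_def] at hy'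
  rw [Fin.lt_def] at hij hkl
  have hik : k ≠ i → k ≠ j → l ≠ i → l ≠ j → False := by
    intro a1 a2 a3 a4
    simp only [a1, a2, a3, a4, if_false] at hy'
    exact a1 (huniq k l hkl hy').1.symm
  have H := huniq
  by_cases a1 : k = i
  · subst a1
    by_cases a4 : l = j
    · subst a4; simp [(Fin.lt_def.2 hij).ne'] at hy'; order
    · have a3 : l ≠ k := by rintro rfl; omega
      simp only [a3, a4, if_true, if_false] at hy'
      have := H j l (by rw [Fin.lt_def]; have : l.val ≠ j.val := fun e => a4 (Fin.ext e); omega) hy'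
      rw [this.1] at hij; omega
  · by_cases a2 : k = j
    · subst a2
      have a3 : l ≠ i := by rintro rfl; omega
      have a4 : l ≠ k := by rintro rfl; omega
      simp only [a1, a3, a4, if_true, if_false] at hy'
      exact a4 (H i l (by rw [Fin.lt_def]; omega) hy').2.symm
    · by_cases a3 : l = i
      · subst a3
        simp only [a1, a2, if_true, if_false] at hy'
        exact a1 (H k j (by rw [Fin.lt_def]; omega) hy').1.symm
      · by_cases a4 : l = j
        · subst a4
          simp only [a1, a2, a3, if_true, if_false] at hy'
          have : k.val ≠ i.val := fun e => a1 (Fin.ext e)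
          have := H k i (by rw [Fin.lt_def]; omega) hy'
          exact a1 this.1.symm
        · exact hik a1 a2 a3 a4

/-! ### Cuts of a hypercube decomposition -/

/-- The simple transposition `(j j+1)` lies in `[e, v]` but not in `I`. -/
def IsCut (v : Perm (Fin n)) (I : Set (Perm (Fin n))) (j : ℕ) : Prop :=
  ∃ a b : Fin n, a.val = j ∧ b.val = j + 1 ∧ BruhatLE (swap a b) v ∧ swap a b ∉ I

variable {v : Perm (Fin n)} {I : Set (Perm (Fin n))}

theorem IsHypercubeDecomposition.le (hI : IsHypercubeDecomposition 1 v I) {w : Perm (Fin n)}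
    (h : w ∈ I) : BruhatLE w v := by
  obtain ⟨z, hz, rfl⟩ := hI.principal
  exact h.2.trans hz.2

theorem IsHypercubeDecomposition.lower (hI : IsHypercubeDecomposition 1 v I) {x w : Perm (Fin n)}
    (hx : BruhatLE x w) (h : w ∈ I) : x ∈ I := by
  obtain ⟨z, hz, rfl⟩ := hI.principal
  exact ⟨one_le x, hx.trans h.2⟩

theorem IsHypercubeDecomposition.one_mem (hI : IsHypercubeDecomposition 1 v I) : 1 ∈ I := by
  obtain ⟨z, hz, rfl⟩ := hI.principal
  exact ⟨.refl, one_le z⟩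

theorem IsHypercubeDecomposition.not_crosses (hI : IsHypercubeDecomposition 1 v I)
    {w : Perm (Fin n)} (h : w ∈ I) {j : ℕ} (hj : IsCut v I j) : ¬ Crosses w j := by
  obtain ⟨a, b, rfl, hb, h1, h2⟩ := hj
  intro hc
  exact h2 (hI.lower ((swap_le_iff_crosses hb).2 hc) h)

/-- Crossing is inherited upwards in Bruhat order, so everything below `w` avoids the cuts too. By
induction the three lower vertices of a diamond with top `w` are in `I`, and closure adds `w`. -/
theorem IsHypercubeDecomposition.mem_of_not_crosses (hI : IsHypercubeDecomposition 1 v I)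
    (w : Perm (Fin n)) (hw : BruhatLE w v) (h : ∀ j, IsCut v I j → ¬ Crosses w j) : w ∈ I := by
  rcases eq_one_or_swap_or_isDiamondTop w with rfl | ⟨i, j, hij, rfl⟩ | ⟨a, b, c, hbc, e1, e2, e3, e4⟩
  · exact hI.one_mem
  · by_contra hc
    refine h i ⟨i, j, rfl, hij, hw, hc⟩ ?_
    rw [crosses_swap (by rw [Fin.lt_def]; omega)]
    omega
  · have key : ∀ x, BruhatLE x w → length x < length w → x ∈ I := fun x hx _ =>
      hI.mem_of_not_crosses x (hx.trans hw) fun j hj hc => h j hj (hc.mono hx)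
    have hb := key b e3.le e3.2
    have hc := key c e4.le e4.2
    have ha := key a (e1.le.trans e3.le) (e1.2.trans e3.2)
    refine (hI.diamondClosed a b c w ⟨?_, ?_, ?_, ?_, hbc, e1, e2, e3, e4⟩).1 ha hb hc <;>
      rw [mem_interval_one]
    exacts [hI.le ha, hI.le hb, hI.le hc, hw]
termination_by length w

theorem IsHypercubeDecomposition.exists_cut (hI : IsHypercubeDecomposition 1 v I)
    {w : Perm (Fin n)} (hw : BruhatLE w v) (h : w ∉ I) : ∃ j, IsCut v I j ∧ Crosses w j := by
  by_contra hc
  push Not at hc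
  exact h (hI.mem_of_not_crosses w hw hc)

theorem IsHypercubeDecomposition.not_mem (hI : IsHypercubeDecomposition 1 v I)
    {w : Perm (Fin n)} {j : ℕ} (hj : IsCut v I j) (h : Crosses w j) : w ∉ I :=
  fun hw => hI.not_crosses hw hj h

/-! ### Hypercubes as functions on finite sets of permutations -/

/-- A hypercube in `[e, v]` with bottom `x` spanned by `Y`, given by a function on all finite sets
of permutations of which only the values at subsets of `Y` matter. -/
structure Cube (v x : Perm (Fin n)) (Y : Finset (Perm (Fin n)))
    (ψ : Finset (Perm (Fin n)) → Perm (Fin n)) : Prop where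
  le : ∀ A ⊆ Y, BruhatLE (ψ A) v
  inj : ∀ A ⊆ Y, ∀ B ⊆ Y, ψ A = ψ B → A = B
  edge : ∀ A ⊆ Y, ∀ y ∈ Y, y ∉ A → Edge (ψ A) (ψ (insert y A))
  bot : ψ ∅ = x
  atom : ∀ y ∈ Y, ψ {y} = y

theorem Cube.mono {x : Perm (Fin n)} {Y Z : Finset (Perm (Fin n))}
    {ψ : Finset (Perm (Fin n)) → Perm (Fin n)} (h : Cube v x Y ψ) (hZ : Z ⊆ Y) : Cube v x Z ψ :=
  ⟨fun A hA => h.le A (hA.trans hZ), fun A hA B hB => h.inj A (hA.trans hZ) B (hB.trans hZ),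
    fun A hA y hy => h.edge A (hA.trans hZ) y (hZ hy), h.bot, fun y hy => h.atom y (hZ hy)⟩

theorem IsHypercube.cube {x : Perm (Fin n)} {Y : Finset (Perm (Fin n))}
    {φ : Finset Y → Perm (Fin n)} (h : IsHypercube 1 v x Y φ) :
    Cube v x Y fun A => φ (A.subtype (· ∈ Y)) where
  le A _ := (h.mem _).2
  inj A hA B hB e := by
    have h1 := h.injective e
    ext a
    constructor
    · intro ha
      have : (⟨a, hA ha⟩ : Y) ∈ A.subtype (· ∈ Y) := by simpa using ha
      rw [h1] at this; simpa using this
    · intro ha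
      have : (⟨a, hB ha⟩ : Y) ∈ B.subtype (· ∈ Y) := by simpa using ha
      rw [← h1] at this; simpa using this
  edge A hA y hy hyA := by
    apply h.edge
    have h1 : (insert y A).subtype (· ∈ Y) = insert (⟨y, hy⟩ : Y) (A.subtype (· ∈ Y)) := by
      ext a; simp [Subtype.ext_iff]
    rw [h1]
    exact Finset.covBy_insert (by simpa using hyA)
  bot := by
    have : (∅ : Finset (Perm (Fin n))).subtype (· ∈ Y) = ∅ := by ext; simp
    simp only [this, h.bot]
  atom y hy := by
    have : ({y} : Finset (Perm (Fin n))).subtype (· ∈ Y) = {⟨y, hy⟩} := by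
      ext a; simp [Subtype.ext_iff]
    simp only [this, h.atom]

theorem Cube.isHypercube {x : Perm (Fin n)} {Y : Finset (Perm (Fin n))}
    {ψ : Finset (Perm (Fin n)) → Perm (Fin n)} (h : Cube v x Y ψ) :
    IsHypercube 1 v x Y fun A => ψ (A.map (Function.Embedding.subtype _)) := by
  have hsub : ∀ A : Finset Y, A.map (Function.Embedding.subtype _) ⊆ Y := by
    intro A a ha
    simp only [Finset.mem_map] at ha
    obtain ⟨b, -, rfl⟩ := ha
    exact b.2
  refine ⟨fun A => mem_interval_one.2 (h.le _ (hsub A)), ?_, ?_, ?_, ?_⟩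
  · intro A B e
    exact Finset.map_injective _ (h.inj _ (hsub A) _ (hsub B) e)
  · intro A B hAB
    obtain ⟨a, ha, rfl⟩ := Finset.covBy_iff_exists_insert.1 hAB
    rw [Finset.map_insert]
    exact h.edge _ (hsub A) _ a.2 (by simpa using ha)
  · simp only [Finset.map_empty, h.bot]
  · intro y
    simp only [Finset.map_singleton]
    exact h.atom _ y.2

theorem HasCluster.exists_cube {x : Perm (Fin n)} (h : HasCluster 1 v I x)
    {Y : Finset (Perm (Fin n))} (hY : Y ∈ Antichains 1 v I x) : ∃ ψ, Cube v x Y ψ := by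
  obtain ⟨φ, hφ, -⟩ := h Y hY
  exact ⟨_, hφ.cube⟩

theorem HasCluster.cube_unique {x : Perm (Fin n)} (h : HasCluster 1 v I x)
    {Y : Finset (Perm (Fin n))} (hY : Y ∈ Antichains 1 v I x)
    {ψ ψ' : Finset (Perm (Fin n)) → Perm (Fin n)} (h1 : Cube v x Y ψ) (h2 : Cube v x Y ψ') :
    ψ Y = ψ' Y := by
  have := (h Y hY).unique h1.isHypercube h2.isHypercube
  have h3 := congrFun this Finset.univ
  have : (Finset.univ : Finset Y).map (Function.Embedding.subtype _) = Y := by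
    ext a; simp
  simpa only [this] using h3

theorem HasCluster.theta_eq {x : Perm (Fin n)} (h : HasCluster 1 v I x)
    {Y : Finset (Perm (Fin n))} (hY : Y ∈ Antichains 1 v I x)
    {ψ : Finset (Perm (Fin n)) → Perm (Fin n)} (h1 : Cube v x Y ψ) :
    theta 1 v x Y = ψ Y := by
  have hex : ∃ φ : Finset Y → Perm (Fin n), IsHypercube 1 v x Y φ := ⟨_, h1.isHypercube⟩
  rw [theta, dif_pos hex]
  have h2 := h.cube_unique hY h1 hex.choose_spec.cube
  rw [h2]
  ext a; simp

theorem Antichains.mono {x : Perm (Fin n)} {Y Z : Finset (Perm (Fin n))}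
    (hY : Y ∈ Antichains 1 v I x) (hZ : Z ⊆ Y) : Z ∈ Antichains 1 v I x :=
  ⟨fun _ ha => hY.1 (hZ ha), hY.2.subset (by exact_mod_cast hZ)⟩

/-- The hypercube map is itself a hypercube. -/
theorem HasCluster.cube_theta {x : Perm (Fin n)} (h : HasCluster 1 v I x)
    {Y : Finset (Perm (Fin n))} (hY : Y ∈ Antichains 1 v I x) : Cube v x Y (theta 1 v x) := by
  obtain ⟨ψ, hψ⟩ := h.exists_cube hY
  have key : ∀ A ⊆ Y, theta 1 v x A = ψ A := fun A hA =>
    h.theta_eq (Antichains.mono hY hA) (hψ.mono hA)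
  refine ⟨?_, ?_, ?_, ?_, ?_⟩
  · intro A hA; rw [key A hA]; exact hψ.le A hA
  · intro A hA B hB e; rw [key A hA, key B hB] at e; exact hψ.inj A hA B hB e
  · intro A hA y hy hyA
    rw [key A hA, key _ (Finset.insert_subset hy hA)]
    exact hψ.edge A hA y hy hyA
  · rw [key _ (Finset.empty_subset _)]; exact hψ.bot
  · intro y hy
    rw [key _ (Finset.singleton_subset_iff.2 hy)]; exact hψ.atom y hy

theorem Cube.pair_of_diamond {x y z w : Perm (Fin n)} (hyz : y ≠ z) (hw : BruhatLE w v)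
    (e1 : Edge x y) (e2 : Edge x z) (e3 : Edge y w) (e4 : Edge z w) :
    Cube v x {y, z} fun A => if y ∈ A then (if z ∈ A then w else y) else (if z ∈ A then z else x) := by
  have key : ∀ A ⊆ ({y, z} : Finset (Perm (Fin n))), A = ∅ ∨ A = {y} ∨ A = {z} ∨ A = {y, z} := by
    intro A hA
    rw [Finset.subset_iff] at hA
    by_cases h1 : y ∈ A <;> by_cases h2 : z ∈ A
    · right; right; right; ext a; specialize @hA a; simp at hA ⊢; grind
    · right; left; ext a; specialize @hA a; simp at hA ⊢; grind
    · right; right; left; ext a; specialize @hA a; simp at hA ⊢; grind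
    · left; ext a; specialize @hA a; simp at hA ⊢; grind
  have hzy := hyz.symm
  have d1 := e1.ne
  have d2 := e2.ne
  have d3 := e3.ne
  have d4 := e4.ne
  have d5 : x ≠ w := by rintro rfl; exact lt_asymm e1.2 e3.2
  have d1' := e1.ne.symm
  have d2' := e2.ne.symm
  have d3' := e3.ne.symm
  have d4' := e4.ne.symm
  have d5' := d5.symm
  refine ⟨?_, ?_, ?_, by simp, ?_⟩
  · intro A hA
    rcases key A hA with rfl | rfl | rfl | rfl <;> simp [hyz, hzy]
    · exact e1.le.trans (e3.le.trans hw)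
    · exact e3.le.trans hw
    · exact e4.le.trans hw
    · exact hw
  · intro A hA B hB
    rcases key A hA with rfl | rfl | rfl | rfl <;> rcases key B hB with rfl | rfl | rfl | rfl <;>
      simp [*]
  · intro A hA u hu huA
    simp only [Finset.mem_insert, Finset.mem_singleton] at hu
    rcases key A hA with rfl | rfl | rfl | rfl <;> rcases hu with rfl | rfl <;>
      simp_all
  · intro u hu
    simp only [Finset.mem_insert, Finset.mem_singleton] at hu
    rcases hu with rfl | rfl <;> simp [*]

/-- The top of a two-dimensional face of a cube. -/
theorem Cube.face {x : Perm (Fin n)} {Y : Finset (Perm (Fin n))}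
    {ψ : Finset (Perm (Fin n)) → Perm (Fin n)} (h : Cube v x Y ψ) {A : Finset (Perm (Fin n))}
    (hA : A ⊆ Y) {y z : Perm (Fin n)} (hy : y ∈ Y) (hz : z ∈ Y) (hyA : y ∉ A) (hzA : z ∉ A)
    (hyz : y ≠ z) {t s : Perm (Fin n)} (ht : ψ (insert y A) = ψ A * t)
    (hs : ψ (insert z A) = ψ A * s) :
    ψ (insert y (insert z A)) = ψ A * t * s ∨ ψ (insert y (insert z A)) = ψ A * s * t := by
  have e1 := h.edge A hA y hy hyA
  have e2 := h.edge A hA z hz hzA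
  have e3 := h.edge (insert y A) (Finset.insert_subset hy hA) z hz (by simp [hyz.symm, hzA])
  have e4 := h.edge (insert z A) (Finset.insert_subset hz hA) y hy (by simp [hyz, hyA])
  rw [Finset.insert_comm] at e3
  have key : ∀ {t : Perm (Fin n)}, Edge (ψ A) (ψ A * t) → t.IsSwap := by
    intro t he
    obtain ⟨i, j, hij, -, h5⟩ := he.exists_swap
    exact ⟨i, j, hij.ne, mul_left_cancel h5⟩
  rw [ht] at e1 e3
  rw [hs] at e2 e4
  refine diamond_top (key e1) (key e2) ?_ e1 e3 e4
  rintro rfl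
  have h6 := h.inj _ (Finset.insert_subset hy hA) _ (Finset.insert_subset hz hA) (ht.trans hs.symm)
  have h7 : y ∈ insert z A := by rw [← h6]; simp
  simp [hyz, hyA] at h7

/-! ### The shape of the transpositions outside `I` -/

theorem mem_out {x y : Perm (Fin n)} (hI : IsHypercubeDecomposition 1 v I) {j : ℕ}
    (hj : IsCut v I j) (hc : Crosses y j) (hy : BruhatLE y v) (e : Edge x y) :
    y ∈ Out 1 v I x :=
  ⟨mem_interval_one.2 hy, hI.not_mem hj hc, e⟩

theorem edge_one_swap {a b : Fin n} (h : a < b) : Edge 1 (swap a b) := by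
  simpa using edge_of_swap (x := (1 : Perm (Fin n))) h (by simpa using h)

theorem pair_mem_antichains {x y z : Perm (Fin n)} (hy : y ∈ Out 1 v I x) (hz : z ∈ Out 1 v I x)
    (h1 : ¬ BruhatLE y z) (h2 : ¬ BruhatLE z y) : {y, z} ∈ Antichains 1 v I x := by
  refine ⟨?_, ?_⟩
  · intro u hu
    simp only [Finset.coe_insert, Finset.coe_singleton, Set.mem_insert_iff,
      Set.mem_singleton_iff] at hu
    rcases hu with rfl | rfl <;> assumption
  · intro a ha b hb hab
    simp only [Finset.coe_insert, Finset.coe_singleton, Set.mem_insert_iff,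
      Set.mem_singleton_iff] at ha hb
    rcases ha with rfl | rfl <;> rcases hb with rfl | rfl
    · exact absurd rfl hab
    · exact h1
    · exact h2
    · exact absurd rfl hab

/-- The symmetric group on `i < j < k`: the three-cycle `(i j)(j k)`, and its inverse by `edge_inv`,
lie above `(i j)` and `(j k)` and below `(i k)`. -/
theorem edge_left_threeCycle {i j k : Fin n} (hij : i < j) (hjk : j < k) :
    Edge (swap i j) (swap i j * swap j k) :=
  edge_of_swap hjk (by
    rw [swap_apply_right, swap_apply_of_ne_of_ne (hij.trans hjk).ne' hjk.ne']
    exact hij.trans hjk)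

theorem edge_right_threeCycle {i j k : Fin n} (hij : i < j) (hjk : j < k) :
    Edge (swap j k) (swap i j * swap j k) := by
  rw [edge_swap_mul hij.ne, swap_inv, swap_apply_of_ne_of_ne hij.ne (hij.trans hjk).ne,
    swap_apply_left]
  simp [hij, hij.trans hjk]

theorem threeCycle_edge {i j k : Fin n} (hij : i < j) (hjk : j < k) :
    Edge (swap i j * swap j k) (swap i k) := by
  have := edge_of_swap (x := swap i j * swap j k) hij (by
    simp [swap_apply_of_ne_of_ne hij.ne (hij.trans hjk).ne,
      swap_apply_of_ne_of_ne (hij.trans hjk).ne' hjk.ne', hjk])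
  rw [swap_mul_swap_rotate (hij.trans hjk).ne hjk.ne] at this ⊢
  rwa [mul_assoc, swap_mul_self, mul_one] at this

/-- No transposition below `v` crosses two cuts. -/
theorem IsHypercubeDecomposition.not_swap_le_of_cuts (hI : IsHypercubeDecomposition 1 v I)
    {i j : ℕ} (hi : IsCut v I i) (hj : IsCut v I j) (hij : i < j) {a b : Fin n} (ha : a.val ≤ i)
    (hb : j < b.val) : ¬ BruhatLE (swap a b) v := by
  intro hv
  have hbn := b.isLt
  obtain ⟨i', hi'⟩ : ∃ x : Fin n, x.val = i := ⟨⟨i, by omega⟩, rfl⟩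
  obtain ⟨m, hm⟩ : ∃ x : Fin n, x.val = i + 1 := ⟨⟨i + 1, by omega⟩, rfl⟩
  obtain ⟨k, hk⟩ : ∃ x : Fin n, x.val = j + 1 := ⟨⟨j + 1, by omega⟩, rfl⟩
  have him : i' < m := by rw [Fin.lt_def]; omega
  have hmk : m < k := by rw [Fin.lt_def]; omega
  have hv' : BruhatLE (swap i' k) v :=
    hv.swap_mono (him.trans hmk) (by rw [Fin.le_def]; omega) (by rw [Fin.le_def]; omega)
  have hy : swap i' m ∈ Out 1 v I 1 :=
    mem_out hI hi (by rw [crosses_swap him]; omega) (hv'.swap_mono him le_rfl hmk.le)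
      (edge_one_swap him)
  have hz : swap m k ∈ Out 1 v I 1 :=
    mem_out hI hj (by rw [crosses_swap hmk]; omega) (hv'.swap_mono hmk him.le le_rfl)
      (edge_one_swap hmk)
  have hanti := pair_mem_antichains hy hz
    (by rw [swap_le_swap_iff him hmk]; omega) (by rw [swap_le_swap_iff hmk him]; omega)
  have hle := (threeCycle_edge him hmk).le
  have hle' : BruhatLE (swap m k * swap i' m) (swap i' k) := by simpa using hle.inv
  have hne : swap i' m ≠ swap m k := by
    intro e
    have := congrArg (fun f => f i') e
    simp [swap_apply_of_ne_of_ne him.ne (him.trans hmk).ne, him.ne'] at this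
  -- Both three-cycles lie below `(i' k)`, hence below `v`, and complete the same antichain to a
  -- diamond. This contradicts uniqueness at the identity.
  have c1 := Cube.pair_of_diamond hne (hle.trans hv') (edge_one_swap him) (edge_one_swap hmk)
    (edge_left_threeCycle him hmk) (edge_right_threeCycle him hmk)
  have c2 := Cube.pair_of_diamond hne (hle'.trans hv') (edge_one_swap him) (edge_one_swap hmk)
    (by simpa using edge_inv (edge_left_threeCycle him hmk))
    (by simpa using edge_inv (edge_right_threeCycle him hmk))
  have := (hI.cluster 1 hI.one_mem).cube_unique hanti c1 c2
  simp at this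
  have := congrArg (fun f => f m) this
  simp [swap_apply_of_ne_of_ne (him.trans hmk).ne' hmk.ne',
    swap_apply_of_ne_of_ne him.ne (him.trans hmk).ne, (him.trans hmk).ne'] at this

/-! ### Faces of dimension two and three of a hypercube. -/

theorem Cube.face_pair {x y z t s : Perm (Fin n)} {Y : Finset (Perm (Fin n))}
    {ψ : Finset (Perm (Fin n)) → Perm (Fin n)} (h : Cube v x Y ψ) (hy : y ∈ Y) (hz : z ∈ Y)
    (hyz : y ≠ z) (ht : y = x * t) (hs : z = x * s) :
    ψ {y, z} = x * t * s ∨ ψ {y, z} = x * s * t := by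
  have := h.face (Finset.empty_subset Y) hy hz (by simp) (by simp) hyz
    (t := t) (s := s) (by rw [insert_empty_eq, h.atom y hy, h.bot, ht])
    (by rw [insert_empty_eq, h.atom z hz, h.bot, hs])
  rwa [insert_empty_eq, h.bot] at this

theorem Cube.face_triple {x y z w t s : Perm (Fin n)} {Y : Finset (Perm (Fin n))}
    {ψ : Finset (Perm (Fin n)) → Perm (Fin n)} (h : Cube v x Y ψ) (hy : y ∈ Y) (hz : z ∈ Y)
    (hw : w ∈ Y) (hyz : y ≠ z) (hyw : y ≠ w) (hzw : z ≠ w) (ht : ψ {y, z} = y * t)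
    (hs : ψ {y, w} = y * s) :
    ψ {y, z, w} = y * t * s ∨ ψ {y, z, w} = y * s * t := by
  have := h.face (A := {y}) (by simpa using hy) hz hw (by simpa using hyz.symm)
    (by simpa using hyw.symm) hzw (t := t) (s := s)
    (by rw [h.atom y hy, Finset.pair_comm, ht]) (by rw [h.atom y hy, Finset.pair_comm, hs])
  rw [h.atom y hy] at this
  have e : (insert z (insert w {y}) : Finset (Perm (Fin n))) = {y, z, w} := by
    ext u; simp; tauto
  rwa [e] at this

theorem Cube.edge_pair {x y z : Perm (Fin n)} {Y : Finset (Perm (Fin n))}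
    {ψ : Finset (Perm (Fin n)) → Perm (Fin n)} (h : Cube v x Y ψ) (hy : y ∈ Y) (hz : z ∈ Y)
    (hyz : y ≠ z) : Edge y (ψ {y, z}) := by
  have := h.edge {y} (by simpa using hy) z hz (by simpa using hyz.symm)
  rwa [h.atom y hy, Finset.pair_comm] at this

theorem Cube.edge_triple {x y z w : Perm (Fin n)} {Y : Finset (Perm (Fin n))}
    {ψ : Finset (Perm (Fin n)) → Perm (Fin n)} (h : Cube v x Y ψ) (hy : y ∈ Y) (hz : z ∈ Y)
    (hw : w ∈ Y) (hyw : y ≠ w) (hzw : z ≠ w) :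
    Edge (ψ {y, z}) (ψ {y, z, w}) := by
  have := h.edge {y, z} (Finset.insert_subset hy (by simpa using hz)) w hw
    (by simp [hyw.symm, hzw.symm])
  have e : (insert w {y, z} : Finset (Perm (Fin n))) = {y, z, w} := by
    ext u; simp; tauto
  rwa [e] at this

theorem swap_mul_swap_disjoint {a b c d : Fin n} (h1 : a ≠ c) (h2 : a ≠ d) (h3 : b ≠ c)
    (h4 : b ≠ d) : swap a b * swap c d = swap c d * swap a b := by
  rw [mul_swap_eq_swap_mul, swap_apply_of_ne_of_ne h1.symm h3.symm,
    swap_apply_of_ne_of_ne h2.symm h4.symm]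

theorem length_of_cover {x : Perm (Fin n)} {i j : Fin n} (hij : i < j) (hx : x i < x j)
    (h : ∀ m, i < m → m < j → ¬ (x i < x m ∧ x m < x j)) :
    length (x * swap i j) = length x + 1 := by
  rw [length_mul_swap hij hx]
  have : (Finset.univ.filter fun m => i < m ∧ m < j ∧ x i < x m ∧ x m < x j) = ∅ := by
    rw [Finset.filter_eq_empty_iff]
    rintro m - ⟨h1, h2, h3⟩
    exact h m h1 h2 h3
  rw [this]; simp

/-- A transposition below `v` crossing the cut `b` cannot extend by one point on both sides. -/
theorem IsHypercubeDecomposition.not_swap_le_of_cut (hI : IsHypercubeDecomposition 1 v I)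
    {a b c d : Fin n} (hb : b.val = a.val + 1) (hc : c.val = b.val + 1) (hd : d.val = c.val + 1)
    (hcut : IsCut v I b.val) : ¬ BruhatLE (swap a d) v := by
  intro hv
  have lab : a < b := by rw [Fin.lt_def]; omega
  have lbc : b < c := by rw [Fin.lt_def]; omega
  have lcd : c < d := by rw [Fin.lt_def]; omega
  have lac := lab.trans lbc
  have lbd := lbc.trans lcd
  have lad := lab.trans lbd
  have ab := lab.ne
  have bc := lbc.ne
  have cd := lcd.ne
  have ac := lac.ne
  have bd := lbd.ne
  have ad := lad.ne
  have ba := ab.symm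
  have cb := bc.symm
  have dc := cd.symm
  have ca := ac.symm
  have db := bd.symm
  have da := ad.symm
  -- On the positions `a, b, c, d` the values of `x` are `b, a, d, c`. The covers `A`, `B`, `C` of
  -- `x` span no three-dimensional hypercube, which contradicts the cluster at `x`.
  obtain ⟨x, hx⟩ : ∃ x : Perm (Fin n), x = swap a b * swap c d := ⟨_, rfl⟩
  have xa : x a = b := by subst hx; simp [swap_apply_def, *]
  have xb : x b = a := by subst hx; simp [swap_apply_def, *]
  have xc : x c = d := by subst hx; simp [swap_apply_def, *]
  have xd : x d = c := by subst hx; simp [swap_apply_def, *]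
  obtain ⟨A, hA⟩ : ∃ A, A = x * swap a c := ⟨_, rfl⟩
  obtain ⟨B, hB⟩ : ∃ B, B = x * swap b d := ⟨_, rfl⟩
  obtain ⟨C, hC⟩ : ∃ C, C = x * swap b c := ⟨_, rfl⟩
  have eA : Edge x A := by rw [hA]; exact edge_of_swap lac (by rw [xa, xc]; exact lbd)
  have eB : Edge x B := by rw [hB]; exact edge_of_swap lbd (by rw [xb, xd]; exact lac)
  have eC : Edge x C := by rw [hC]; exact edge_of_swap lbc (by rw [xb, xc]; exact lad)
  -- Ascending paths from `x` to `(a d)` pass through `A`, `B` and `C`, so all three lie below `v`.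
  have top : x * swap a c * swap b c * swap c d = swap a d := by
    rw [hx]
    ext t
    simp only [Perm.mul_apply, swap_apply_def]
    grind
  have top' : x * swap b d * swap b c * swap a b = swap a d := by
    rw [hx]
    ext t
    simp only [Perm.mul_apply, swap_apply_def]
    grind
  have hCA : C * swap a b = A * swap b c := by
    rw [hC, hA, mul_assoc, mul_assoc]
    congr 1
    rw [swap_comm b c, swap_comm a b, swap_mul_swap_rotate ca ba, swap_comm c a, swap_comm c b]
  have lA2 : BruhatLE (A * swap b c) v := by
    have := edge_of_swap (x := A * swap b c) lcd (by rw [hA]; simp [swap_apply_def, *])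
    rw [hA, top] at this
    rw [hA]; exact this.le.trans hv
  have lA : BruhatLE A v := by
    have := edge_of_swap (x := A) lbc (by rw [hA]; simp [swap_apply_def, *])
    exact this.le.trans lA2
  have lC : BruhatLE C v := by
    have := edge_of_swap (x := C) lab (by rw [hC]; simp [swap_apply_def, *])
    rw [hCA] at this
    exact this.le.trans lA2
  have lB : BruhatLE B v := by
    have e1 := edge_of_swap (x := B) lbc (by rw [hB]; simp [swap_apply_def, *])
    have e2 := edge_of_swap (x := B * swap b c) lab (by rw [hB]; simp [swap_apply_def, *])
    rw [hB, top'] at e2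
    rw [hB] at e1 ⊢
    exact e1.le.trans (e2.le.trans hv)
  -- The only indices `x` can cross are `a` and `c`; were one of them a cut, `(a d)` would cross two
  -- cuts.
  have hxI : x ∈ I := by
    refine hI.mem_of_not_crosses x (eA.le.trans lA) fun j hj hcr => ?_
    rw [hx] at hcr
    rcases hcr.of_mul with h1 | h1
    · rw [crosses_swap lab] at h1
      obtain rfl : j = a.val := by omega
      exact hI.not_swap_le_of_cuts hj hcut (by omega) le_rfl (by omega) hv
    · rw [crosses_swap lcd] at h1
      obtain rfl : j = c.val := by omega
      exact hI.not_swap_le_of_cuts hcut hj (by omega) (by omega) (by omega) hv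
  have oA : A ∈ Out 1 v I x := mem_out hI hcut
    ⟨a, by omega, by rw [hA, Perm.mul_apply, swap_apply_left, xc]; omega⟩ lA eA
  have oB : B ∈ Out 1 v I x := mem_out hI hcut
    ⟨b, by omega, by rw [hB, Perm.mul_apply, swap_apply_left, xd]; omega⟩ lB eB
  have oC : C ∈ Out 1 v I x := mem_out hI hcut
    ⟨b, by omega, by rw [hC, Perm.mul_apply, swap_apply_left, xc]; omega⟩ lC eC
  have nAB : A ≠ B := by
    intro e; have := congrArg (fun f => f a) e; rw [hA, hB] at this; simp [swap_apply_def, *] at this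
  have nAC : A ≠ C := by
    intro e; have := congrArg (fun f => f a) e; rw [hA, hC] at this; simp [swap_apply_def, *] at this
  have nBC : B ≠ C := by
    intro e; have := congrArg (fun f => f b) e; rw [hB, hC] at this; simp [swap_apply_def, *] at this
  have lenA : length A = length x + 1 := by
    rw [hA]
    refine length_of_cover lac (by rw [xa, xc]; exact lbd) fun m h1 h2 h3 => ?_
    rw [Fin.lt_def] at h1 h2
    obtain rfl : m = b := Fin.ext (by omega)
    rw [xa, xb] at h3; order
  have lenB : length B = length x + 1 := by
    rw [hB]
    refine length_of_cover lbd (by rw [xb, xd]; exact lac) fun m h1 h2 h3 => ?_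
    rw [Fin.lt_def] at h1 h2
    obtain rfl : m = c := Fin.ext (by omega)
    rw [xc, xd] at h3; order
  have lenC : length C = length x + 1 := by
    rw [hC]
    refine length_of_cover lbc (by rw [xb, xc]; exact lad) fun m h1 h2 h3 => ?_
    rw [Fin.lt_def] at h1 h2
    omega
  have hY : ({A, B, C} : Finset (Perm (Fin n))) ∈ Antichains 1 v I x := by
    refine ⟨?_, ?_⟩
    · intro u hu
      simp only [Finset.coe_insert, Finset.coe_singleton, Set.mem_insert_iff,
        Set.mem_singleton_iff] at hu
      rcases hu with rfl | rfl | rfl <;> assumption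
    · intro u hu w hw huw hle
      apply huw
      apply hle.eq_of_length_eq
      simp only [Finset.coe_insert, Finset.coe_singleton, Set.mem_insert_iff,
        Set.mem_singleton_iff] at hu hw
      have hlen : ∀ u, (u = A ∨ u = B ∨ u = C) → length u = length x + 1 := by
        rintro u (rfl | rfl | rfl) <;> assumption
      rw [hlen u hu, hlen w hw]
  obtain ⟨ψ, hψ⟩ := (hI.cluster x hxI).exists_cube hY
  have mA : A ∈ ({A, B, C} : Finset (Perm (Fin n))) := by simp
  have mB : B ∈ ({A, B, C} : Finset (Perm (Fin n))) := by simp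
  have mC : C ∈ ({A, B, C} : Finset (Perm (Fin n))) := by simp
  have hAB : ψ {A, B} = A * swap b d := by
    rw [hA]
    rcases hψ.face_pair mA mB nAB hA hB with h | h
    · rw [hA] at h; exact h
    · rw [hA] at h; rw [h, mul_assoc, mul_assoc, swap_mul_swap_disjoint ba bc da dc]
  have hAC : ψ {A, C} = A * swap b c := by
    rcases hψ.face_pair mA mC nAC hA hC with h | h
    · rw [h, hA]
    · have := hψ.edge_pair mC mA nAC.symm
      rw [Finset.pair_comm, h, ← hC, edge_mul_swap ac, hC] at this
      simp [swap_apply_def, *] at this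
      order
  have e1 := hψ.edge_triple mA mB mC nAC nBC
  -- Neither candidate for the top vertex lies above the vertex at `{A, B}`.
  rcases hψ.face_triple mA mB mC nAB nAC nBC hAB hAC with h | h
  · rw [h, hAB, edge_mul_swap bc, hA] at e1
    simp [swap_apply_def, *] at e1
    order
  · have h5 : A * swap b c * swap b d = A * swap b d * swap c d := by
      rw [mul_assoc, mul_assoc]
      congr 1
      rw [mul_swap_eq_swap_mul (swap b d) c d, swap_apply_of_ne_of_ne cb cd, swap_apply_right,
        swap_comm c b]
    rw [h, hAB, h5, edge_mul_swap cd, hA] at e1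
    simp [swap_apply_def, *] at e1
    order

theorem mul_swap_conj (w : Perm (Fin n)) {i j k : Fin n} (hij : i ≠ j) (hjk : j ≠ k) :
    w * swap i j * swap i k = w * swap i k * swap j k := by
  rw [mul_assoc, mul_assoc]
  congr 1
  rw [mul_swap_eq_swap_mul (swap i k) j k, swap_apply_of_ne_of_ne hij.symm hjk, swap_apply_right,
    swap_comm j i]

/-- Transpositions below `v` crossing different cuts do not overlap. -/
theorem IsHypercubeDecomposition.not_overlap (hI : IsHypercubeDecomposition 1 v I)
    {i a b k : Fin n} {j : ℕ} (hia : i < a) (hb : b.val = a.val + 1) (haj : a.val < j)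
    (hk : k.val = j + 1) (ci : IsCut v I i.val) (cj : IsCut v I j)
    (h1 : BruhatLE (swap i b) v) (h2 : BruhatLE (swap a k) v) : False := by
  have lia := hia
  have lab : a < b := by rw [Fin.lt_def]; omega
  have lbk : b < k := by rw [Fin.lt_def]; omega
  have lib := lia.trans lab
  have lak := lab.trans lbk
  have lik := lia.trans lak
  have ia := lia.ne
  have ab := lab.ne
  have bk := lbk.ne
  have ib := lib.ne
  have ak := lak.ne
  have ik := lik.ne
  have ai := ia.symm
  have ba := ab.symm
  have kb := bk.symm
  have bi := ib.symm
  have ka := ak.symm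
  have ki := ik.symm
  -- At `x = (a b)` the edges to `P`, `Q` cross the cut `i` and those to `R`, `S` cross `j`. They
  -- span a four-dimensional hypercube whose faces are forced one after another, and whose top is
  -- `(i k)`, which crosses both cuts.
  obtain ⟨x, hx⟩ : ∃ x : Perm (Fin n), x = swap a b := ⟨_, rfl⟩
  have xi : x i = i := by subst hx; simp [swap_apply_def, *]
  have xa : x a = b := by subst hx; simp
  have xb : x b = a := by subst hx; simp
  have xk : x k = k := by subst hx; simp [swap_apply_def, *]
  obtain ⟨P, hP⟩ : ∃ A, A = x * swap i a := ⟨_, rfl⟩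
  obtain ⟨Q, hQ⟩ : ∃ A, A = x * swap i b := ⟨_, rfl⟩
  obtain ⟨R, hR⟩ : ∃ A, A = x * swap a k := ⟨_, rfl⟩
  obtain ⟨S, hS⟩ : ∃ A, A = x * swap b k := ⟨_, rfl⟩
  have hQ' : Q = swap i a * swap a b := by
    rw [hQ, hx, mul_swap_eq_swap_mul, swap_apply_of_ne_of_ne ia ib, swap_apply_right]
  have hP' : P = Q⁻¹ := by rw [hP, hQ', hx, mul_inv_rev, swap_inv, swap_inv]
  have hS' : S = swap a b * swap b k := by rw [hS, hx]
  have hR' : R = S⁻¹ := by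
    rw [hR, hS', hx, mul_inv_rev, swap_inv, swap_inv, mul_swap_eq_swap_mul, swap_apply_left,
      swap_apply_of_ne_of_ne ka kb]
  have lQ' : BruhatLE Q (swap i b) := by rw [hQ']; exact (threeCycle_edge lia lab).le
  have lP' : BruhatLE P (swap i b) := by rw [hP']; simpa using lQ'.inv
  have lS' : BruhatLE S (swap a k) := by rw [hS']; exact (threeCycle_edge lab lbk).le
  have lR' : BruhatLE R (swap a k) := by rw [hR']; simpa using lS'.inv
  have eP : Edge x P := by rw [hP]; exact edge_of_swap lia (by rw [xi, xa]; exact lib)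
  have eQ : Edge x Q := by rw [hQ]; exact edge_of_swap lib (by rw [xi, xb]; exact lia)
  have eR : Edge x R := by rw [hR]; exact edge_of_swap lak (by rw [xa, xk]; exact lbk)
  have eS : Edge x S := by rw [hS]; exact edge_of_swap lbk (by rw [xb, xk]; exact lak)
  have hxI : x ∈ I := by
    refine hI.mem_of_not_crosses x (eP.le.trans (lP'.trans h1)) fun m hm hcr => ?_
    rw [hx, crosses_swap lab] at hcr
    exact hI.not_swap_le_of_cuts ci hm (by rw [Fin.lt_def] at hia; omega) le_rfl (by omega) h1
  rw [Fin.lt_def] at hia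
  have cP : Crosses P i.val := ⟨i, le_rfl, by rw [hP, Perm.mul_apply, swap_apply_left, xa]; omega⟩
  have cQ : Crosses Q i.val := ⟨i, le_rfl, by rw [hQ, Perm.mul_apply, swap_apply_left, xb]; omega⟩
  have cR : Crosses R j := ⟨a, by omega, by rw [hR, Perm.mul_apply, swap_apply_left, xk]; omega⟩
  have cS : Crosses S j := ⟨b, by omega, by rw [hS, Perm.mul_apply, swap_apply_left, xk]; omega⟩
  have ncI : ¬ Crosses (swap i b) j := by rw [crosses_swap lib]; omega
  have ncJ : ¬ Crosses (swap a k) i.val := by rw [crosses_swap lak]; omega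
  have oP : P ∈ Out 1 v I x := mem_out hI ci cP (lP'.trans h1) eP
  have oQ : Q ∈ Out 1 v I x := mem_out hI ci cQ (lQ'.trans h1) eQ
  have oR : R ∈ Out 1 v I x := mem_out hI cj cR (lR'.trans h2) eR
  have oS : S ∈ Out 1 v I x := mem_out hI cj cS (lS'.trans h2) eS
  have nPQ : P ≠ Q := by
    intro e; have := congrArg (fun f => f i) e; rw [hP, hQ] at this; simp [*] at this
  have nRS : R ≠ S := by
    intro e; have := congrArg (fun f => f k) e; rw [hR, hS] at this; simp [*] at this
  have nRi : ¬ Crosses R i.val := fun h => ncJ (h.mono lR')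
  have nSi : ¬ Crosses S i.val := fun h => ncJ (h.mono lS')
  have nPj : ¬ Crosses P j := fun h => ncI (h.mono lP')
  have nQj : ¬ Crosses Q j := fun h => ncI (h.mono lQ')
  have nPR : P ≠ R := by rintro e; rw [e] at cP; exact nRi cP
  have nPS : P ≠ S := by rintro e; rw [e] at cP; exact nSi cP
  have nQR : Q ≠ R := by rintro e; rw [e] at cQ; exact nRi cQ
  have nQS : Q ≠ S := by rintro e; rw [e] at cQ; exact nSi cQ
  obtain ⟨Y, hYdef⟩ : ∃ Y : Finset (Perm (Fin n)), Y = {P, Q, R, S} := ⟨_, rfl⟩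
  have hmem : ∀ u, u ∈ Y ↔ u = P ∨ u = Q ∨ u = R ∨ u = S := by intro u; rw [hYdef]; simp
  have mP : P ∈ Y := by simp [hmem]
  have mQ : Q ∈ Y := by simp [hmem]
  have mR : R ∈ Y := by simp [hmem]
  have mS : S ∈ Y := by simp [hmem]
  -- `P` and `Q` are mutually inverse, hence of equal length, and so are `R` and `S`; elements of
  -- different pairs are separated by the cut they cross.
  have hY : Y ∈ Antichains 1 v I x := by
    refine ⟨?_, ?_⟩
    · intro u hu
      rcases (hmem u).1 (by simpa using hu) with rfl | rfl | rfl | rfl <;> assumption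
    · intro u hu w hw huw hle
      have lPQ : length P = length Q := by rw [hP', length_inv]
      have lRS : length R = length S := by rw [hR', length_inv]
      rcases (hmem u).1 (by simpa using hu) with h3 | h3 | h3 | h3 <;>
        rcases (hmem w).1 (by simpa using hw) with h4 | h4 | h4 | h4 <;>
        rw [h3, h4] at hle huw <;>
        first
          | exact huw rfl
          | exact huw (hle.eq_of_length_eq (by omega))
          | exact nRi (cP.mono hle)
          | exact nRi (cQ.mono hle)
          | exact nSi (cP.mono hle)
          | exact nSi (cQ.mono hle)
          | exact nPj (cR.mono hle)
          | exact nPj (cS.mono hle)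
          | exact nQj (cR.mono hle)
          | exact nQj (cS.mono hle)
  obtain ⟨ψ, hψ⟩ := (hI.cluster x hxI).exists_cube hY
  have hPS : ψ {P, S} = P * swap b k := by
    rcases hψ.face_pair mP mS nPS hP hS with h | h
    · rw [h, hP]
    · rw [h, hP, mul_assoc, mul_assoc, swap_mul_swap_disjoint ib ik ab ak]
  have hSP : ψ {S, P} = S * swap i a := by
    rw [Finset.pair_comm, hPS, hP, hS, mul_assoc, mul_assoc, swap_mul_swap_disjoint ib ik ab ak]
  have hRQ : ψ {R, Q} = R * swap i b := by
    rcases hψ.face_pair mR mQ nQR.symm hR hQ with h | h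
    · rw [h, hR]
    · rw [h, hR, mul_assoc, mul_assoc, swap_mul_swap_disjoint ia ik ba bk]
  -- With the other product, neither candidate for the vertex at `{S, Q, P}` would be above this
  -- one. The faces below are decided in the same way.
  have hSQ : ψ {S, Q} = S * swap i k := by
    rcases hψ.face_pair mS mQ nQS.symm hS hQ with h | h
    · exfalso
      rw [← hS] at h
      have e1 := hψ.edge_triple mS mQ mP nPS.symm nPQ.symm
      rcases hψ.face_triple mS mQ mP nQS.symm nPS.symm nPQ.symm h hSP with h' | h'
      · rw [h', h, edge_mul_swap ia, hS] at e1
        simp [swap_apply_def, *] at e1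
        order
      · rw [h', h, mul_swap_conj S ia ab, edge_mul_swap ab, hS] at e1
        simp [swap_apply_def, *] at e1
        order
    · rw [h, hS, swap_comm i b, mul_swap_conj x bi ik]
  have hT1 : ψ {S, Q, P} = S * swap i a * swap k a := by
    rcases hψ.face_triple mS mQ mP nQS.symm nPS.symm nPQ.symm hSQ hSP with h | h
    · rw [h, mul_swap_conj S ik ka]
    · exfalso
      have e1 := hψ.edge_triple mS mP mQ nQS.symm nPQ
      rw [show ({S, P, Q} : Finset (Perm (Fin n))) = {S, Q, P} by rw [Finset.pair_comm P Q],
        h, hSP, edge_mul_swap ik, hS] at e1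
      simp [swap_apply_def, *] at e1
      order
  have hPR : ψ {P, R} = P * swap k i := by
    rcases hψ.face_pair mR mP nPR.symm hR hP with h | h
    · rw [Finset.pair_comm, h, hP, swap_comm i a, mul_swap_conj x ak ki]
    · exfalso
      have h' : ψ {R, P} = R * swap i k := by
        rw [h, hR, swap_comm i a, mul_swap_conj x ai ik]
      have e1 := hψ.edge_triple mR mP mQ nQR.symm nPQ
      rcases hψ.face_triple mR mP mQ nPR.symm nQR.symm nPQ h' hRQ with h3 | h3
      · rw [h3, h', edge_mul_swap ib, hR] at e1
        simp [swap_apply_def, *] at e1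
        order
      · rw [h3, h', mul_swap_conj R ib bk, edge_mul_swap bk, hR] at e1
        simp [swap_apply_def, *] at e1
        order
  have hT2 : ψ {P, R, S} = P * swap b k * swap i b := by
    rcases hψ.face_triple mP mR mS nPR nPS nRS hPR hPS with h | h
    · rw [h, swap_comm b k, mul_swap_conj P ki ib]
    · exfalso
      have e1 := hψ.edge_triple mP mS mR nPR nRS.symm
      rw [show ({P, S, R} : Finset (Perm (Fin n))) = {P, R, S} by rw [Finset.pair_comm S R],
        h, hPS, edge_mul_swap ki, hP] at e1
      simp [swap_apply_def, *] at e1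
      order
  -- Over the vertex at `{P, S}` the labels towards `Q` and `R` commute, so the top is determined.
  have hfin := hψ.face (A := {P, S}) (y := Q) (z := R)
    (Finset.insert_subset mP (by simpa using mS)) mQ mR (by simp [nPQ.symm, nQS])
    (by simp [nPR.symm, nRS]) nQR (t := swap k a) (s := swap i b)
    (by rw [show (insert Q {P, S} : Finset (Perm (Fin n))) = {S, Q, P} by ext u; simp; tauto,
      hT1, Finset.pair_comm, hSP])
    (by rw [show (insert R {P, S} : Finset (Perm (Fin n))) = {P, R, S} by ext u; simp; tauto,
      hT2, hPS])
  have hcomm : ψ {P, S} * swap k a * swap i b = ψ {P, S} * swap i b * swap k a := by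
    rw [mul_assoc, mul_assoc, swap_mul_swap_disjoint ki kb ai ab]
  have htop : P * swap b k * swap i b * swap k a = swap i k := by
    rw [hP, hx]
    refine Equiv.ext fun t => ?_
    by_cases ti : t = i
    · subst ti; simp [swap_apply_def, *]
    by_cases ta : t = a
    · subst ta; simp [swap_apply_def, *]
    by_cases tb : t = b
    · subst tb; simp [swap_apply_def, *]
    by_cases tk : t = k
    · subst tk; simp [swap_apply_def, *]
    simp [swap_apply_def, *]
  rw [hcomm, or_self, hPS, htop] at hfin
  refine hI.not_swap_le_of_cuts ci cj (by omega) (a := i) (b := k) le_rfl (by omega) ?_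
  rw [← hfin]
  exact hψ.le _ (Finset.insert_subset mQ (Finset.insert_subset mR (Finset.insert_subset mP
    (by simpa using mS))))

/-- `y = (a b)` is a transposition below `v` which crosses the cut `j`. -/
structure OutAt (v : Perm (Fin n)) (I : Set (Perm (Fin n))) (j : ℕ) (a b : Fin n)
    (y : Perm (Fin n)) : Prop where
  eq : y = swap a b
  lt : a < b
  left_le : a.val ≤ j
  lt_right : j < b.val
  cut : IsCut v I j
  le : BruhatLE y v

/-! ### Shape and mutual position of the transpositions in `𝒴_e`. -/

theorem OutAt.mem_out (hI : IsHypercubeDecomposition 1 v I) {j : ℕ} {a b : Fin n}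
    {y : Perm (Fin n)} (h : OutAt v I j a b y) : y ∈ Out 1 v I 1 := by
  refine BruhatCube.mem_out hI h.cut ?_ h.le ?_
  · rw [h.eq, crosses_swap h.lt]; exact ⟨h.left_le, h.lt_right⟩
  · rw [h.eq]; exact edge_one_swap h.lt

theorem exists_outAt (hI : IsHypercubeDecomposition 1 v I) {y : Perm (Fin n)}
    (h : y ∈ Out 1 v I 1) : ∃ j a b, OutAt v I j a b y := by
  obtain ⟨j, hj, hc⟩ := hI.exists_cut (mem_interval_one.1 h.1) h.2.1
  obtain ⟨a, b, hab, -, rfl⟩ := h.2.2.exists_swap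
  rw [one_mul] at hc h ⊢
  rw [crosses_swap hab] at hc
  exact ⟨j, a, b, rfl, hab, hc.1, hc.2, hj, mem_interval_one.1 h.1⟩

/-- Otherwise the interval contains `[j-1, j+2]`, and `(j-1 j+2)` would lie below `v`. -/
theorem OutAt.shape (hI : IsHypercubeDecomposition 1 v I) {j : ℕ} {a b : Fin n}
    {y : Perm (Fin n)} (h : OutAt v I j a b y) : a.val = j ∨ b.val = j + 1 := by
  by_contra hc
  rw [not_or] at hc
  have h1 := h.left_le
  have h2 := h.lt_right
  have hb := b.isLt
  have hle := h.le
  rw [h.eq] at hle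
  refine hI.not_swap_le_of_cut (a := ⟨j - 1, by omega⟩) (b := ⟨j, by omega⟩) (c := ⟨j + 1, by omega⟩)
    (d := ⟨j + 2, by omega⟩) ?_ rfl rfl h.cut (hle.swap_mono ?_ ?_ ?_)
  · simp only; omega
  · rw [Fin.lt_def]; simp only; omega
  · rw [Fin.le_def]; simp only; omega
  · rw [Fin.le_def]; simp only; omega

/-- Neither interval reaches across the other's cut. An overlap would then contain `c` and `c + 1`
between the two cuts, and shrinking both transpositions gives the configuration of `not_overlap`. -/
theorem OutAt.ordered (hI : IsHypercubeDecomposition 1 v I) {i j : ℕ} {a b c d : Fin n}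
    {y z : Perm (Fin n)} (h : OutAt v I i a b y) (h' : OutAt v I j c d z) (hij : i < j) :
    b ≤ c := by
  by_contra hcb
  rw [not_le, Fin.lt_def] at hcb
  have h1 := h.left_le
  have h2 := h.lt_right
  have h3 := h'.left_le
  have h4 := h'.lt_right
  have hb := b.isLt
  have hd := d.isLt
  have hle := h.le
  rw [h.eq] at hle
  have hle' := h'.le
  rw [h'.eq] at hle'
  have hbj : b.val ≤ j := by
    by_contra hc
    exact hI.not_swap_le_of_cuts h.cut h'.cut hij h1 (by omega) hle
  have hci : i < c.val := by
    by_contra hc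
    exact hI.not_swap_le_of_cuts h.cut h'.cut hij (by omega) h4 hle'
  refine hI.not_overlap (i := ⟨i, by omega⟩) (a := c) (b := ⟨c.val + 1, by omega⟩)
    (k := ⟨j + 1, by omega⟩) ?_ rfl (by omega : c.val < j) rfl h.cut h'.cut
    (hle.swap_mono ?_ ?_ ?_) (hle'.swap_mono ?_ le_rfl ?_)
  all_goals simp only [Fin.lt_def, Fin.le_def]
  all_goals omega

/-- If `(a b)`, `(c d)` cross the same cut `j` and `a < c`, `b < d`, then `b = j + 1`, `c = j`. -/
theorem OutAt.same_cut (hI : IsHypercubeDecomposition 1 v I) {j : ℕ} {a b c d : Fin n}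
    {y z : Perm (Fin n)} (h : OutAt v I j a b y) (h' : OutAt v I j c d z) (hac : a < c)
    (hbd : b < d) : b.val = j + 1 ∧ c.val = j := by
  rw [Fin.lt_def] at hac hbd
  have h1 := h.shape hI
  have h2 := h'.shape hI
  have h3 := h'.left_le
  have h4 := h.lt_right
  omega

theorem OutAt.le_iff {i j : ℕ} {a b c d : Fin n} {y z : Perm (Fin n)} (h : OutAt v I i a b y)
    (h' : OutAt v I j c d z) : BruhatLE y z ↔ c ≤ a ∧ b ≤ d := by
  rw [h.eq, h'.eq, swap_le_swap_iff h.lt h'.lt]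

theorem OutAt.apply_of_ne {i : ℕ} {a b m : Fin n} {y : Perm (Fin n)} (h : OutAt v I i a b y)
    (h1 : m ≠ a) (h2 : m ≠ b) : y m = m := by
  rw [h.eq, swap_apply_of_ne_of_ne h1 h2]

/-- `q` is fixed by all of `T`, and `p` is fixed by all of `T` or is the endpoint facing `q` of an
interval containing all points moved by `T`. -/
def IsEnd (p q : Fin n) (T : Set (Perm (Fin n))) : Prop :=
  (∀ u ∈ T, u q = q) ∧
    ((∀ u ∈ T, u p = p) ∨ (p < q ∧ ∀ u ∈ T, ∀ m, p < m → u m = m) ∨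
      (q < p ∧ ∀ u ∈ T, ∀ m, m < p → u m = m))

/-- If some `u₀` in `T` moves `p`, then `p` is its right endpoint and its cut lies before that of
`z`. The ordering of cuts then excludes that any element of `T` reaches beyond `p`. -/
theorem OutAt.isEnd_right (hI : IsHypercubeDecomposition 1 v I) {j : ℕ} {p q : Fin n}
    {z : Perm (Fin n)} (h : OutAt v I j p q z) {T : Set (Perm (Fin n))}
    (hT : ∀ u ∈ T, ∃ i c d, OutAt v I i c d u ∧ c < p ∧ d < q) : IsEnd p q T := by
  refine ⟨?_, ?_⟩
  · intro u hu
    obtain ⟨i, c, d, hu', h1, h2⟩ := hT u hu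
    exact hu'.apply_of_ne (h1.trans h.lt).ne' h2.ne'
  by_cases hp : ∀ u ∈ T, u p = p
  · exact .inl hp
  push Not at hp
  obtain ⟨u₀, hu₀, hne⟩ := hp
  obtain ⟨i₀, c₀, d₀, ho₀, h1, h2⟩ := hT u₀ hu₀
  have hd : d₀ = p := by
    by_contra hc
    exact hne (ho₀.apply_of_ne h1.ne' (Ne.symm hc))
  subst hd
  refine .inr (.inl ⟨h.lt, fun u hu m hm => ?_⟩)
  obtain ⟨i, c, d, ho, h3, h4⟩ := hT u hu
  have hi₀ := ho₀.lt_right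
  have hj := h.left_le
  suffices hd : d ≤ d₀ from ho.apply_of_ne (h3.trans hm).ne' (hd.trans_lt hm).ne'
  rcases lt_trichotomy i j with hij | hij | hij
  · exact ho.ordered hI h hij
  · subst hij
    exact absurd (ho₀.ordered hI ho (by omega)) (not_le.2 h3)
  · exact absurd (h.ordered hI ho hij) (not_le.2 (h3.trans h.lt))

theorem OutAt.isEnd_left (hI : IsHypercubeDecomposition 1 v I) {j : ℕ} {p q : Fin n}
    {z : Perm (Fin n)} (h : OutAt v I j q p z) {T : Set (Perm (Fin n))}
    (hT : ∀ u ∈ T, ∃ i c d, OutAt v I i c d u ∧ q < c ∧ p < d) : IsEnd p q T := by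
  refine ⟨?_, ?_⟩
  · intro u hu
    obtain ⟨i, c, d, hu', h1, h2⟩ := hT u hu
    exact hu'.apply_of_ne h1.ne (h1.trans hu'.lt).ne
  by_cases hp : ∀ u ∈ T, u p = p
  · exact .inl hp
  push Not at hp
  obtain ⟨u₀, hu₀, hne⟩ := hp
  obtain ⟨i₀, c₀, d₀, ho₀, h1, h2⟩ := hT u₀ hu₀
  have hd : c₀ = p := by
    by_contra hc
    exact hne (ho₀.apply_of_ne (Ne.symm hc) h2.ne)
  subst hd
  refine .inr (.inr ⟨h.lt, fun u hu m hm => ?_⟩)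
  obtain ⟨i, c, d, ho, h3, h4⟩ := hT u hu
  have hi₀ := ho₀.left_le
  have hj := h.lt_right
  suffices hd : c₀ ≤ c from ho.apply_of_ne (hm.trans_le hd).ne (hm.trans h4).ne
  rcases lt_trichotomy i j with hij | hij | hij
  · exact absurd (ho.ordered hI h hij) (not_le.2 (h3.trans ho.lt))
  · subst hij
    exact absurd (ho.ordered hI ho₀ (by omega)) (not_le.2 h4)
  · exact h.ordered hI ho hij

/-! ### Three-cycles -/

theorem edge_threeCycle {c p q : Fin n} (h : c < p ∧ p < q ∨ q < p ∧ p < c) :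
    Edge (swap c p) (swap c p * swap p q) ∧ Edge (swap p q) (swap c p * swap p q) := by
  rcases h with h | h
  · exact ⟨edge_left_threeCycle h.1 h.2, edge_right_threeCycle h.1 h.2⟩
  · have h1 := edge_inv (edge_left_threeCycle h.1 h.2)
    have h2 := edge_inv (edge_right_threeCycle h.1 h.2)
    rw [mul_inv_rev] at h1 h2
    simp only [swap_inv] at h1 h2
    rw [swap_comm c p, swap_comm p q]
    exact ⟨h2, h1⟩

/-- Conjugating by `(a c)` enlarges the three-cycle, and both the right and the left multiplication
go up. -/
theorem threeCycle_mono {a c p q : Fin n} (h : a < c ∧ c < p ∧ p < q ∨ q < p ∧ p < c ∧ c < a) :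
    BruhatLE (swap c p * swap p q) (swap a p * swap p q) := by
  have hac : a ≠ c := by rcases h with h | h <;> order
  have hcp : c ≠ p := by rcases h with h | h <;> order
  have hpq : p ≠ q := by rcases h with h | h <;> order
  have hap : a ≠ p := by rcases h with h | h <;> order
  have hcq : c ≠ q := by rcases h with h | h <;> order
  have haq : a ≠ q := by rcases h with h | h <;> order
  have e1 : Edge (swap c p * swap p q) (swap c p * swap p q * swap a c) := by
    rw [edge_mul_swap hac]
    simp only [Perm.mul_apply, swap_apply_of_ne_of_ne hap haq, swap_apply_of_ne_of_ne hcp hcq,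
      swap_apply_left, swap_apply_of_ne_of_ne hac hap]
    rcases h with h | h
    · simp [h.1, h.1.trans h.2.1]
    · simp [not_lt_of_gt h.2.2, not_lt_of_gt (h.2.1.trans h.2.2)]
  have e2 : Edge (swap c p * swap p q * swap a c) (swap a c * (swap c p * swap p q * swap a c)) := by
    rw [edge_swap_mul hac]
    simp only [mul_inv_rev, swap_inv, Perm.mul_apply, swap_apply_of_ne_of_ne hap haq,
      swap_apply_left, swap_apply_of_ne_of_ne hac hap,
      swap_apply_of_ne_of_ne haq.symm hcq.symm]
    rcases h with h | h
    · simp [h.1, h.2.1.trans h.2.2]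
    · simp [not_lt_of_gt h.2.2, not_lt_of_gt (h.1.trans h.2.1)]
  have e3 : swap a c * (swap c p * swap p q * swap a c) = swap a p * swap p q := by
    rw [← mul_assoc, ← mul_assoc, mul_swap_eq_swap_mul (swap a c), swap_apply_right,
      swap_apply_of_ne_of_ne hap.symm hcp.symm, mul_assoc (swap a p),
      mul_swap_eq_swap_mul (swap a c) p q, swap_apply_of_ne_of_ne hap.symm hcp.symm,
      swap_apply_of_ne_of_ne haq.symm hcq.symm, mul_assoc, mul_assoc, swap_mul_self, mul_one]
  rw [← e3]
  exact e1.le.trans e2.le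

/-! ### The extension property of hypercubes at the identity -/

/-- The top of a two-dimensional face is a product of its bottom and the two edge labels, all
quotients of smaller vertices. Applied to stabilisers, this shows that a vertex fixes every point
fixed by its atoms. -/
theorem Cube.mem_subgroup {Y : Finset (Perm (Fin n))} {ψ : Finset (Perm (Fin n)) → Perm (Fin n)}
    (h : Cube v 1 Y ψ) (H : Subgroup (Perm (Fin n))) (A : Finset (Perm (Fin n))) (hA : A ⊆ Y)
    (hH : ∀ u ∈ A, u ∈ H) : ψ A ∈ H := by
  rcases A.eq_empty_or_nonempty with rfl | ⟨y, hy⟩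
  · rw [h.bot]; exact H.one_mem
  rcases (A.erase y).eq_empty_or_nonempty with he | ⟨z, hz⟩
  · obtain rfl : A = {y} := by rw [← Finset.insert_erase hy, he, insert_empty_eq]
    rw [h.atom y (hA hy)]
    exact hH y hy
  · have hzA := Finset.mem_of_mem_erase hz
    have hyz : z ≠ y := Finset.ne_of_mem_erase hz
    set B := (A.erase y).erase z with hB
    have hBA : B ⊆ A := (Finset.erase_subset _ _).trans (Finset.erase_subset _ _)
    have hzB : insert z B = A.erase y := Finset.insert_erase hz
    have hAeq : insert y (insert z B) = A := by rw [hzB, Finset.insert_erase hy]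
    have hyB : insert y B = A.erase z := by
      rw [hB, Finset.erase_right_comm]
      exact Finset.insert_erase (Finset.mem_erase.2 ⟨hyz.symm, hy⟩)
    have c1 : (A.erase y).card < A.card := Finset.card_erase_lt_of_mem hy
    have c2 : (A.erase z).card < A.card := Finset.card_erase_lt_of_mem hzA
    have c3 : B.card < A.card := (Finset.card_erase_lt_of_mem hz).trans c1
    have i1 := h.mem_subgroup H (A.erase y) ((Finset.erase_subset _ _).trans hA)
      fun u hu => hH u (Finset.mem_of_mem_erase hu)
    have i2 := h.mem_subgroup H (A.erase z) ((Finset.erase_subset _ _).trans hA)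
      fun u hu => hH u (Finset.mem_of_mem_erase hu)
    have i3 := h.mem_subgroup H B (hBA.trans hA) fun u hu => hH u (hBA hu)
    have := h.face (hBA.trans hA) (hA hy) (hA hzA) (by simp [hB]) (by simp [hB]) hyz.symm
      (t := (ψ B)⁻¹ * ψ (A.erase z)) (s := (ψ B)⁻¹ * ψ (A.erase y))
      (by rw [hyB]; simp) (by rw [hzB]; simp)
    rw [hAeq] at this
    rcases this with e | e <;> rw [e]
    · exact H.mul_mem (H.mul_mem i3 (H.mul_mem (H.inv_mem i3) i2)) (H.mul_mem (H.inv_mem i3) i1)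
    · exact H.mul_mem (H.mul_mem i3 (H.mul_mem (H.inv_mem i3) i1)) (H.mul_mem (H.inv_mem i3) i2)
termination_by A.card

theorem Cube.apply_eq {Y : Finset (Perm (Fin n))} {ψ : Finset (Perm (Fin n)) → Perm (Fin n)}
    (h : Cube v 1 Y ψ) {A : Finset (Perm (Fin n))} (hA : A ⊆ Y) {m : Fin n}
    (hm : ∀ u ∈ A, u m = m) : ψ A m = m := by
  have := h.mem_subgroup (MulAction.stabilizer (Perm (Fin n)) m) A hA fun u hu => by
    rw [MulAction.mem_stabilizer_iff]; exact hm u hu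
  rw [MulAction.mem_stabilizer_iff] at this
  exact this

theorem Cube.inv {Y : Finset (Perm (Fin n))} {ψ : Finset (Perm (Fin n)) → Perm (Fin n)}
    (h : Cube v 1 Y ψ) (hY : ∀ y ∈ Y, y⁻¹ = y) : Cube v⁻¹ 1 Y fun A => (ψ A)⁻¹ :=
  ⟨fun A hA => (h.le A hA).inv, fun A hA B hB e => h.inj A hA B hB (inv_injective e),
    fun A hA y hy hyA => edge_inv (h.edge A hA y hy hyA), by simp [h.bot],
    fun y hy => by simp only [h.atom y hy, hY y hy]⟩

theorem eq_swap_of_isSwap {t : Perm (Fin n)} (ht : t.IsSwap) {p : Fin n} (hp : t p ≠ p) :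
    t = swap p (t p) := by
  obtain ⟨a, b, hab, rfl⟩ := ht
  by_cases h1 : p = a
  · subst h1; simp
  by_cases h2 : p = b
  · subst h2; simp [swap_comm]
  · exact absurd (swap_apply_of_ne_of_ne h1 h2) hp

/-- Induction on `A`. For `x ∈ A`, the face spanned by `x` and `z` over `A \ {x}` has top `ψ A * z`
or `ψ A * (t z t)`, where `t` is the label from `A \ {x}` to `A`. As `t` fixes `q`, `t z t = (t p,
q)`. If the second option holds for two elements of `A`, their labels agree at `p`: either they fix
`p` and `t z t = z`, or they coincide, against injectivity. -/
theorem Cube.insert_eq_mul {Y : Finset (Perm (Fin n))} {z : Perm (Fin n)}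
    {ψ : Finset (Perm (Fin n)) → Perm (Fin n)} (h : Cube v 1 (insert z Y) ψ) (hzY : z ∉ Y)
    {p q : Fin n} (hz : z = swap p q) (hq : ∀ u ∈ Y, u q = q)
    (hpair : ∀ u ∈ Y, ψ {u, z} = u * z) (A : Finset (Perm (Fin n))) (hA : A ⊆ Y) :
    ψ (insert z A) = ψ A * z := by
  have hYz : Y ⊆ insert z Y := Finset.subset_insert _ _
  have hzm : z ∈ insert z Y := Finset.mem_insert_self _ _
  rcases A.eq_empty_or_nonempty with rfl | ⟨a, ha⟩
  · rw [insert_empty_eq, h.atom z hzm, h.bot, one_mul]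
  rcases (A.erase a).eq_empty_or_nonempty with he | ⟨b, hb⟩
  · obtain rfl : A = {a} := by rw [← Finset.insert_erase ha, he, insert_empty_eq]
    rw [h.atom a (hYz (hA ha)), Finset.pair_comm, hpair a (hA ha)]
  have hbA := Finset.mem_of_mem_erase hb
  have hab : b ≠ a := Finset.ne_of_mem_erase hb
  have c1 : (A.erase a).card < A.card := Finset.card_erase_lt_of_mem ha
  have c2 : (A.erase b).card < A.card := Finset.card_erase_lt_of_mem hbA
  have key : ∀ x ∈ A, ψ (insert z (A.erase x)) = ψ (A.erase x) * z →
      ∃ t : Perm (Fin n), t.IsSwap ∧ t q = q ∧ ψ A = ψ (A.erase x) * t ∧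
        (ψ (insert z A) = ψ A * z ∨ ψ (insert z A) = ψ A * (t * z * t)) := by
    intro x hx ih
    have hxz : x ≠ z := by rintro rfl; exact hzY (hA hx)
    have hsub : A.erase x ⊆ insert z Y := (Finset.erase_subset _ _).trans (hA.trans hYz)
    have hins : insert x (A.erase x) = A := Finset.insert_erase hx
    have he := h.edge (A.erase x) hsub x (hYz (hA hx)) (Finset.notMem_erase _ _)
    rw [hins] at he
    obtain ⟨i, j, hij, -, e⟩ := he.exists_swap
    have hfq : ∀ B ⊆ A, ψ B q = q := fun B hB =>
      h.apply_eq (hB.trans (hA.trans hYz)) fun u hu => hq u (hA (hB hu))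
    have hf := h.face hsub (hYz (hA hx)) hzm (Finset.notMem_erase _ _)
      (fun hc => hzY (hA (Finset.mem_of_mem_erase hc))) hxz (t := swap i j) (s := z)
      (by rw [hins]; exact e) ih
    rw [Finset.insert_comm, hins] at hf
    refine ⟨swap i j, ⟨i, j, hij.ne, rfl⟩, ?_, e, ?_⟩
    · have h1 := hfq A subset_rfl
      rw [e, Perm.mul_apply] at h1
      exact (ψ (A.erase x)).injective (h1.trans (hfq _ (Finset.erase_subset _ _)).symm)
    · rcases hf with hf | hf
      · left; rw [hf, ← e]
      · right
        rw [hf, e]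
        simp only [mul_assoc, swap_mul_self_mul]
  obtain ⟨t, ht, htq, et, h1⟩ := key a ha
    (h.insert_eq_mul hzY hz hq hpair _ ((Finset.erase_subset _ _).trans hA))
  obtain ⟨r, hr, hrq, er, h2⟩ := key b hbA
    (h.insert_eq_mul hzY hz hq hpair _ ((Finset.erase_subset _ _).trans hA))
  rcases h1 with h1 | h1
  · exact h1
  rcases h2 with h2 | h2
  · exact h2
  have conj : ∀ {t : Perm (Fin n)}, t.IsSwap → t q = q → t * z * t = swap (t p) q := by
    intro t ht htq
    obtain ⟨i, j, hij, rfl⟩ := ht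
    rw [hz, mul_swap_eq_swap_mul (swap i j) p q, htq, mul_assoc, swap_mul_self, mul_one]
  have heq : t p = r p := by
    have := mul_left_cancel (h1.symm.trans h2)
    rw [conj ht htq, conj hr hrq] at this
    have h3 := congrArg (fun f => f q) this
    simpa using h3
  by_cases htp : t p = p
  · rw [h1, conj ht htq, htp, hz]
  · exfalso
    have hrp : r p ≠ p := by rw [← heq]; exact htp
    have htr : t = r := by
      rw [eq_swap_of_isSwap ht htp, eq_swap_of_isSwap hr hrp, heq]
    rw [← htr] at er
    have h3 := h.inj _ ((Finset.erase_subset _ _).trans (hA.trans hYz)) _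
      ((Finset.erase_subset _ _).trans (hA.trans hYz)) (mul_right_cancel (et.symm.trans er))
    have : b ∈ A.erase b := by rw [← h3]; exact hb
    exact Finset.notMem_erase _ _ this
termination_by A.card

/-! ### Orientation of the hypercube map at an end -/

theorem IsEnd.of_fix {p q : Fin n} {T S : Set (Perm (Fin n))} (h : IsEnd p q T)
    (hS : ∀ g ∈ S, ∀ m, (∀ u ∈ T, u m = m) → g m = m) : IsEnd p q S := by
  refine ⟨fun g hg => hS g hg q h.1, ?_⟩
  rcases h.2 with h | h | h
  · exact .inl fun g hg => hS g hg p h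
  · exact .inr (.inl ⟨h.1, fun g hg m hm => hS g hg m fun u hu => h.2 u hu m hm⟩)
  · exact .inr (.inr ⟨h.1, fun g hg m hm => hS g hg m fun u hu => h.2 u hu m hm⟩)

theorem IsEnd.edge_mul_swap {p q : Fin n} {b : Perm (Fin n)} (hpq : p ≠ q) (h : IsEnd p q {b}) :
    Edge b (b * swap p q) := by
  rw [BruhatCube.edge_mul_swap hpq, h.1 b rfl]
  have hne : b p ≠ q := by
    intro e; exact hpq (b.injective (e.trans (h.1 b rfl).symm))
  rcases h.2 with h2 | h2 | h2
  · rw [h2 b rfl]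
  · have : b p ≤ p := by
      by_contra hc
      have h3 := h2.2 b rfl _ (not_le.1 hc)
      exact hc (b.injective h3).le
    simp [h2.1, this.trans_lt h2.1]
  · have : p ≤ b p := by
      by_contra hc
      have h3 := h2.2 b rfl _ (not_le.1 hc)
      exact hc (b.injective h3).ge
    simp [not_lt_of_gt h2.1, not_lt_of_gt (h2.1.trans_le this)]

/-- Removing `(p q)` conjugates the positions exchanged by the edge. As `q` is fixed by `a` and `b`,
only a position `p` can arise from `q`. Then `p` is the moved point nearest to `q`, so the order of
the two positions survives. -/
theorem IsEnd.edge_of_edge_mul {p q : Fin n} {a b : Perm (Fin n)}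
    (h : IsEnd p q {a, b}) (he : Edge (a * swap p q) (b * swap p q)) : Edge a b := by
  obtain ⟨i, j, hij, hlt, e⟩ := he.exists_swap
  have hb : b = a * swap (swap p q i) (swap p q j) := by
    rw [swap_apply_apply, swap_inv, ← mul_assoc, ← mul_assoc, ← e, mul_assoc, swap_mul_self,
      mul_one]
  rw [Perm.mul_apply, Perm.mul_apply] at hlt
  obtain ⟨m, hm⟩ : ∃ m, m = swap p q i := ⟨_, rfl⟩
  obtain ⟨k, hk⟩ : ∃ k, k = swap p q j := ⟨_, rfl⟩
  rw [← hm, ← hk] at hb hlt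
  have hmk : m ≠ k := by rintro rfl; exact lt_irrefl _ hlt
  have nm : ¬ (a m = m ∧ b m = m) := by
    rintro ⟨h1, h2⟩
    rw [hb, Perm.mul_apply, swap_apply_left, ← h1] at h2
    exact hmk (a.injective (by rw [h1, h2, h1]))
  have nk : ¬ (a k = k ∧ b k = k) := by
    rintro ⟨h1, h2⟩
    rw [hb, Perm.mul_apply, swap_apply_right, ← h1] at h2
    exact hmk (a.injective (by rw [h2, h1]))
  suffices hs : m < k by rw [hb]; exact edge_of_swap hs hlt
  have hfix : ∀ x, (∀ u ∈ ({a, b} : Set (Perm (Fin n))), u x = x) → x ≠ m ∧ x ≠ k := by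
    intro x hx
    refine ⟨?_, ?_⟩
    · rintro rfl; exact nm ⟨hx a (by simp), hx b (by simp)⟩
    · rintro rfl; exact nk ⟨hx a (by simp), hx b (by simp)⟩
  have hq := hfix q h.1
  have hi : i ≠ p := by rintro rfl; rw [swap_apply_left] at hm; exact hq.1 hm.symm
  have hj : j ≠ p := by rintro rfl; rw [swap_apply_left] at hk; exact hq.2 hk.symm
  have h2 : (p ≠ m ∧ p ≠ k) ∨ (p < q ∧ ∀ x, p < x → x ≠ m ∧ x ≠ k) ∨
      (q < p ∧ ∀ x, x < p → x ≠ m ∧ x ≠ k) := by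
    rcases h.2 with h2 | h2 | h2
    · exact .inl (hfix p h2)
    · exact .inr (.inl ⟨h2.1, fun x hx => hfix x fun u hu => h2.2 u hu x hx⟩)
    · exact .inr (.inr ⟨h2.1, fun x hx => hfix x fun u hu => h2.2 u hu x hx⟩)
  by_cases hiq : i = q
  · subst hiq
    rw [swap_apply_right] at hm
    subst hm
    rw [swap_apply_of_ne_of_ne hj hij.ne'] at hk
    subst hk
    rcases h2 with h2 | h2 | h2
    · exact absurd rfl h2.1
    · exact absurd rfl (h2.2 k (h2.1.trans hij)).2
    · by_contra hc
      exact (h2.2 k (lt_of_le_of_ne (not_lt.1 hc) hmk.symm)).2 rfl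
  by_cases hjq : j = q
  · subst hjq
    rw [swap_apply_right] at hk
    subst hk
    rw [swap_apply_of_ne_of_ne hi hiq] at hm
    subst hm
    rcases h2 with h2 | h2 | h2
    · exact absurd rfl h2.2
    · by_contra hc
      exact (h2.2 m (lt_of_le_of_ne (not_lt.1 hc) hmk.symm)).1 rfl
    · exact hij.trans h2.1
  rw [swap_apply_of_ne_of_ne hi hiq] at hm
  rw [swap_apply_of_ne_of_ne hj hjq] at hk
  rw [hm, hk]; exact hij

theorem inv_apply_eq_of {g : Perm (Fin n)} {m : Fin n} (h : g m = m) : g⁻¹ m = m := by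
  rw [Perm.inv_eq_iff_eq, h]

theorem IsEnd.inv {p q : Fin n} {T : Set (Perm (Fin n))} (h : IsEnd p q T) :
    IsEnd p q ((·⁻¹) '' T) := by
  refine h.of_fix ?_
  rintro _ ⟨g, hg, rfl⟩ m hm
  exact inv_apply_eq_of (hm g hg)

theorem IsEnd.edge_swap_mul {p q : Fin n} {b : Perm (Fin n)} (hpq : p ≠ q) (h : IsEnd p q {b}) :
    Edge b (swap p q * b) := by
  have h1 := h.inv
  rw [Set.image_singleton] at h1
  simpa using edge_inv (h1.edge_mul_swap hpq)

theorem IsEnd.edge_of_mul_edge {p q : Fin n} {a b : Perm (Fin n)}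
    (h : IsEnd p q {a, b}) (he : Edge (swap p q * a) (swap p q * b)) : Edge a b := by
  have h1 := h.inv
  rw [Set.image_pair] at h1
  have h2 := edge_inv he
  rw [mul_inv_rev, mul_inv_rev, swap_inv] at h2
  simpa using edge_inv (h1.edge_of_edge_mul h2)

/-! ### Hypercubes at the identity spanned by two transpositions. -/

theorem theta_pair_eq (hI : IsHypercubeDecomposition 1 v I) {y z w : Perm (Fin n)}
    (hy : y ∈ Out 1 v I 1) (hz : z ∈ Out 1 v I 1) (h1 : ¬ BruhatLE y z) (h2 : ¬ BruhatLE z y)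
    (hw : BruhatLE w v) (e1 : Edge y w) (e2 : Edge z w) : theta 1 v 1 {y, z} = w := by
  have hne : y ≠ z := by rintro rfl; exact h1 .refl
  rw [(hI.cluster 1 hI.one_mem).theta_eq (pair_mem_antichains hy hz h1 h2)
    (Cube.pair_of_diamond hne hw hy.2.2 hz.2.2 e1 e2)]
  simp

theorem theta_pair_cases (hI : IsHypercubeDecomposition 1 v I) {y z : Perm (Fin n)}
    (hy : y ∈ Out 1 v I 1) (hz : z ∈ Out 1 v I 1) (h1 : ¬ BruhatLE y z) (h2 : ¬ BruhatLE z y) :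
    BruhatLE (theta 1 v 1 {y, z}) v ∧
      (theta 1 v 1 {y, z} = y * z ∨ theta 1 v 1 {y, z} = z * y) := by
  have hne : y ≠ z := by rintro rfl; exact h1 .refl
  have hc := (hI.cluster 1 hI.one_mem).cube_theta (pair_mem_antichains hy hz h1 h2)
  have := hc.face_pair (y := y) (z := z) (t := y) (s := z) (by simp) (by simp) hne (by simp)
    (by simp)
  rw [one_mul, one_mul] at this
  exact ⟨hc.le _ subset_rfl, this⟩

theorem OutAt.exists_swap_of_isEnd {i : ℕ} {a b p q : Fin n} {u : Perm (Fin n)}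
    {T : Set (Perm (Fin n))} (hu : OutAt v I i a b u) (hT : IsEnd p q T) (huT : u ∈ T)
    (hp : u p ≠ p) : ∃ c, u = swap c p ∧ (c < p ∧ p < q ∨ q < p ∧ p < c) := by
  have hpab : p = a ∨ p = b := by
    by_contra hc
    rw [not_or] at hc
    exact hp (hu.apply_of_ne hc.1 hc.2)
  have ha : u a ≠ a := by rw [hu.eq, swap_apply_left]; exact hu.lt.ne'
  have hb : u b ≠ b := by rw [hu.eq, swap_apply_right]; exact hu.lt.ne
  rcases hT.2 with h2 | h2 | h2
  · exact absurd (h2 u huT) hp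
  · rcases hpab with rfl | rfl
    · exact absurd (h2.2 u huT b hu.lt) hb
    · exact ⟨a, hu.eq, .inl ⟨hu.lt, h2.1⟩⟩
  · rcases hpab with rfl | rfl
    · exact ⟨b, by rw [swap_comm]; exact hu.eq, .inr ⟨h2.1, hu.lt⟩⟩
    · exact absurd (h2.2 u huT a hu.lt) ha

theorem commute_swap_of_fix {g : Perm (Fin n)} {p q : Fin n} (hp : g p = p) (hq : g q = q) :
    g * swap p q = swap p q * g := by
  rw [mul_swap_eq_swap_mul, hp, hq]

/-- At an end, the orientation of the pair products is uniform. -/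
theorem orientation (hI : IsHypercubeDecomposition 1 v I) {p q : Fin n} {z : Perm (Fin n)}
    (hz : z = swap p q) (hzo : z ∈ Out 1 v I 1) {T : Set (Perm (Fin n))} (hT : IsEnd p q T)
    (hTo : ∀ u ∈ T, u ∈ Out 1 v I 1 ∧ ¬ BruhatLE u z ∧ ¬ BruhatLE z u) :
    (∀ u ∈ T, theta 1 v 1 {u, z} = u * z) ∨ (∀ u ∈ T, theta 1 v 1 {u, z} = z * u) := by
  by_contra hcon
  rw [not_or] at hcon
  push Not at hcon
  obtain ⟨⟨u, huT, hu⟩, ⟨t, htT, ht⟩⟩ := hcon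
  obtain ⟨hu1, hu2, hu3⟩ := hTo u huT
  obtain ⟨ht1, ht2, ht3⟩ := hTo t htT
  have cu := theta_pair_cases hI hu1 hzo hu2 hu3
  have ct := theta_pair_cases hI ht1 hzo ht2 ht3
  have eu : theta 1 v 1 {u, z} = z * u := cu.2.resolve_left hu
  have et : theta 1 v 1 {t, z} = t * z := ct.2.resolve_right ht
  -- If `p` is fixed, the two products coincide. So `u` and `t` both move `p`, and they extend from
  -- it on the side away from `q`.
  have pu : u p ≠ p := by
    intro hp
    apply hu
    rw [eu, hz, commute_swap_of_fix hp (hT.1 u huT)]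
  have pt : t p ≠ p := by
    intro hp
    apply ht
    rw [et, hz, commute_swap_of_fix hp (hT.1 t htT)]
  obtain ⟨_, _, _, ou⟩ := exists_outAt hI hu1
  obtain ⟨_, _, _, ot⟩ := exists_outAt hI ht1
  obtain ⟨c, hc, hc'⟩ := ou.exists_swap_of_isEnd hT huT pu
  obtain ⟨d, hd, hd'⟩ := ot.exists_swap_of_isEnd hT htT pt
  have edge_c := edge_threeCycle hc'
  have edge_d := edge_threeCycle hd'
  rw [← hc, ← hz] at edge_c
  rw [← hd, ← hz] at edge_d
  have invu : u⁻¹ = u := by rw [hc, swap_inv]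
  have invt : t⁻¹ = t := by rw [hd, swap_inv]
  have invz : z⁻¹ = z := by rw [hz, swap_inv]
  -- The three-cycles are comparable by `threeCycle_mono`. The smaller one then lies below `v` and
  -- is a second top for its pair, against uniqueness.
  have caseA : BruhatLE (u * z) (t * z) → False := fun h =>
    hu (theta_pair_eq hI hu1 hzo hu2 hu3 (h.trans (et ▸ ct.1)) edge_c.1 edge_c.2)
  have caseB : BruhatLE (z * t) (z * u) → False := fun h => by
    refine ht (theta_pair_eq hI ht1 hzo ht2 ht3 (h.trans (eu ▸ cu.1)) ?_ ?_)
    · have := edge_inv edge_d.1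
      rwa [mul_inv_rev, invt, invz] at this
    · have := edge_inv edge_d.2
      rwa [mul_inv_rev, invt, invz] at this
  have caseB' : BruhatLE (t * z) (u * z) → False := fun h => caseB (by
    have := h.inv
    rwa [mul_inv_rev, mul_inv_rev, invt, invz, invu] at this)
  rcases lt_trichotomy c d with hcd | hcd | hcd
  · rcases hc' with h1 | h1
    · rcases hd' with h2 | h2
      · apply caseB'
        rw [hc, hd, hz]
        exact threeCycle_mono (.inl ⟨hcd, h2.1, h2.2⟩)
      · exact absurd h2.1 (not_lt_of_gt h1.2)
    · apply caseA
      rw [hc, hd, hz]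
      exact threeCycle_mono (.inr ⟨h1.1, h1.2, hcd⟩)
  · apply caseA; rw [hc, hd, hcd]; exact .refl
  · rcases hd' with h1 | h1
    · rcases hc' with h2 | h2
      · apply caseA
        rw [hc, hd, hz]
        exact threeCycle_mono (.inl ⟨hcd, h2.1, h2.2⟩)
      · exact absurd h2.1 (not_lt_of_gt h1.2)
    · apply caseB'
      rw [hc, hd, hz]
      exact threeCycle_mono (.inr ⟨h1.1, h1.2, hcd⟩)

theorem out_inv (hI : IsHypercubeDecomposition 1 v I) {y : Perm (Fin n)} (h : y ∈ Out 1 v I 1) :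
    y⁻¹ = y := by
  obtain ⟨_, _, _, ho⟩ := exists_outAt hI h
  rw [ho.eq, swap_inv]

theorem theta_insert_right (hI : IsHypercubeDecomposition 1 v I) {Y : Finset (Perm (Fin n))}
    {z : Perm (Fin n)} {p q : Fin n} (hY : insert z Y ∈ Antichains 1 v I 1) (hzY : z ∉ Y)
    (hz : z = swap p q) (hq : ∀ u ∈ Y, u q = q) (h : ∀ u ∈ Y, theta 1 v 1 {u, z} = u * z) :
    theta 1 v 1 (insert z Y) = theta 1 v 1 Y * z :=
  ((hI.cluster 1 hI.one_mem).cube_theta hY).insert_eq_mul hzY hz hq h Y subset_rfl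

theorem theta_insert_left (hI : IsHypercubeDecomposition 1 v I) {Y : Finset (Perm (Fin n))}
    {z : Perm (Fin n)} {p q : Fin n} (hY : insert z Y ∈ Antichains 1 v I 1) (hzY : z ∉ Y)
    (hz : z = swap p q) (hq : ∀ u ∈ Y, u q = q) (h : ∀ u ∈ Y, theta 1 v 1 {u, z} = z * u) :
    theta 1 v 1 (insert z Y) = z * theta 1 v 1 Y := by
  have hc := ((hI.cluster 1 hI.one_mem).cube_theta hY).inv fun y hy => out_inv hI (hY.1 hy)
  have hzi : z⁻¹ = z := by rw [hz, swap_inv]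
  have := hc.insert_eq_mul hzY hz hq (fun u hu => by
    rw [h u hu, mul_inv_rev, hzi, out_inv hI (hY.1 (by simp [hu]))]) Y subset_rfl
  have h2 := congrArg (·⁻¹) this
  simp only [inv_inv, mul_inv_rev] at h2
  rw [h2, hzi]

/-! ### The strong cluster at the identity -/

theorem insert_insert_mem_antichains {Y : Finset (Perm (Fin n))} {y₁ y₂ : Perm (Fin n)}
    (h1 : insert y₁ Y ∈ Antichains 1 v I 1) (h2 : insert y₂ Y ∈ Antichains 1 v I 1)
    (h3 : ¬ BruhatLE y₁ y₂) (h4 : ¬ BruhatLE y₂ y₁) :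
    insert y₁ (insert y₂ Y) ∈ Antichains 1 v I 1 := by
  refine ⟨?_, ?_⟩
  · intro u hu
    simp only [Finset.coe_insert, Set.mem_insert_iff, Finset.mem_coe] at hu
    rcases hu with rfl | rfl | hu
    · exact h1.1 (by simp)
    · exact h2.1 (by simp)
    · exact h1.1 (by simp [hu])
  · intro a ha b hb hab
    simp only [Finset.coe_insert, Set.mem_insert_iff, Finset.mem_coe] at ha hb
    rcases ha with rfl | rfl | ha <;> rcases hb with rfl | rfl | hb
    · exact absurd rfl hab
    · exact h3
    · exact h1.2 (by simp) (by simp [hb]) hab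
    · exact h4
    · exact absurd rfl hab
    · exact h2.2 (by simp) (by simp [hb]) hab
    · exact h1.2 (by simp [ha]) (by simp) hab
    · exact h2.2 (by simp [ha]) (by simp) hab
    · exact h1.2 (by simp [ha]) (by simp [hb]) hab

theorem not_le_of_insert {Y : Finset (Perm (Fin n))} {y u : Perm (Fin n)}
    (h : insert y Y ∈ Antichains 1 v I 1) (hu : u ∈ Y) (hy : y ∉ Y) :
    ¬ BruhatLE u y ∧ ¬ BruhatLE y u := by
  have hne : u ≠ y := by rintro rfl; exact hy hu
  exact ⟨h.2 (by simp [hu]) (by simp) hne, h.2 (by simp) (by simp [hu]) hne.symm⟩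

/-- Every diamond over `θ(Y)` with middle vertices `θ(Y ∪ {y₁})`, `θ(Y ∪ {y₂})` comes from the
cluster. -/
def DiamondsFill (v : Perm (Fin n)) (Y : Finset (Perm (Fin n))) (y₁ y₂ : Perm (Fin n)) : Prop :=
  ∀ w, BruhatLE w v → theta 1 v 1 (insert y₁ Y) ≠ theta 1 v 1 (insert y₂ Y) →
    Edge (theta 1 v 1 (insert y₁ Y)) w → Edge (theta 1 v 1 (insert y₂ Y)) w →
    ¬ BruhatLE y₁ y₂ ∧ ¬ BruhatLE y₂ y₁ ∧ theta 1 v 1 (insert y₁ (insert y₂ Y)) = w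

theorem DiamondsFill.symm {Y : Finset (Perm (Fin n))} {y₁ y₂ : Perm (Fin n)}
    (h : DiamondsFill v Y y₁ y₂) : DiamondsFill v Y y₂ y₁ := by
  intro w hw hne e1 e2
  obtain ⟨h1, h2, h3⟩ := h w hw hne.symm e2 e1
  exact ⟨h2, h1, by rw [Finset.insert_comm]; exact h3⟩

theorem theta_diamond_top (hI : IsHypercubeDecomposition 1 v I) {Y : Finset (Perm (Fin n))}
    {y₁ y₂ w : Perm (Fin n)} (hn1 : y₁ ∉ Y) (hn2 : y₂ ∉ Y)
    (h1 : insert y₁ Y ∈ Antichains 1 v I 1) (h2 : insert y₂ Y ∈ Antichains 1 v I 1)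
    (hne : theta 1 v 1 (insert y₁ Y) ≠ theta 1 v 1 (insert y₂ Y))
    (e1 : Edge (theta 1 v 1 (insert y₁ Y)) w) (e2 : Edge (theta 1 v 1 (insert y₂ Y)) w) :
    w = theta 1 v 1 (insert y₁ Y) * (theta 1 v 1 Y)⁻¹ * theta 1 v 1 (insert y₂ Y) ∨
    w = theta 1 v 1 (insert y₂ Y) * (theta 1 v 1 Y)⁻¹ * theta 1 v 1 (insert y₁ Y) := by
  have c1 := (hI.cluster 1 hI.one_mem).cube_theta h1
  have c2 := (hI.cluster 1 hI.one_mem).cube_theta h2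
  have f1 := c1.edge Y (Finset.subset_insert _ _) y₁ (Finset.mem_insert_self _ _) hn1
  have f2 := c2.edge Y (Finset.subset_insert _ _) y₂ (Finset.mem_insert_self _ _) hn2
  generalize theta 1 v 1 (insert y₁ Y) = a₁ at *
  generalize theta 1 v 1 (insert y₂ Y) = a₂ at *
  generalize theta 1 v 1 Y = a₀ at *
  obtain ⟨i, j, hij, -, rfl⟩ := f1.exists_swap
  obtain ⟨k, l, hkl, -, rfl⟩ := f2.exists_swap
  have := diamond_top ⟨i, j, hij.ne, rfl⟩ ⟨k, l, hkl.ne, rfl⟩ (fun e => hne (by rw [e])) f1 e1 e2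
  simpa [mul_assoc] using this

/-- At an end, `z` can be cancelled on one and the same side from all four vertices of the diamond.
Edges survive by `IsEnd`, and the smaller top stays below `v` because multiplying it by `z` goes up.
-/
theorem DiamondsFill.of_erase (hI : IsHypercubeDecomposition 1 v I) {Y : Finset (Perm (Fin n))}
    {y₁ y₂ z : Perm (Fin n)} {p q : Fin n} (hn1 : y₁ ∉ insert z Y) (hn2 : y₂ ∉ insert z Y)
    (h1 : insert y₁ (insert z Y) ∈ Antichains 1 v I 1)
    (h2 : insert y₂ (insert z Y) ∈ Antichains 1 v I 1)
    (hzY : z ∉ Y) (hz : z = swap p q) (hpq : p ≠ q)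
    (hend : IsEnd p q ((insert y₁ (insert y₂ Y) : Finset (Perm (Fin n))) : Set (Perm (Fin n))))
    (ih : DiamondsFill v Y y₁ y₂) : DiamondsFill v (insert z Y) y₁ y₂ := by
  intro w hw hneq e1 e2
  have hcl := hI.cluster 1 hI.one_mem
  have hzo : z ∈ Out 1 v I 1 := h1.1 (by simp)
  have hn1' : y₁ ∉ Y := fun h => hn1 (Finset.mem_insert_of_mem h)
  have hn2' : y₂ ∉ Y := fun h => hn2 (Finset.mem_insert_of_mem h)
  have hz1 : z ≠ y₁ := by rintro rfl; exact hn1 (Finset.mem_insert_self _ _)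
  have hz2 : z ≠ y₂ := by rintro rfl; exact hn2 (Finset.mem_insert_self _ _)
  have hzz : z * z = 1 := by rw [hz, swap_mul_self]
  have i1 : insert y₁ (insert z Y) = insert z (insert y₁ Y) := Finset.insert_comm _ _ _
  have i2 : insert y₂ (insert z Y) = insert z (insert y₂ Y) := Finset.insert_comm _ _ _
  have h1' : insert y₁ Y ∈ Antichains 1 v I 1 :=
    Antichains.mono h1 (by rw [i1]; exact Finset.subset_insert _ _)
  have h2' : insert y₂ Y ∈ Antichains 1 v I 1 :=
    Antichains.mono h2 (by rw [i2]; exact Finset.subset_insert _ _)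
  have hTo : ∀ u ∈ ((insert y₁ (insert y₂ Y) : Finset (Perm (Fin n))) : Set (Perm (Fin n))),
      u ∈ Out 1 v I 1 ∧ ¬ BruhatLE u z ∧ ¬ BruhatLE z u := by
    intro u hu
    simp only [Finset.coe_insert, Set.mem_insert_iff, Finset.mem_coe] at hu
    rcases hu with rfl | rfl | hu
    · exact ⟨h1.1 (by simp), h1.2 (by simp) (by simp) hz1.symm, h1.2 (by simp) (by simp) hz1⟩
    · exact ⟨h2.1 (by simp), h2.2 (by simp) (by simp) hz2.symm, h2.2 (by simp) (by simp) hz2⟩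
    · have hzu : z ≠ u := by rintro rfl; exact hzY hu
      exact ⟨h1.1 (by simp [hu]), h1.2 (by simp [hu]) (by simp) hzu.symm,
        h1.2 (by simp) (by simp [hu]) hzu⟩
  have hq : ∀ u ∈ insert y₁ (insert y₂ Y), u q = q := fun u hu => hend.1 u (by exact_mod_cast hu)
  have hsub1 : insert y₁ Y ⊆ insert y₁ (insert y₂ Y) :=
    Finset.insert_subset_insert _ (Finset.subset_insert _ _)
  have hsub2 : insert y₂ Y ⊆ insert y₁ (insert y₂ Y) := Finset.subset_insert _ _
  have hsub0 : Y ⊆ insert y₁ (insert y₂ Y) := (Finset.subset_insert _ _).trans hsub2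
  have fix0 : ∀ m, (∀ u ∈ insert y₁ (insert y₂ Y), u m = m) → theta 1 v 1 Y m = m := fun m hm =>
    (hcl.cube_theta h1').apply_eq (Finset.subset_insert _ _) fun u hu => hm u (hsub0 hu)
  have fix1 : ∀ m, (∀ u ∈ insert y₁ (insert y₂ Y), u m = m) → theta 1 v 1 (insert y₁ Y) m = m :=
    fun m hm => (hcl.cube_theta h1').apply_eq subset_rfl fun u hu => hm u (hsub1 hu)
  have fix2 : ∀ m, (∀ u ∈ insert y₁ (insert y₂ Y), u m = m) → theta 1 v 1 (insert y₂ Y) m = m :=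
    fun m hm => (hcl.cube_theta h2').apply_eq subset_rfl fun u hu => hm u (hsub2 hu)
  have htop := theta_diamond_top hI hn1 hn2 h1 h2 hneq e1 e2
  have h0 : insert z Y ∈ Antichains 1 v I 1 := Antichains.mono h1 (Finset.subset_insert _ _)
  have hz1' : z ∉ insert y₁ Y := by simp [hz1, hzY]
  have hz2' : z ∉ insert y₂ Y := by simp [hz2, hzY]
  have fixw : ∀ w', (w' = theta 1 v 1 (insert y₁ Y) * (theta 1 v 1 Y)⁻¹ *
      theta 1 v 1 (insert y₂ Y) ∨ w' = theta 1 v 1 (insert y₂ Y) * (theta 1 v 1 Y)⁻¹ *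
      theta 1 v 1 (insert y₁ Y)) →
      ∀ m, (∀ u ∈ insert y₁ (insert y₂ Y), u m = m) → w' m = m := by
    rintro w' (rfl | rfl) m hm <;>
      simp only [Perm.mul_apply, fix1 m hm, fix2 m hm, inv_apply_eq_of (fix0 m hm)]
  have hends : ∀ w', (∀ m, (∀ u ∈ insert y₁ (insert y₂ Y), u m = m) → w' m = m) →
      IsEnd p q {w'} ∧ IsEnd p q {theta 1 v 1 (insert y₁ Y), w'} ∧
      IsEnd p q {theta 1 v 1 (insert y₂ Y), w'} := by
    intro w' hw'
    refine ⟨hend.of_fix ?_, hend.of_fix ?_, hend.of_fix ?_⟩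
    · rintro g rfl m hm
      exact hw' m fun u hu => hm u (by exact_mod_cast hu)
    · rintro g (rfl | rfl) m hm
      · exact fix1 m fun u hu => hm u (by exact_mod_cast hu)
      · exact hw' m fun u hu => hm u (by exact_mod_cast hu)
    · rintro g (rfl | rfl) m hm
      · exact fix2 m fun u hu => hm u (by exact_mod_cast hu)
      · exact hw' m fun u hu => hm u (by exact_mod_cast hu)
  have hzT : z ∉ insert y₁ (insert y₂ Y) := by simp [hz1, hz2, hzY]
  have iT : insert y₁ (insert y₂ (insert z Y)) = insert z (insert y₁ (insert y₂ Y)) := by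
    rw [i2, Finset.insert_comm]
  rcases orientation hI hz hzo hend hTo with ho | ho
  · have t0 := theta_insert_right hI h0 hzY hz (fun u hu => hq u (hsub0 hu))
      fun u hu => ho u (by exact_mod_cast hsub0 hu)
    have t1 := theta_insert_right hI (i1 ▸ h1) hz1' hz (fun u hu => hq u (hsub1 hu))
      fun u hu => ho u (by exact_mod_cast hsub1 hu)
    have t2 := theta_insert_right hI (i2 ▸ h2) hz2' hz (fun u hu => hq u (hsub2 hu))
      fun u hu => ho u (by exact_mod_cast hsub2 hu)
    rw [i1, i2, t1, t2] at hneq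
    rw [i1, i2, t0, t1, t2] at htop
    rw [i1, t1] at e1
    rw [i2, t2] at e2
    obtain ⟨w', rfl⟩ : ∃ w', w = w' * z := ⟨w * z, by rw [mul_assoc, hzz, mul_one]⟩
    have hw' := hends w' (fixw w' (by
      rcases htop with h | h
      · left; apply mul_right_cancel (b := z); rw [h]; simp [mul_assoc]
      · right; apply mul_right_cancel (b := z); rw [h]; simp [mul_assoc]))
    have hww : Edge w' (w' * z) := by rw [hz]; exact hw'.1.edge_mul_swap hpq
    obtain ⟨r1, r2, r3⟩ := ih w' (hww.le.trans hw) (fun e => hneq (by rw [e]))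
      (hw'.2.1.edge_of_edge_mul (by rw [← hz]; exact e1))
      (hw'.2.2.edge_of_edge_mul (by rw [← hz]; exact e2))
    refine ⟨r1, r2, ?_⟩
    have h3 := insert_insert_mem_antichains h1 h2 r1 r2
    rw [iT] at h3 ⊢
    rw [theta_insert_right hI h3 hzT hz hq fun u hu => ho u (by exact_mod_cast hu), r3]
  · have t0 := theta_insert_left hI h0 hzY hz (fun u hu => hq u (hsub0 hu))
      fun u hu => ho u (by exact_mod_cast hsub0 hu)
    have t1 := theta_insert_left hI (i1 ▸ h1) hz1' hz (fun u hu => hq u (hsub1 hu))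
      fun u hu => ho u (by exact_mod_cast hsub1 hu)
    have t2 := theta_insert_left hI (i2 ▸ h2) hz2' hz (fun u hu => hq u (hsub2 hu))
      fun u hu => ho u (by exact_mod_cast hsub2 hu)
    rw [i1, i2, t1, t2] at hneq
    rw [i1, i2, t0, t1, t2] at htop
    rw [i1, t1] at e1
    rw [i2, t2] at e2
    obtain ⟨w', rfl⟩ : ∃ w', w = z * w' := ⟨z * w, by rw [← mul_assoc, hzz, one_mul]⟩
    have hw' := hends w' (fixw w' (by
      rcases htop with h | h
      · left; apply mul_left_cancel (a := z); rw [h]; simp [mul_assoc]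
      · right; apply mul_left_cancel (a := z); rw [h]; simp [mul_assoc]))
    have hww : Edge w' (z * w') := by rw [hz]; exact hw'.1.edge_swap_mul hpq
    obtain ⟨r1, r2, r3⟩ := ih w' (hww.le.trans hw) (fun e => hneq (by rw [e]))
      (hw'.2.1.edge_of_mul_edge (by rw [← hz]; exact e1))
      (hw'.2.2.edge_of_mul_edge (by rw [← hz]; exact e2))
    refine ⟨r1, r2, ?_⟩
    have h3 := insert_insert_mem_antichains h1 h2 r1 r2
    rw [iT] at h3 ⊢
    rw [theta_insert_left hI h3 hzT hz hq fun u hu => ho u (by exact_mod_cast hu), r3]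

/-! ### Diamonds whose two new transpositions are the extremes. -/

theorem OutAt.lt_or_lt {i j : ℕ} {a b c d : Fin n} {y z : Perm (Fin n)} (h : OutAt v I i a b y)
    (h' : OutAt v I j c d z) (h1 : ¬ BruhatLE y z) (h2 : ¬ BruhatLE z y) :
    (a < c ∧ b < d) ∨ (c < a ∧ d < b) := by
  rw [h.le_iff h'] at h1
  rw [h'.le_iff h] at h2
  omega

theorem OutAt.cut_eq (hI : IsHypercubeDecomposition 1 v I) {i j : ℕ} {a b : Fin n}
    {y : Perm (Fin n)} (h : OutAt v I i a b y) (hj : IsCut v I j) (h1 : a.val ≤ j)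
    (h2 : j < b.val) : j = i := by
  have hle := h.le
  rw [h.eq] at hle
  rcases lt_trichotomy i j with hij | hij | hij
  · exact absurd hle (hI.not_swap_le_of_cuts h.cut hj hij h.left_le h2)
  · exact hij.symm
  · exact absurd hle (hI.not_swap_le_of_cuts hj h.cut hij h1 h.lt_right)

/-- Comparable elements cross the same cut and, by their shape, share an endpoint. Neither product
of the two is then above the longer transposition. -/
theorem OutAt.no_diamond_of_le (hI : IsHypercubeDecomposition 1 v I) {i j : ℕ} {a b c d : Fin n}
    {y z w : Perm (Fin n)} (h : OutAt v I i a b y) (h' : OutAt v I j c d z) (hle : BruhatLE y z)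
    (hne : y ≠ z) (e1 : Edge y w) (e2 : Edge z w) : False := by
  rw [h.le_iff h'] at hle
  have hij : i = j := h'.cut_eq hI h.cut (le_trans (Fin.le_def.1 hle.1) h.left_le)
    (lt_of_lt_of_le h.lt_right (Fin.le_def.1 hle.2))
  subst hij
  have s1 := h.shape hI
  have s2 := h'.shape hI
  have l1 := h.left_le
  have l2 := h.lt_right
  have hac : a = c ∨ b = d := by
    rw [Fin.le_def, Fin.le_def] at hle
    rcases s2 with s2 | s2
    · left; apply Fin.ext; omega
    · right; apply Fin.ext; omega
  have hab := h.lt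
  have hcd := h'.lt
  have sy : y.IsSwap := by rw [h.eq]; exact ⟨a, b, hab.ne, rfl⟩
  have sz : z.IsSwap := by rw [h'.eq]; exact ⟨c, d, hcd.ne, rfl⟩
  have htop := diamond_top (a := 1) (d := w) sy sz hne
    (by rw [one_mul, h.eq]; exact edge_one_swap hab) (by rw [one_mul]; exact e1)
    (by rw [one_mul]; exact e2)
  rw [one_mul, one_mul] at htop
  rw [h.eq, h'.eq] at htop hne
  rw [h'.eq] at e2
  rcases hac with hac | hac
  · subst hac
    have hbd : b ≠ d := by rintro rfl; exact hne rfl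
    have hbd' : b < d := lt_of_le_of_ne hle.2 hbd
    rcases htop with ht | ht
    · have := mul_swap_conj (1 : Perm (Fin n)) hab.ne hbd
      rw [one_mul, one_mul] at this
      rw [ht, this, edge_mul_swap hbd, swap_apply_right, swap_apply_of_ne_of_ne hab.ne' hbd] at e2
      exact absurd (e2.1 hbd') (not_lt_of_gt hab)
    · rw [ht, edge_mul_swap hab.ne, swap_apply_left, swap_apply_of_ne_of_ne hab.ne' hbd] at e2
      exact absurd (e2.1 hab) (not_lt_of_gt hbd')
  · subst hac
    have hca : c ≠ a := by rintro rfl; exact hne rfl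
    have hca' : c < a := lt_of_le_of_ne hle.1 hca
    rcases htop with ht | ht
    · have := mul_swap_conj (1 : Perm (Fin n)) hab.ne' hca.symm
      rw [one_mul, one_mul, swap_comm b a, swap_comm b c] at this
      rw [ht, this, edge_mul_swap hca.symm, swap_apply_left, swap_apply_of_ne_of_ne hca.symm hab.ne]
        at e2
      exact absurd (e2.2 hab) (not_lt_of_gt hca')
    · rw [ht, edge_mul_swap hab.ne, swap_apply_right, swap_apply_of_ne_of_ne hca.symm hab.ne] at e2
      exact absurd (e2.1 hab) (not_lt_of_gt hca')

/-- Conjugation by `b` turns `y₂` into `(b p, q)`, which commutes with `y₁ = (p' q')` unless `b p =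
q'`. In that case the product is above `(p' p)`, while some element of `Y` ends at `p` and another
starts at `q'`; so `(p' p)` crosses two cuts, which is impossible below `v`. -/
theorem conj_mul_eq_of_le (hI : IsHypercubeDecomposition 1 v I) {Y : Finset (Perm (Fin n))}
    {y₁ y₂ : Perm (Fin n)} {i j : ℕ} {p' q' p q : Fin n} (o1 : OutAt v I i p' q' y₁)
    (o2 : OutAt v I j p q y₂) (hp : p' < p) (hq : q' < q)
    (hY : ∀ u ∈ Y, ∃ k c d, OutAt v I k c d u ∧ p' < c ∧ q' < d ∧ c < p ∧ d < q) (hpq : p ≠ q')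
    {b : Perm (Fin n)} (hb : ∀ m, (∀ u ∈ Y, u m = m) → b m = m)
    (hv : BruhatLE (b * y₂ * b⁻¹ * y₁ * b) v ∨ BruhatLE (b * y₂ * b⁻¹ * y₁ * b)⁻¹ v) :
    b * y₂ * b⁻¹ * y₁ * b = y₁ * b * y₂ := by
  have hpp := o1.lt
  have hpq' := o2.lt
  have bp' : b p' = p' := hb p' fun u hu => by
    obtain ⟨k, c, d, ho, h1, h2, h3, h4⟩ := hY u hu
    exact ho.apply_of_ne h1.ne (h1.trans ho.lt).ne
  have bq : b q = q := hb q fun u hu => by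
    obtain ⟨k, c, d, ho, h1, h2, h3, h4⟩ := hY u hu
    exact ho.apply_of_ne (ho.lt.trans h4).ne' h4.ne'
  have hconj : b * y₂ * b⁻¹ = swap (b p) q := by
    rw [o2.eq, ← swap_apply_apply, bq]
  by_cases hbp : b p = q'
  · exfalso
    have ibp : b⁻¹ q' = p := by rw [Perm.inv_eq_iff_eq, hbp]
    have hle : BruhatLE (swap p' p) (b * y₂ * b⁻¹ * y₁ * b) := by
      refine swap_le_of_le_apply hp ?_ ?_
      · simp only [Perm.mul_apply, bp', o1.eq, swap_apply_left, ibp, o2.eq, bq]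
        exact hpq'.le
      · have : (b * y₂ * b⁻¹ * y₁ * b) p = p' := by
          rw [Perm.mul_apply, Perm.mul_apply, hbp, hconj, hbp, o1.eq, swap_apply_right,
            swap_apply_of_ne_of_ne hpp.ne (hpp.trans hq).ne]
        rw [(Perm.inv_eq_iff_eq).2 this.symm]
    have hle' : BruhatLE (swap p' p) v := by
      rcases hv with hv | hv
      · exact hle.trans hv
      · have := hle.inv
        rw [swap_inv] at this
        exact this.trans hv
    obtain ⟨u, hu, hup⟩ : ∃ u ∈ Y, u p ≠ p := by
      by_contra hc
      push Not at hc
      exact hpq ((hb p hc).symm.trans hbp)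
    obtain ⟨t, ht, htq⟩ : ∃ u ∈ Y, u q' ≠ q' := by
      by_contra hc
      push Not at hc
      exact hpq (b.injective (hbp.trans (hb q' hc).symm))
    obtain ⟨k, c, d, ou, c1, c2, c3, c4⟩ := hY u hu
    obtain ⟨l, e, f, ot, d1, d2, d3, d4⟩ := hY t ht
    have hd : d = p := by
      by_contra hc
      exact hup (ou.apply_of_ne c3.ne' (Ne.symm hc))
    have he : e = q' := by
      by_contra hc
      exact htq (ot.apply_of_ne (Ne.symm hc) d2.ne)
    subst hd he
    have x1 := o1.left_le
    have x2 := o1.lt_right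
    have x3 := ou.left_le
    have x4 := ou.lt_right
    have x5 := ot.left_le
    have hki : k ≠ i := by
      rintro rfl
      have h5 := o1.same_cut hI ou c1 c2
      exact absurd (ou.ordered hI ot (by omega)) (not_le.2 d3)
    rw [Fin.lt_def] at c1 d3
    rcases lt_or_gt_of_ne hki with h | h
    · exact hI.not_swap_le_of_cuts ou.cut o1.cut h (by omega) (by omega) hle'
    · exact hI.not_swap_le_of_cuts o1.cut ou.cut h (by omega) (by omega) hle'
  · have hbp' : b p ≠ p' := fun h => hp.ne' (b.injective (h.trans bp'.symm))
    have hcomm : swap (b p) q * y₁ = y₁ * swap (b p) q := by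
      rw [o1.eq]
      exact swap_mul_swap_disjoint hbp' hbp (hpp.trans hq).ne' hq.ne'
    rw [hconj, hcomm, ← hconj]
    simp [mul_assoc]

theorem diamondsFill_of_ends (hI : IsHypercubeDecomposition 1 v I) {Y : Finset (Perm (Fin n))}
    {y₁ y₂ : Perm (Fin n)} {i j : ℕ} {p' q' p q : Fin n} (o1 : OutAt v I i p' q' y₁)
    (o2 : OutAt v I j p q y₂) (hp : p' < p) (hq : q' < q) (hn1 : y₁ ∉ Y) (hn2 : y₂ ∉ Y)
    (h1 : insert y₁ Y ∈ Antichains 1 v I 1) (h2 : insert y₂ Y ∈ Antichains 1 v I 1)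
    (hY : ∀ u ∈ Y, ∃ k c d, OutAt v I k c d u ∧ p' < c ∧ q' < d ∧ c < p ∧ d < q) :
    DiamondsFill v Y y₁ y₂ := by
  intro w hw hneq e1 e2
  have hcl := hI.cluster 1 hI.one_mem
  have r1 : ¬ BruhatLE y₁ y₂ := by rw [o1.le_iff o2]; exact fun h => absurd h.1 (not_le.2 hp)
  have r2 : ¬ BruhatLE y₂ y₁ := by rw [o2.le_iff o1]; exact fun h => absurd h.2 (not_le.2 hq)
  refine ⟨r1, r2, ?_⟩
  have hne : y₁ ≠ y₂ := by rintro rfl; exact r1 .refl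
  have y1o := o1.mem_out hI
  have y2o := o2.mem_out hI
  have hZ := insert_insert_mem_antichains h1 h2 r1 r2
  -- When the extremes share an endpoint there is no room for `Y`, and uniqueness for the pair
  -- suffices.
  by_cases hpq : p = q'
  · have hYe : Y = ∅ := by
      rw [Finset.eq_empty_iff_forall_notMem]
      intro u hu
      obtain ⟨k, c, d, ou, c1, c2, c3, c4⟩ := hY u hu
      have x1 := o1.lt_right
      have x2 := o2.left_le
      have x3 : p.val = q'.val := by rw [hpq]
      rcases lt_trichotomy k i with h | h | h
      · exact absurd (ou.ordered hI o1 h) (not_le.2 (c1.trans ou.lt))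
      · subst h
        exact absurd (ou.ordered hI o2 (by omega)) (not_le.2 (hpq ▸ c2))
      · exact absurd (o1.ordered hI ou h) (not_le.2 (hpq ▸ c3))
    subst hYe
    simp only [insert_empty_eq] at e1 e2 h1 h2 ⊢
    rw [(hcl.cube_theta h1).atom y₁ (by simp)] at e1
    rw [(hcl.cube_theta h2).atom y₂ (by simp)] at e2
    exact theta_pair_eq hI y1o y2o r1 r2 hw e1 e2
  have end2 : IsEnd p q ((insert y₁ Y : Finset (Perm (Fin n))) : Set (Perm (Fin n))) := by
    refine o2.isEnd_right hI fun u hu => ?_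
    simp only [Finset.coe_insert, Set.mem_insert_iff, Finset.mem_coe] at hu
    rcases hu with rfl | hu
    · exact ⟨i, p', q', o1, hp, hq⟩
    · obtain ⟨k, c, d, ou, c1, c2, c3, c4⟩ := hY u hu
      exact ⟨k, c, d, ou, c3, c4⟩
  have end1 : IsEnd q' p' ((insert y₂ Y : Finset (Perm (Fin n))) : Set (Perm (Fin n))) := by
    refine o1.isEnd_left hI fun u hu => ?_
    simp only [Finset.coe_insert, Set.mem_insert_iff, Finset.mem_coe] at hu
    rcases hu with rfl | hu
    · exact ⟨j, p, q, o2, hp, hq⟩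
    · obtain ⟨k, c, d, ou, c1, c2, c3, c4⟩ := hY u hu
      exact ⟨k, c, d, ou, c1, c2⟩
  have s1 : y₁ = swap q' p' := by rw [swap_comm]; exact o1.eq
  have or2 := orientation hI o2.eq y2o end2 fun u hu => by
    simp only [Finset.coe_insert, Set.mem_insert_iff, Finset.mem_coe] at hu
    rcases hu with rfl | hu
    · exact ⟨y1o, r1, r2⟩
    · exact ⟨h1.1 (by simp [hu]), not_le_of_insert h2 hu hn2⟩
  have or1 := orientation hI s1 y1o end1 fun u hu => by
    simp only [Finset.coe_insert, Set.mem_insert_iff, Finset.mem_coe] at hu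
    rcases hu with rfl | hu
    · exact ⟨y2o, r2, r1⟩
    · exact ⟨h1.1 (by simp [hu]), not_le_of_insert h1 hu hn1⟩
  have htop := theta_diamond_top hI hn1 hn2 h1 h2 hneq e1 e2
  have hfix : ∀ m, (∀ u ∈ Y, u m = m) → theta 1 v 1 Y m = m := fun m hm =>
    (hcl.cube_theta h1).apply_eq (Finset.subset_insert _ _) hm
  have hZ' := hZ
  rw [Finset.insert_comm] at hZ'
  have n1 : y₁ ∉ insert y₂ Y := by simp [hne, hn1]
  have n2 : y₂ ∉ insert y₁ Y := by simp [hne.symm, hn2]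
  have q2 : ∀ u ∈ insert y₁ Y, u q = q := fun u hu => end2.1 u (by exact_mod_cast hu)
  have q1 : ∀ u ∈ insert y₂ Y, u p' = p' := fun u hu => end1.1 u (by exact_mod_cast hu)
  have m1 : ∀ u ∈ Y, u ∈ insert y₁ Y := fun u hu => Finset.mem_insert_of_mem hu
  have m2 : ∀ u ∈ Y, u ∈ insert y₂ Y := fun u hu => Finset.mem_insert_of_mem hu
  have inv1 := out_inv hI y1o
  have inv2 := out_inv hI y2o
  -- If both extremes multiply on the same side, each candidate for `w` is one of the two
  -- expressions for `θ`. If the sides differ, one candidate is immediate and the other needs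
  -- `conj_mul_eq_of_le`.
  rcases or2 with or2 | or2 <;> rcases or1 with or1 | or1
  · have a2 := theta_insert_right hI h2 hn2 o2.eq (fun u hu => q2 u (m1 u hu))
      fun u hu => or2 u (by exact_mod_cast m1 u hu)
    have b2 := theta_insert_right hI hZ' n2 o2.eq q2 fun u hu => or2 u (by exact_mod_cast hu)
    have a1 := theta_insert_right hI h1 hn1 s1 (fun u hu => q1 u (m2 u hu))
      fun u hu => or1 u (by exact_mod_cast m2 u hu)
    have b1 := theta_insert_right hI hZ n1 s1 q1 fun u hu => or1 u (by exact_mod_cast hu)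
    rcases htop with h | h
    · rw [Finset.insert_comm, b2, h, a2]; simp [mul_assoc]
    · rw [b1, h, a1]; simp [mul_assoc]
  · have a2 := theta_insert_right hI h2 hn2 o2.eq (fun u hu => q2 u (m1 u hu))
      fun u hu => or2 u (by exact_mod_cast m1 u hu)
    have b2 := theta_insert_right hI hZ' n2 o2.eq q2 fun u hu => or2 u (by exact_mod_cast hu)
    have a1 := theta_insert_left hI h1 hn1 s1 (fun u hu => q1 u (m2 u hu))
      fun u hu => or1 u (by exact_mod_cast m2 u hu)
    rw [Finset.insert_comm, b2, a1]
    rcases htop with h | h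
    · rw [h, a1, a2]; simp [mul_assoc]
    · rw [a1, a2] at h
      have h' : w = theta 1 v 1 Y * y₂ * (theta 1 v 1 Y)⁻¹ * y₁ * theta 1 v 1 Y := by
        rw [h]; simp [mul_assoc]
      rw [h'] at hw ⊢
      exact (conj_mul_eq_of_le hI o1 o2 hp hq hY hpq hfix (.inl hw)).symm
  · have a2 := theta_insert_left hI h2 hn2 o2.eq (fun u hu => q2 u (m1 u hu))
      fun u hu => or2 u (by exact_mod_cast m1 u hu)
    have b2 := theta_insert_left hI hZ' n2 o2.eq q2 fun u hu => or2 u (by exact_mod_cast hu)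
    have a1 := theta_insert_right hI h1 hn1 s1 (fun u hu => q1 u (m2 u hu))
      fun u hu => or1 u (by exact_mod_cast m2 u hu)
    rw [Finset.insert_comm, b2, a1]
    rcases htop with h | h
    · rw [a1, a2] at h
      have h' : w⁻¹ = (theta 1 v 1 Y)⁻¹ * y₂ * (theta 1 v 1 Y)⁻¹⁻¹ * y₁ * (theta 1 v 1 Y)⁻¹ := by
        rw [h]; simp [mul_assoc, inv1, inv2]
      have := conj_mul_eq_of_le hI o1 o2 hp hq hY hpq (b := (theta 1 v 1 Y)⁻¹)
        (fun m hm => inv_apply_eq_of (hfix m hm)) (.inr (by rw [← h', inv_inv]; exact hw))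
      rw [← h'] at this
      rw [← inv_inj, this]
      simp [mul_assoc, inv1, inv2]
    · rw [h, a1, a2]; simp [mul_assoc]
  · have a2 := theta_insert_left hI h2 hn2 o2.eq (fun u hu => q2 u (m1 u hu))
      fun u hu => or2 u (by exact_mod_cast m1 u hu)
    have b2 := theta_insert_left hI hZ' n2 o2.eq q2 fun u hu => or2 u (by exact_mod_cast hu)
    have a1 := theta_insert_left hI h1 hn1 s1 (fun u hu => q1 u (m2 u hu))
      fun u hu => or1 u (by exact_mod_cast m2 u hu)
    have b1 := theta_insert_left hI hZ n1 s1 q1 fun u hu => or1 u (by exact_mod_cast hu)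
    rcases htop with h | h
    · rw [b1, h, a1]; simp [mul_assoc]
    · rw [Finset.insert_comm, b2, h, a2]; simp [mul_assoc]

theorem OutAt.right_unique {i j : ℕ} {a b c d : Fin n} {y : Perm (Fin n)} (h : OutAt v I i a b y)
    (h' : OutAt v I j c d y) : b = d :=
  le_antisymm ((h.le_iff h').1 .refl).2 ((h'.le_iff h).1 .refl).2

theorem OutAt.left_unique {i j : ℕ} {a b c d : Fin n} {y : Perm (Fin n)} (h : OutAt v I i a b y)
    (h' : OutAt v I j c d y) : a = c :=
  le_antisymm ((h'.le_iff h).1 .refl).1 ((h.le_iff h').1 .refl).1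

theorem exists_rightmost (hI : IsHypercubeDecomposition 1 v I) {Y : Finset (Perm (Fin n))}
    (hY : Y ∈ Antichains 1 v I 1) (hne : Y.Nonempty) :
    ∃ z ∈ Y, ∃ j p q, OutAt v I j p q z ∧
      ∀ u ∈ Y, u ≠ z → ∃ i c d, OutAt v I i c d u ∧ c < p ∧ d < q := by
  obtain ⟨y, hy⟩ := hne
  obtain ⟨-, a, -, -⟩ := exists_outAt hI (hY.1 hy)
  have : Nonempty (Fin n) := ⟨a⟩
  choose! J A B hO using fun y (hy : y ∈ Y) => exists_outAt hI (hY.1 hy)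
  obtain ⟨z, hz, hmax⟩ := Y.exists_max_image B ⟨y, hy⟩
  refine ⟨z, hz, J z, A z, B z, hO z hz, fun u hu huz => ⟨J u, A u, B u, hO u hu, ?_⟩⟩
  exact ((hO u hu).lt_or_lt (hO z hz) (hY.2 hu hz huz) (hY.2 hz hu huz.symm)).resolve_right
    fun h => absurd h.2 (not_lt.2 (hmax u hu))

theorem exists_leftmost (hI : IsHypercubeDecomposition 1 v I) {Y : Finset (Perm (Fin n))}
    (hY : Y ∈ Antichains 1 v I 1) (hne : Y.Nonempty) :
    ∃ z ∈ Y, ∃ j p q, OutAt v I j p q z ∧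
      ∀ u ∈ Y, u ≠ z → ∃ i c d, OutAt v I i c d u ∧ p < c ∧ q < d := by
  obtain ⟨y, hy⟩ := hne
  obtain ⟨-, a, -, -⟩ := exists_outAt hI (hY.1 hy)
  have : Nonempty (Fin n) := ⟨a⟩
  choose! J A B hO using fun y (hy : y ∈ Y) => exists_outAt hI (hY.1 hy)
  obtain ⟨z, hz, hmin⟩ := Y.exists_min_image A ⟨y, hy⟩
  refine ⟨z, hz, J z, A z, B z, hO z hz, fun u hu huz => ⟨J u, A u, B u, hO u hu, ?_⟩⟩
  exact ((hO u hu).lt_or_lt (hO z hz) (hY.2 hu hz huz) (hY.2 hz hu huz.symm)).resolve_left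
    fun h => absurd h.1 (not_lt.2 (hmin u hu))

theorem diamondsFill (hI : IsHypercubeDecomposition 1 v I) (Y : Finset (Perm (Fin n)))
    {y₁ y₂ : Perm (Fin n)} (hn1 : y₁ ∉ Y) (hn2 : y₂ ∉ Y) (hne : y₁ ≠ y₂)
    (h1 : insert y₁ Y ∈ Antichains 1 v I 1) (h2 : insert y₂ Y ∈ Antichains 1 v I 1) :
    DiamondsFill v Y y₁ y₂ := by
  induction Y using Finset.strongInduction with
  | H Y ih =>
  have hY : Y ∈ Antichains 1 v I 1 := Antichains.mono h1 (Finset.subset_insert _ _)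
  obtain ⟨i₁, a₁, b₁, o1⟩ := exists_outAt hI (h1.1 (Finset.mem_coe.2 (Finset.mem_insert_self y₁ Y)))
  obtain ⟨i₂, a₂, b₂, o2⟩ := exists_outAt hI (h2.1 (Finset.mem_coe.2 (Finset.mem_insert_self y₂ Y)))
  have hrem : ∀ z ∈ Y, ∀ p q, z = swap p q → p ≠ q →
      IsEnd p q ((insert y₁ (insert y₂ (Y.erase z)) : Finset (Perm (Fin n))) : Set (Perm (Fin n))) →
      DiamondsFill v Y y₁ y₂ := by
    intro z hz p q hzpq hpq hend
    have hYz := Finset.insert_erase hz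
    have := DiamondsFill.of_erase hI (z := z) (Y := Y.erase z) (by rwa [hYz]) (by rwa [hYz])
      (by rwa [hYz]) (by rwa [hYz]) (Finset.notMem_erase z Y) hzpq hpq hend
      (ih (Y.erase z) (Finset.erase_ssubset hz) (fun h => hn1 (Finset.mem_of_mem_erase h))
        (fun h => hn2 (Finset.mem_of_mem_erase h))
        (Antichains.mono h1 (Finset.insert_subset_insert _ (Finset.erase_subset _ _)))
        (Antichains.mono h2 (Finset.insert_subset_insert _ (Finset.erase_subset _ _))))
    rwa [hYz] at this
  rcases Y.eq_empty_or_nonempty with rfl | hYne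
  · by_cases hle : BruhatLE y₁ y₂ ∨ BruhatLE y₂ y₁
    · intro w hw hneq e1 e2
      have hcl := hI.cluster 1 hI.one_mem
      simp only [insert_empty_eq] at e1 e2 h1 h2
      rw [(hcl.cube_theta h1).atom y₁ (by simp)] at e1
      rw [(hcl.cube_theta h2).atom y₂ (by simp)] at e2
      exfalso
      rcases hle with hle | hle
      · exact o1.no_diamond_of_le hI o2 hle hne e1 e2
      · exact o2.no_diamond_of_le hI o1 hle hne.symm e2 e1
    · rw [not_or] at hle
      rcases o1.lt_or_lt o2 hle.1 hle.2 with h | h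
      · exact diamondsFill_of_ends hI o1 o2 h.1 h.2 hn1 hn2 h1 h2 (by simp)
      · exact (diamondsFill_of_ends hI o2 o1 h.1 h.2 hn2 hn1 h2 h1 (by simp)).symm
  obtain ⟨zr, hzr, jr, pr, qr, or, hr⟩ := exists_rightmost hI hY hYne
  obtain ⟨zl, hzl, jl, pl, ql, ol, hl⟩ := exists_leftmost hI hY hYne
  have n1r := not_le_of_insert h1 hzr hn1
  have n2r := not_le_of_insert h2 hzr hn2
  have n1l := not_le_of_insert h1 hzl hn1
  have n2l := not_le_of_insert h2 hzl hn2
  have mem_right : ∀ u ∈ Y, ∃ i c d, OutAt v I i c d u ∧ c ≤ pr ∧ d ≤ qr ∧ pl ≤ c ∧ ql ≤ d := by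
    intro u hu
    obtain ⟨i, c, d, ou⟩ := exists_outAt hI (hY.1 hu)
    refine ⟨i, c, d, ou, ?_⟩
    have e1 : c ≤ pr ∧ d ≤ qr := by
      by_cases huz : u = zr
      · subst huz; exact ⟨(ou.left_unique or).le, (ou.right_unique or).le⟩
      · obtain ⟨i', c', d', ou', h, h'⟩ := hr u hu huz
        rw [ou.left_unique ou', ou.right_unique ou']; exact ⟨h.le, h'.le⟩
    have e2 : pl ≤ c ∧ ql ≤ d := by
      by_cases huz : u = zl
      · subst huz; exact ⟨(ou.left_unique ol).ge, (ou.right_unique ol).ge⟩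
      · obtain ⟨i', c', d', ou', h, h'⟩ := hl u hu huz
        rw [ou.left_unique ou', ou.right_unique ou']; exact ⟨h.le, h'.le⟩
    exact ⟨e1.1, e1.2, e2⟩
  obtain ⟨-, c, d, oc, k1, k2, k3, k4⟩ := mem_right zl hzl
  have hlr : pl ≤ pr := k3.trans k1
  have hlr' : ql ≤ qr := k4.trans k2
  have hends : ∀ {i j : ℕ} {a b c d : Fin n} {y y' : Perm (Fin n)}, OutAt v I i a b y →
      OutAt v I j c d y' → a < pl ∧ b < ql → pr < c ∧ qr < d → y ∉ Y → y' ∉ Y →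
      insert y Y ∈ Antichains 1 v I 1 → insert y' Y ∈ Antichains 1 v I 1 →
      DiamondsFill v Y y y' := by
    intro i j a b c d y y' oy oy' f g my my' hy hy'
    refine diamondsFill_of_ends hI oy oy' (by order) (by order) my my' hy hy' fun u hu => ?_
    obtain ⟨i, c, d, ou, k1, k2, k3, k4⟩ := mem_right u hu
    exact ⟨i, c, d, ou, by order, by order, by order, by order⟩
  -- If the rightmost or the leftmost element of `Y` is extreme for `Y ∪ {y₁, y₂}`, it is stripped
  -- off. Otherwise one of `y₁`, `y₂` is to the left of all of `Y` and the other to the right.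
  by_cases hR : (a₁ < pr ∧ b₁ < qr) ∧ a₂ < pr ∧ b₂ < qr
  · refine hrem zr hzr pr qr or.eq or.lt.ne (or.isEnd_right hI fun u hu => ?_)
    simp only [Finset.coe_insert, Set.mem_insert_iff, Finset.mem_coe, Finset.mem_erase] at hu
    rcases hu with rfl | rfl | hu
    · exact ⟨_, _, _, o1, hR.1⟩
    · exact ⟨_, _, _, o2, hR.2⟩
    · exact hr u hu.2 hu.1
  by_cases hL : (pl < a₁ ∧ ql < b₁) ∧ pl < a₂ ∧ ql < b₂
  · refine hrem zl hzl ql pl (by rw [swap_comm]; exact ol.eq) ol.lt.ne'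
      (ol.isEnd_left hI fun u hu => ?_)
    simp only [Finset.coe_insert, Set.mem_insert_iff, Finset.mem_coe, Finset.mem_erase] at hu
    rcases hu with rfl | rfl | hu
    · exact ⟨_, _, _, o1, hL.1⟩
    · exact ⟨_, _, _, o2, hL.2⟩
    · exact hl u hu.2 hu.1
  have g1 := o1.lt_or_lt or n1r.2 n1r.1
  have g2 := o2.lt_or_lt or n2r.2 n2r.1
  have f1 := o1.lt_or_lt ol n1l.2 n1l.1
  have f2 := o2.lt_or_lt ol n2l.2 n2l.1
  by_cases hf : a₁ < pl ∧ b₁ < ql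
  · exact hends o1 o2 hf (by omega) hn1 hn2 h1 h2
  · exact (hends o2 o1 (by omega) (by omega) hn2 hn1 h2 h1).symm

theorem isStrongCluster_one (hI : IsHypercubeDecomposition 1 v I) : IsStrongCluster 1 v I 1 := by
  refine ⟨hI.cluster 1 hI.one_mem, fun Y₁ h1 Y₂ h2 hc hc' w hd => ?_⟩
  have d1 : (Y₁ \ Y₂).card = 1 := by
    have := Finset.card_sdiff_add_card_inter Y₁ Y₂; omega
  have d2 : (Y₂ \ Y₁).card = 1 := by
    have := Finset.card_sdiff_add_card_inter Y₂ Y₁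
    rw [Finset.inter_comm] at this; omega
  obtain ⟨y₁, hy1⟩ := Finset.card_eq_one.1 d1
  obtain ⟨y₂, hy2⟩ := Finset.card_eq_one.1 d2
  have m1 : ∀ u, (u ∈ Y₁ ∧ u ∉ Y₂) ↔ u = y₁ := fun u => by
    rw [← Finset.mem_sdiff, hy1, Finset.mem_singleton]
  have m2 : ∀ u, (u ∈ Y₂ ∧ u ∉ Y₁) ↔ u = y₂ := fun u => by
    rw [← Finset.mem_sdiff, hy2, Finset.mem_singleton]
  have p1 := (m1 y₁).2 rfl
  have p2 := (m2 y₂).2 rfl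
  have e1 : Y₁ = insert y₁ (Y₁ ∩ Y₂) := by
    ext u; rw [Finset.mem_insert, Finset.mem_inter, ← m1 u]; tauto
  have e2 : Y₂ = insert y₂ (Y₁ ∩ Y₂) := by
    ext u; rw [Finset.mem_insert, Finset.mem_inter, ← m2 u]; tauto
  have e3 : Y₁ ∪ Y₂ = insert y₁ (insert y₂ (Y₁ ∩ Y₂)) := by
    ext u
    rw [Finset.mem_insert, Finset.mem_insert, Finset.mem_inter, Finset.mem_union, ← m1 u, ← m2 u]
    tauto
  have n1 : y₁ ∉ Y₁ ∩ Y₂ := fun h => p1.2 (Finset.mem_inter.1 h).2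
  have n2 : y₂ ∉ Y₁ ∩ Y₂ := fun h => p2.2 (Finset.mem_inter.1 h).1
  have hne : y₁ ≠ y₂ := by rintro rfl; exact p1.2 p2.1
  rw [e3]
  generalize Y₁ ∩ Y₂ = Y at *
  subst e1 e2
  obtain ⟨r1, r2, r3⟩ := diamondsFill hI Y n1 n2 hne h1 h2 w hd.mem_top.2 hd.ne hd.left_top
    hd.right_top
  exact ⟨(insert_insert_mem_antichains h1 h2 r1 r2).2, r3⟩

/-! ### The numerical criterion -/

theorem theta_insert_rightmost (hI : IsHypercubeDecomposition 1 v I) {Y : Finset (Perm (Fin n))}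
    {z : Perm (Fin n)} {j : ℕ} {p q : Fin n} (hY : insert z Y ∈ Antichains 1 v I 1) (hzY : z ∉ Y)
    (oz : OutAt v I j p q z) (hr : ∀ u ∈ Y, ∃ i c d, OutAt v I i c d u ∧ c < p ∧ d < q) :
    theta 1 v 1 (insert z Y) = theta 1 v 1 Y * z ∨ theta 1 v 1 (insert z Y) = z * theta 1 v 1 Y := by
  have hend : IsEnd p q (Y : Set (Perm (Fin n))) := oz.isEnd_right hI hr
  have hq : ∀ u ∈ Y, u q = q := fun u hu => hend.1 u (by exact_mod_cast hu)
  rcases orientation hI oz.eq (oz.mem_out hI) hend fun u hu =>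
    ⟨hY.1 (by simp [Finset.mem_coe.1 hu]), not_le_of_insert hY (Finset.mem_coe.1 hu) hzY⟩ with h | h
  · exact .inl (theta_insert_right hI hY hzY oz.eq hq fun u hu => h u (by exact_mod_cast hu))
  · exact .inr (theta_insert_left hI hY hzY oz.eq hq fun u hu => h u (by exact_mod_cast hu))

theorem theta_insert_apply_ne (hI : IsHypercubeDecomposition 1 v I) {Y : Finset (Perm (Fin n))}
    {z : Perm (Fin n)} {j : ℕ} {p q : Fin n} (hY : insert z Y ∈ Antichains 1 v I 1) (hzY : z ∉ Y)
    (oz : OutAt v I j p q z) (hr : ∀ u ∈ Y, ∃ i c d, OutAt v I i c d u ∧ c < p ∧ d < q) :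
    theta 1 v 1 (insert z Y) q ≠ q := by
  have hq : theta 1 v 1 Y q = q :=
    ((hI.cluster 1 hI.one_mem).cube_theta hY).apply_eq (Finset.subset_insert _ _) fun u hu =>
      (oz.isEnd_right hI (T := (Y : Set (Perm (Fin n)))) hr).1 u hu
  rcases theta_insert_rightmost hI hY hzY oz hr with h | h
  · rw [h, Perm.mul_apply, oz.eq, swap_apply_right]
    intro hc
    exact oz.lt.ne ((theta 1 v 1 Y).injective (hc.trans hq.symm))
  · rw [h, Perm.mul_apply, hq, oz.eq, swap_apply_right]
    exact oz.lt.ne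

/-- Since inversion preserves length, passing to `θ(Y)⁻¹` reduces multiplication on the left to
multiplication on the right. -/
theorem exists_length_theta_insert (hI : IsHypercubeDecomposition 1 v I)
    {Y : Finset (Perm (Fin n))} {z : Perm (Fin n)} {j : ℕ} {p q : Fin n}
    (hY : insert z Y ∈ Antichains 1 v I 1) (hzY : z ∉ Y)
    (oz : OutAt v I j p q z) (hr : ∀ u ∈ Y, ∃ i c d, OutAt v I i c d u ∧ c < p ∧ d < q) :
    ∃ x, (x = theta 1 v 1 Y ∨ x = (theta 1 v 1 Y)⁻¹) ∧ length x = length (theta 1 v 1 Y) ∧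
      length (theta 1 v 1 (insert z Y)) = length (x * swap p q) ∧
      ∀ m, (∀ u ∈ Y, u m = m) → x m = m := by
  have hfix : ∀ m, (∀ u ∈ Y, u m = m) → theta 1 v 1 Y m = m := fun m hm =>
    ((hI.cluster 1 hI.one_mem).cube_theta hY).apply_eq (Finset.subset_insert _ _) hm
  rcases theta_insert_rightmost hI hY hzY oz hr with h | h
  · exact ⟨_, .inl rfl, rfl, by rw [h, oz.eq], hfix⟩
  · refine ⟨_, .inr rfl, length_inv _, ?_, fun m hm => inv_apply_eq_of (hfix m hm)⟩
    rw [h, oz.eq, ← length_inv, mul_inv_rev, swap_inv]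

theorem apply_le_of_fixes {x : Perm (Fin n)} {p : Fin n} (h : ∀ m, p < m → x m = m) : x p ≤ p := by
  by_contra hc
  rw [not_le] at hc
  exact hc.ne' (x.injective (h _ hc))

theorem OutAt.mem_out_le_iff (hI : IsHypercubeDecomposition 1 v I) {z y : Perm (Fin n)} {j : ℕ}
    {p q : Fin n} (oz : OutAt v I j p q z) : y ∈ Out 1 v I 1 ∧ BruhatLE y z ↔
      ∃ c d : Fin n, p ≤ c ∧ d ≤ q ∧ c.val ≤ j ∧ j < d.val ∧ y = swap c d := by
  constructor
  · rintro ⟨hy, hle⟩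
    obtain ⟨i, c, d, o⟩ := exists_outAt hI hy
    rw [o.le_iff oz] at hle
    have hl := o.left_le
    have hr := o.lt_right
    have h1 := Fin.le_def.1 hle.1
    have h2 := Fin.le_def.1 hle.2
    obtain rfl := oz.cut_eq hI o.cut (by omega) (by omega)
    exact ⟨c, d, hle.1, hle.2, hl, hr, o.eq⟩
  · rintro ⟨c, d, h1, h2, h3, h4, rfl⟩
    have hcd : c < d := by rw [Fin.lt_def]; omega
    have hle : BruhatLE (swap c d) z := by
      rw [oz.eq, swap_le_swap_iff hcd oz.lt]; exact ⟨h1, h2⟩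
    exact ⟨OutAt.mem_out hI ⟨rfl, hcd, h3, h4, oz.cut, hle.trans oz.le⟩, hle⟩

theorem swap_left_injective (p : Fin n) : Function.Injective (swap p) := by
  intro a b h
  have := congrArg (fun σ : Perm (Fin n) => σ p) h
  simpa using this

theorem ncard_image_swap_left (p : Fin n) (s : Finset (Fin n)) :
    (swap p '' (s : Set (Fin n))).ncard = s.card := by
  rw [Set.ncard_image_of_injective _ (swap_left_injective p), Set.ncard_coe_finset]

theorem ncard_image_swap_right (q : Fin n) (s : Finset (Fin n)) :
    ((fun c => swap c q) '' (s : Set (Fin n))).ncard = s.card := by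
  simp_rw [swap_comm _ q]
  exact ncard_image_swap_left q s

/-- The shape at the cut pins one endpoint, so only the other one varies. -/
theorem OutAt.ncard_out_le (hI : IsHypercubeDecomposition 1 v I) {z : Perm (Fin n)} {j : ℕ}
    {p q : Fin n} (oz : OutAt v I j p q z) :
    {y | y ∈ Out 1 v I 1 ∧ BruhatLE y z}.ncard = q.val - p.val := by
  have hl := oz.left_le
  have hr := oz.lt_right
  rcases oz.shape hI with hs | hs
  · have : {y | y ∈ Out 1 v I 1 ∧ BruhatLE y z} = swap p '' (Finset.Ioc p q : Set (Fin n)) := by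
      ext y
      rw [Set.mem_ofPred_eq, oz.mem_out_le_iff hI]
      simp only [Set.mem_image, Finset.coe_Ioc, Set.mem_Ioc]
      constructor
      · rintro ⟨c, d, h1, h2, h3, h4, rfl⟩
        have hc : c = p := by rw [Fin.le_def] at h1; apply Fin.ext; omega
        exact ⟨d, ⟨by rw [Fin.lt_def]; omega, h2⟩, by rw [hc]⟩
      · rintro ⟨d, ⟨h1, h2⟩, rfl⟩
        rw [Fin.lt_def] at h1
        exact ⟨p, d, le_rfl, h2, by omega, by omega, rfl⟩
    rw [this, ncard_image_swap_left, Fin.card_Ioc]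
  · have : {y | y ∈ Out 1 v I 1 ∧ BruhatLE y z} =
        (fun c => swap c q) '' (Finset.Ico p q : Set (Fin n)) := by
      ext y
      rw [Set.mem_ofPred_eq, oz.mem_out_le_iff hI]
      simp only [Set.mem_image, Finset.coe_Ico, Set.mem_Ico]
      constructor
      · rintro ⟨c, d, h1, h2, h3, h4, rfl⟩
        have hd : d = q := by rw [Fin.le_def] at h2; apply Fin.ext; omega
        exact ⟨c, ⟨h1, by rw [Fin.lt_def]; omega⟩, by rw [hd]⟩
      · rintro ⟨c, ⟨h1, h2⟩, rfl⟩
        rw [Fin.lt_def] at h2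
        exact ⟨c, q, h1, le_rfl, by omega, by omega, rfl⟩
    rw [this, ncard_image_swap_right, Fin.card_Ico]

theorem ncard_lam_insert (Y : Finset (Perm (Fin n))) (z : Perm (Fin n)) :
    (Lam 1 v I 1 (insert z Y)).ncard =
      {y | (y ∈ Out 1 v I 1 ∧ BruhatLE y z) ∧ ∀ u ∈ Y, ¬ BruhatLE y u}.ncard +
        (Lam 1 v I 1 Y).ncard := by
  have hsub : Lam 1 v I 1 Y ⊆ Lam 1 v I 1 (insert z Y) := fun y hy =>
    ⟨hy.1, hy.2.imp fun u hu => ⟨Finset.mem_insert_of_mem hu.1, hu.2⟩⟩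
  rw [← Set.ncard_sdiff_add_ncard_of_subset hsub (Set.toFinite _)]
  congr 2
  ext y
  simp only [Lam, Set.mem_sdiff, Set.mem_ofPred_eq, Finset.mem_insert, exists_eq_or_imp, not_and,
    not_exists]
  constructor
  · rintro ⟨⟨h1, h2⟩, h3⟩
    exact ⟨⟨h1, h2.resolve_right fun ⟨u, hu, hle⟩ => h3 h1 u hu hle⟩, h3 h1⟩
  · rintro ⟨⟨h1, h2⟩, h3⟩
    exact ⟨⟨h1, .inl h2⟩, fun _ => h3⟩

/-- By `length_mul_swap` the length grows by one plus twice the number of positions strictly between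
`p` and `q` with intermediate value. If `Y` moves nothing beyond `p`, all `q - p - 1` positions
count, and all `q - p` elements below `z` are new. Otherwise some `(a b) ∈ Y` crosses the cut of
`z`, which forces `p = j` and `b = j + 1`; then only the `q - b - 1` positions beyond `b` count, and
the new elements are `(p d)` with `b < d ≤ q`. -/
theorem length_theta_insert (hI : IsHypercubeDecomposition 1 v I)
    {Y : Finset (Perm (Fin n))} {z : Perm (Fin n)} {j : ℕ} {p q : Fin n}
    (hY : insert z Y ∈ Antichains 1 v I 1) (hzY : z ∉ Y)
    (oz : OutAt v I j p q z) (hr : ∀ u ∈ Y, ∃ i c d, OutAt v I i c d u ∧ c < p ∧ d < q) :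
    length (theta 1 v 1 (insert z Y)) + 1 = length (theta 1 v 1 Y) +
      2 * {y | (y ∈ Out 1 v I 1 ∧ BruhatLE y z) ∧ ∀ u ∈ Y, ¬ BruhatLE y u}.ncard := by
  obtain ⟨x, hx, hlx, hlen, hfix⟩ := exists_length_theta_insert hI hY hzY oz hr
  have hpq := oz.lt
  have hpq' := Fin.lt_def.1 hpq
  have hxq : x q = q := hfix q fun u hu => by
    obtain ⟨i, c, d, ou, h1, h2⟩ := hr u hu
    exact ou.apply_of_ne (h1.trans hpq).ne' h2.ne'
  rw [hlen, ← hlx]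
  by_cases hA : ∀ u ∈ Y, ∀ m, p < m → u m = m
  · have hxm : ∀ m, p < m → x m = m := fun m hm => hfix m fun u hu => hA u hu m hm
    have hxp := apply_le_of_fixes hxm
    rw [length_mul_swap hpq (by rw [hxq]; exact hxp.trans_lt hpq)]
    have hcount : (Finset.univ.filter fun m => p < m ∧ m < q ∧ x p < x m ∧ x m < x q) =
        Finset.Ioo p q := by
      ext m
      simp only [Finset.mem_filter, Finset.mem_univ, true_and, Finset.mem_Ioo]
      constructor
      · exact fun h => ⟨h.1, h.2.1⟩
      · rintro ⟨h1, h2⟩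
        rw [hxm m h1, hxq]
        exact ⟨h1, h2, hxp.trans_lt h1, h2⟩
    have hset : {y | (y ∈ Out 1 v I 1 ∧ BruhatLE y z) ∧ ∀ u ∈ Y, ¬ BruhatLE y u} =
        {y | y ∈ Out 1 v I 1 ∧ BruhatLE y z} := by
      ext y
      simp only [Set.mem_ofPred_eq, and_iff_left_iff_imp]
      rintro ⟨hy, hyz⟩ u hu hyu
      obtain ⟨i, c, d, o⟩ := exists_outAt hI hy
      obtain ⟨k, e, f, ou, h1, h2⟩ := hr u hu
      have h3 := ((o.le_iff ou).1 hyu).2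
      have h4 := ((o.le_iff oz).1 hyz).1
      have hfm := hA u hu f (h4.trans_lt (o.lt.trans_le h3))
      rw [ou.eq, swap_apply_right] at hfm
      exact ou.lt.ne hfm
    rw [hcount, hset, oz.ncard_out_le hI, Fin.card_Ioo]
    omega
  · push Not at hA
    obtain ⟨u₀, hu₀, m₀, hm₀, hum⟩ := hA
    obtain ⟨i, a, b, o₀, ha, hb⟩ := hr u₀ hu₀
    obtain rfl : b = m₀ := by
      by_contra hc
      exact hum (o₀.apply_of_ne (ha.trans hm₀).ne' (Ne.symm hc))
    obtain rfl : i = j := by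
      rcases lt_trichotomy i j with h | h | h
      · exact absurd (o₀.ordered hI oz h) (not_le.2 hm₀)
      · exact h
      · exact absurd (oz.ordered hI o₀ h) (not_le.2 (ha.trans hpq))
    obtain ⟨hbj, hpj⟩ := o₀.same_cut hI oz ha hb
    -- An element to the right of `u₀` would cross the same cut and start at `j = p`, although all
    -- of `Y` starts before `p`.
    have hother : ∀ u ∈ Y, u ≠ u₀ → ∃ k c d, OutAt v I k c d u ∧ c < a ∧ d ≤ a := by
      intro u hu hne
      obtain ⟨k, c, d, ou, h1, h2⟩ := hr u hu
      have i1 : ¬ BruhatLE u u₀ := hY.2 (by simp [hu]) (by simp [hu₀]) hne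
      have i2 : ¬ BruhatLE u₀ u := hY.2 (by simp [hu₀]) (by simp [hu]) hne.symm
      have l1 := ou.left_le
      have l2 := ou.lt_right
      rw [Fin.lt_def] at h1
      rcases ou.lt_or_lt o₀ i1 i2 with ⟨g1, g2⟩ | ⟨g1, g2⟩
      · rw [Fin.lt_def] at g2
        exact ⟨k, c, d, ou, g1, ou.ordered hI o₀ (by omega)⟩
      · have hk : k = i := by
          rcases lt_trichotomy k i with h | h | h
          · exact absurd (ou.ordered hI o₀ h) (not_le.2 (o₀.lt.trans g2))
          · exact h
          · have := Fin.le_def.1 (o₀.ordered hI ou h)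
            omega
        subst hk
        have := o₀.same_cut hI ou g1 g2
        omega
    have hxp : x p = p := hfix p fun u hu => by
      by_cases hne : u = u₀
      · subst hne; exact o₀.apply_of_ne ha.ne' hm₀.ne
      · obtain ⟨k, c, d, ou, h1, h2⟩ := hother u hu hne
        exact ou.apply_of_ne (h1.trans ha).ne' (h2.trans_lt ha).ne'
    have hxm : ∀ m, b < m → x m = m := fun m hm => hfix m fun u hu => by
      by_cases hne : u = u₀
      · subst hne; exact o₀.apply_of_ne (o₀.lt.trans hm).ne' hm.ne'
      · obtain ⟨k, c, d, ou, h1, h2⟩ := hother u hu hne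
        have hda := (h2.trans_lt o₀.lt).trans hm
        exact ou.apply_of_ne (ou.lt.trans hda).ne' hda.ne'
    -- `b` is the right endpoint of the rightmost element of `Y`, hence is moved by `θ(Y)`. Its
    -- value drops below `p`, so `b` is not counted.
    have hxb : x b ≠ b := by
      have hne : theta 1 v 1 Y b ≠ b := by
        rw [← Finset.insert_erase hu₀]
        refine theta_insert_apply_ne hI ?_ (Finset.notMem_erase _ _) o₀ fun u hu => ?_
        · rw [Finset.insert_erase hu₀]; exact Antichains.mono hY (Finset.subset_insert _ _)
        · obtain ⟨k, c, d, ou, h1, h2⟩ := hother u (Finset.mem_of_mem_erase hu)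
            (Finset.ne_of_mem_erase hu)
          exact ⟨k, c, d, ou, h1, h2.trans_lt o₀.lt⟩
      rcases hx with rfl | rfl
      · exact hne
      · intro hc
        rw [Perm.inv_eq_iff_eq] at hc
        exact hne hc.symm
    have hxb' : x b < p := by
      have h1 := apply_le_of_fixes hxm
      have h2 : x b ≠ p := fun h => hm₀.ne' (x.injective (h.trans hxp.symm))
      rw [Fin.le_def] at h1
      rw [Fin.lt_def]
      rw [Ne, Fin.ext_iff] at h2 hxb
      omega
    rw [length_mul_swap hpq (by rw [hxq, hxp]; exact hpq)]
    have hcount : (Finset.univ.filter fun m => p < m ∧ m < q ∧ x p < x m ∧ x m < x q) =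
        Finset.Ioo b q := by
      ext m
      simp only [Finset.mem_filter, Finset.mem_univ, true_and, Finset.mem_Ioo]
      constructor
      · rintro ⟨h1, h2, h3, h4⟩
        refine ⟨?_, h2⟩
        have hmb : m ≠ b := by
          rintro rfl
          rw [hxp] at h3
          exact absurd h3 (not_lt.2 hxb'.le)
        rw [Fin.lt_def] at h1 ⊢
        rw [Ne, Fin.ext_iff] at hmb
        omega
      · rintro ⟨h1, h2⟩
        rw [hxm m h1, hxq, hxp]
        exact ⟨hm₀.trans h1, h2, hm₀.trans h1, h2⟩
    have hset : {y | (y ∈ Out 1 v I 1 ∧ BruhatLE y z) ∧ ∀ u ∈ Y, ¬ BruhatLE y u} =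
        swap p '' (Finset.Ioc b q : Set (Fin n)) := by
      ext y
      rw [Set.mem_ofPred_eq, oz.mem_out_le_iff hI]
      simp only [Set.mem_image, Finset.coe_Ioc, Set.mem_Ioc]
      constructor
      · rintro ⟨⟨c, d, h1, h2, h3, h4, rfl⟩, h5⟩
        have hc : c = p := by rw [Fin.le_def] at h1; apply Fin.ext; omega
        subst hc
        refine ⟨d, ⟨?_, h2⟩, rfl⟩
        by_contra hbd
        refine h5 u₀ hu₀ ?_
        rw [o₀.eq, swap_le_swap_iff (by rw [Fin.lt_def]; omega) o₀.lt]
        exact ⟨ha.le, not_lt.1 hbd⟩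
      · rintro ⟨d, ⟨h1, h2⟩, rfl⟩
        refine ⟨⟨p, d, le_rfl, h2, by omega, by rw [Fin.lt_def] at h1; omega, rfl⟩, ?_⟩
        intro u hu hle
        have hpd : p < d := hm₀.trans h1
        by_cases hne : u = u₀
        · rw [hne, o₀.eq, swap_le_swap_iff hpd o₀.lt] at hle
          exact absurd h1 (not_lt.2 hle.2)
        · obtain ⟨k, c, e, ou, g1, g2⟩ := hother u hu hne
          rw [ou.eq, swap_le_swap_iff hpd ou.lt] at hle
          exact absurd (hpd.trans_le (hle.2.trans g2)) (not_lt.2 ha.le)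
    rw [hcount, hset, ncard_image_swap_left, Fin.card_Ioo, Fin.card_Ioc]
    rw [Fin.lt_def] at hb
    omega

theorem length_one : length (1 : Perm (Fin n)) = 0 := by
  rw [length, Finset.card_eq_zero, Finset.filter_eq_empty_iff]
  intro p _ h
  exact lt_asymm h.1 h.2

theorem length_theta_add_card (hI : IsHypercubeDecomposition 1 v I) (Y : Finset (Perm (Fin n)))
    (hY : Y ∈ Antichains 1 v I 1) :
    length (theta 1 v 1 Y) + Y.card = 2 * (Lam 1 v I 1 Y).ncard := by
  induction Y using Finset.strongInduction with
  | H Y ih =>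
  rcases Y.eq_empty_or_nonempty with rfl | hne
  · rw [((hI.cluster 1 hI.one_mem).cube_theta hY).bot]
    have h1 : Lam 1 v I 1 ∅ = ∅ := by ext; simp [Lam]
    simp [h1, length_one]
  obtain ⟨z, hz, j, p, q, oz, hr⟩ := exists_rightmost hI hY hne
  have hYz := Finset.insert_erase hz
  have h1 := ih (Y.erase z) (Finset.erase_ssubset hz) (Antichains.mono hY (Finset.erase_subset _ _))
  have h2 := length_theta_insert hI (Y := Y.erase z) (by rwa [hYz]) (Finset.notMem_erase z Y) oz
    fun u hu => hr u (Finset.mem_of_mem_erase hu) (Finset.ne_of_mem_erase hu)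
  have h3 := ncard_lam_insert (v := v) (I := I) (Y.erase z) z
  have h4 := Finset.card_erase_add_one hz
  rw [hYz] at h2 h3
  omega

theorem numericalCriterion_one (hI : IsHypercubeDecomposition 1 v I) :
    NumericalCriterion 1 v I 1 := by
  refine ⟨hI.cluster 1 hI.one_mem, fun Y hY => ?_⟩
  have h := length_theta_add_card hI Y hY
  have h2 : (length (theta 1 v 1 Y) : ℚ) + Y.card = 2 * (Lam 1 v I 1 Y).ncard := by exact_mod_cast h
  rw [length_one, Nat.cast_zero, sub_zero, h2]
  ring

/-! ### A reflection order adapted to a partition into intervals -/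

theorem swap_inj {a b c d : Fin n} (hab : a < b) (hcd : c < d) (h : swap a b = swap c d) :
    a = c ∧ b = d := by
  have h1 := (swap_le_swap_iff hab hcd).1 (by rw [h]; exact .refl)
  have h2 := (swap_le_swap_iff hcd hab).1 (by rw [h]; exact .refl)
  exact ⟨le_antisymm h2.1 h1.1, le_antisymm h1.2 h2.2⟩

theorem exists_swap_lt (t : Reflection n) : ∃ p : Fin n × Fin n, p.1 < p.2 ∧ t.1 = swap p.1 p.2 := by
  obtain ⟨t, a, b, hab, rfl⟩ := t
  rcases lt_or_gt_of_ne hab with h | h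
  · exact ⟨(a, b), h, rfl⟩
  · exact ⟨(b, a), h, swap_comm a b⟩

/-- The key by which the transposition `(a b)`, `a < b`, is sorted: first those inside a fibre of
`β`, lexicographically, then the others, by `a`, then by the fibre of `b`, then by decreasing `b`. -/
def sortKey (β : Fin n → ℕ) (p : Fin n × Fin n) : ℕ ×ₗ ℕ ×ₗ ℕ ×ₗ ℕ :=
  if β p.1 = β p.2 then toLex (0, toLex (p.1.val, toLex (0, p.2.val)))
  else toLex (1, toLex (p.1.val, toLex (β p.2, n - p.2.val)))

theorem sortKey_injective (β : Fin n → ℕ) : Function.Injective (sortKey β) := by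
  rintro ⟨a, b⟩ ⟨c, d⟩ h
  have hb := b.isLt
  have hd := d.isLt
  unfold sortKey at h
  split_ifs at h
  all_goals
    simp only [EmbeddingLike.apply_eq_iff_eq, Prod.mk.injEq] at h
    exact Prod.ext (Fin.ext h.2.1) (Fin.ext (by dsimp only; omega))

theorem sortKey_lt_iff (β : Fin n → ℕ) (a b c d : Fin n) :
    sortKey β (a, b) < sortKey β (c, d) ↔ (β a = β b ∧ β c ≠ β d) ∨
      (β a = β b ∧ β c = β d ∧ (a.val < c.val ∨ a.val = c.val ∧ b.val < d.val)) ∨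
      (β a ≠ β b ∧ β c ≠ β d ∧
        (a.val < c.val ∨ a.val = c.val ∧ (β b < β d ∨ β b = β d ∧ d.val < b.val))) := by
  have hb := b.isLt
  have hd := d.isLt
  simp only [sortKey]
  split_ifs <;> simp only [Prod.Lex.toLex_lt_toLex, true_and] <;> omega

/-- A total order on the transpositions, by `sortKey`. -/
def sortRel (β : Fin n → ℕ) (s t : Reflection n) : Prop :=
  sortKey β (exists_swap_lt s).choose < sortKey β (exists_swap_lt t).choose

theorem choose_swap_lt {t : Reflection n} {a b : Fin n} (hab : a < b) (ht : t.1 = swap a b) :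
    (exists_swap_lt t).choose = (a, b) := by
  have h := (exists_swap_lt t).choose_spec
  have := swap_inj h.1 hab (h.2.symm.trans ht)
  exact Prod.ext this.1 this.2

theorem sortRel_iff (β : Fin n → ℕ) {s t : Reflection n} {a b c d : Fin n} (hab : a < b)
    (hs : s.1 = swap a b) (hcd : c < d) (ht : t.1 = swap c d) :
    sortRel β s t ↔ sortKey β (a, b) < sortKey β (c, d) := by
  rw [sortRel, choose_swap_lt hab hs, choose_swap_lt hcd ht]

/-- For `a < b < c` the order is `ab, ac, bc`, except when exactly `b` and `c` share a fibre. Then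
`(b c)` comes first and the order must be `bc, ac, ab`, which is why `b` decreases in the last entry
of the key. -/
theorem isReflectionOrder_sortRel {β : Fin n → ℕ} (hβ : Monotone β) :
    IsReflectionOrder (sortRel β) := by
  refine ⟨?_, ?_⟩
  · have hinj : Function.Injective fun t : Reflection n => sortKey β (exists_swap_lt t).choose := by
      intro s t h
      have := sortKey_injective β h
      apply Subtype.ext
      rw [(exists_swap_lt s).choose_spec.2, (exists_swap_lt t).choose_spec.2, this]
    exact (RelEmbedding.mk ⟨_, hinj⟩ Iff.rfl :
      sortRel β ↪r (· < · : ℕ ×ₗ ℕ ×ₗ ℕ ×ₗ ℕ → ℕ ×ₗ ℕ ×ₗ ℕ ×ₗ ℕ → Prop)).isStrictTotalOrder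
  · intro a b c hab hbc
    have hac := hab.trans hbc
    rw [sortRel_iff β hab rfl hac rfl, sortRel_iff β hac rfl hbc rfl, sortRel_iff β hbc rfl hac rfl,
      sortRel_iff β hac rfl hab rfl]
    have h1 := hβ hab.le
    have h2 := hβ hbc.le
    rw [Fin.lt_def] at hab hbc
    simp only [sortKey_lt_iff, true_and]
    omega

theorem sortRel_of_eq_of_ne {β : Fin n → ℕ} {s t : Reflection n} {a b c d : Fin n} (hab : a < b)
    (hs : s.1 = swap a b) (hcd : c < d) (ht : t.1 = swap c d) (h1 : β a = β b) (h2 : β c ≠ β d) :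
    sortRel β s t := by
  rw [sortRel_iff β hab hs hcd ht, sortKey_lt_iff]
  exact .inl ⟨h1, h2⟩

-- The fibres of `β`, which counts the cuts before a point, are the blocks of the Young subgroup.
-- One order, with the reflections inside blocks first, serves every `x`.
open Classical in
theorem propertyE (hI : IsHypercubeDecomposition 1 v I) : PropertyE v I := by
  intro x _
  set β : Fin n → ℕ := fun a => ((Finset.range a.val).filter (IsCut v I)).card with hβ
  have hmono : Monotone β := fun a b hab =>
    Finset.card_le_card (Finset.filter_subset_filter _ (Finset.range_mono hab))
  refine ⟨sortRel β, isReflectionOrder_sortRel hmono, ?_⟩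
  rintro x₁ ⟨hx1, -⟩ x₂ ⟨hx2, -⟩ x₃ ⟨hx3, -⟩ y ⟨⟨-, hyv⟩, hy⟩ h₁ h₂
  obtain ⟨⟨a, b⟩, hab, e1⟩ := exists_swap_lt ⟨x₂ * x₁⁻¹, h₁.1⟩
  obtain ⟨⟨c, d⟩, hcd, e2⟩ := exists_swap_lt ⟨y * x₃⁻¹, h₂.1⟩
  refine sortRel_of_eq_of_ne hab e1 hcd e2 ?_ ?_
  · have : (Finset.range a.val).filter (IsCut v I) = (Finset.range b.val).filter (IsCut v I) := by
      ext j
      simp only [Finset.mem_filter, Finset.mem_range, and_congr_left_iff]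
      intro hj
      refine ⟨fun h => h.trans hab, fun h => ?_⟩
      by_contra hc
      have hcr : Crosses (x₂ * x₁⁻¹) j := by
        dsimp only at e1; rw [e1, crosses_swap hab]; exact ⟨not_lt.1 hc, h⟩
      rcases hcr.of_mul with h | h
      · exact hI.not_crosses hx2 hj h
      · exact hI.not_crosses hx1 hj (by simpa using h.inv)
    simp only [hβ, this]
  -- As `y` crosses a cut and `x₃` does not, the label of `x₃ → y` crosses that cut, so its two
  -- points lie in different blocks.
  · obtain ⟨j, hj, hjy⟩ := hI.exists_cut hyv hy
    have hcr : Crosses (swap c d) j := by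
      dsimp only at e2; rw [← e2]
      have : Crosses (y * x₃⁻¹ * x₃) j := by simpa using hjy
      exact this.of_mul.resolve_right (hI.not_crosses hx3 hj)
    rw [crosses_swap hcd] at hcr
    refine (Finset.card_lt_card ⟨Finset.filter_subset_filter _ (Finset.range_mono hcd.le), ?_⟩).ne
    intro h
    have := h (Finset.mem_filter.2 ⟨Finset.mem_range.2 hcr.2, hj⟩)
    have := Finset.mem_range.1 (Finset.mem_filter.1 this).1
    omega

end BruhatCube

theorem theorem4p1 (n : ℕ) (v : Equiv.Perm (Fin n)) (I : Set (Equiv.Perm (Fin n)))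
    (hI : BruhatCube.IsHypercubeDecomposition 1 v I) :
    BruhatCube.PropertyE v I ∧
      BruhatCube.IsStrongCluster 1 v I 1 ∧
      BruhatCube.NumericalCriterion 1 v I 1 :=
  ⟨BruhatCube.propertyE hI, BruhatCube.isStrongCluster_one hI, BruhatCube.numericalCriterion_one hI⟩
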